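/- Let $\mathcal T$ be the surface of the regular tetrahedron with edges of length $1$, represented by its planar net: the closed equilateral triangle $D$ with corners $(0,0)$, $(2,0)$, $(1,\sqrt3)$, in which every point $x$ of a side with endpoints $A,B$ is identified with $A+B-x$. The vertices of $\mathcal T$ are the images of the three corners of $D$ (one vertex) and of the midpoints of its three sides. For real $\mu$, a solution of $-\Delta u=\mu u$ on $\mathcal T$ is a continuous function $u:\mathcal T\to\mathbb C$ which on $D$ is twice continuously differentiable up to the sides except at the vertices, satisfies $-\Delta u=\mu u$ in the interior of $D$ ($\Delta$ being the Laplacian of the plane), and whose normal derivatives along identified parts of the sides match, i.e. the outward normal derivatives at $x$ and at the point identified with $x$ add up to zero (no equation is imposed at the vertices). Let $T=\mathbb R^2/\Lambda$ be the covering hexagonal torus, $\Lambda=\mathbb Z(2,0)+\mathbb Z(1,\sqrt3)$, and let $R:T\to T$, $R(x)=-x$, be the half-turn; it is induced by the rotation by $180^\circ$ about the centre of the period parallelogram. Solutions of $-\Delta u=\mu u$ on $T$ are the functions $u:T\to\mathbb C$ of class $C^2$ satisfying this equation. In both cases the eigenspace of $\mu$ is the complex vector space of all solutions, and $\mu$ is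 an eigenvalue if it is not zero. Let $N(t)$ and $N_T(t)$ be the numbers of eigenvalues $\mu\le t$, counted with multiplicity (the dimension of the eigenspace), on $\mathcal T$ and on $T$. Then, both on $\mathcal T$ and on $T$, all eigenspaces have finite dimension and there are only finitely many eigenvalues $\mu\le t$ for every $t$. Every eigenspace of $T$ is the direct sum of its subspace of functions symmetric under $R$ ($u\circ R=u$) and its subspace of functions skew-symmetric under $R$ ($u\circ R=-u$). The eigenspace of $\mu=0$ on $T$ consists of the constants, and for every $\mu\ne0$ these two subspaces have the same dimension. Moreover, for all $t\ge0$, $$N(t)=\tfrac12 N_T(t)+\tfrac12 .$$ -/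

import Mathlib

open scoped InnerProductSpace

noncomputable section

namespace TetrahedronSpectrum

/-- The Euclidean plane. -/
abbrev Plane : Type := EuclideanSpace ℝ (Fin 2)

/-! ### The surface of the regular tetrahedron with edges of length one

The net is the equilateral triangle of side two, which consists of four unit triangles (the faces).
Each of its three sides is folded at its midpoint, so that the two halves of the side are glued
to one another by the half-turn about the midpoint. -/

/-- The corners of the net. -/
def netCorner : Fin 3 → Plane := ![!₂[0, 0], !₂[2, 0], !₂[1, √3]]

/-- The net of the tetrahedron: the (closed) equilateral triangle of side two. -/
def net : Set Plane := convexHull ℝ (Set.range netCorner)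

/-- The side of the net opposite to the corner `netCorner k`. -/
def netSide (k : Fin 3) : Set Plane := segment ℝ (netCorner (k + 1)) (netCorner (k + 2))

/-- The half-turn about the midpoint of the `k`-th side: it glues the halves of this side. -/
def sideFlip (k : Fin 3) (x : Plane) : Plane := netCorner (k + 1) + netCorner (k + 2) - x

/-- The outward unit normal along the `k`-th side: the direction of the altitude, which has
length `√3`, from the opposite corner to the midpoint of the side. -/
def outwardNormal (k : Fin 3) : Plane :=
  (√3)⁻¹ • (midpoint ℝ (netCorner (k + 1)) (netCorner (k + 2)) - netCorner k)

/-- The points of the net that become vertices of the tetrahedron: the three corners of the net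
(all glued to one vertex; the case `i = j`) and the midpoints of its three sides. -/
def netVertices : Set Plane := {x | ∃ i j : Fin 3, x = midpoint ℝ (netCorner i) (netCorner j)}

/-- The identifications on the boundary of the net. -/
def glue (x y : net) : Prop :=
  ∃ k : Fin 3, (x : Plane) ∈ netSide k ∧ (y : Plane) = sideFlip k x

/-- The surface of the tetrahedron, with the quotient topology of the net. -/
abbrev Tetrahedron : Type := Quot glue

open Classical in
/-- A function on the tetrahedron read on the net (and extended by the irrelevant value zero
to the rest of the plane). -/
def onNet (u : Tetrahedron → ℂ) (x : Plane) : ℂ :=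
  if h : x ∈ net then u (Quot.mk glue ⟨x, h⟩) else 0

/-- `u` solves `-Δ u = μ u` on the surface of the tetrahedron: `u` is continuous on the surface
(also at the vertices, where no equation is imposed; the values along identified edges match
because `u` is a function on the quotient), it is twice continuously differentiable on the net up to
its edges except at the vertices, the equation holds inside the net, and the normal derivatives along
identified edges match: the outward derivative at a point is the inward derivative
at the point with which it is identified. -/
structure SolvesOnTetrahedron (μ : ℝ) (u : Tetrahedron → ℂ) : Prop where
  continuous : Continuous u
  contDiffOn : ContDiffOn ℝ 2 (onNet u) (net \ netVertices)
  equation : ∀ x ∈ interior (net \ netVertices),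
    -Laplacian.laplacian (onNet u) x = (μ : ℂ) * onNet u x
  normal_match : ∀ k : Fin 3, ∀ x ∈ netSide k, x ∉ netVertices → sideFlip k x ∉ netVertices →
    fderivWithin ℝ (onNet u) net x (outwardNormal k) =
      -fderivWithin ℝ (onNet u) net (sideFlip k x) (outwardNormal k)

/-! ### The hexagonal torus -/

/-- The lattice generated by `(2, 0)` and `(1, √3)`. -/
def torusLattice : AddSubgroup Plane := AddSubgroup.closure {!₂[2, 0], !₂[1, √3]}

/-- The hexagonal torus. -/
abbrev Torus : Type := Plane ⧸ torusLattice

/-- A function on the torus read as a periodic function on the plane. -/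
def onPlane (u : Torus → ℂ) (x : Plane) : ℂ := u (QuotientAddGroup.mk x)

/-- `u` solves `-Δ u = μ u` on the torus. -/
structure SolvesOnTorus (μ : ℝ) (u : Torus → ℂ) : Prop where
  contDiff : ContDiff ℝ 2 (onPlane u)
  equation : ∀ x, -Laplacian.laplacian (onPlane u) x = (μ : ℂ) * onPlane u x

/-- The half-turn of the torus whose quotient is the tetrahedron. On the plane it is
`x ↦ 2 c - x` with `c` the centre of the period parallelogram; as `2 c = (2, 0) + (1, √3)` is a
period, on the torus it is `x ↦ -x`. -/
def halfTurn (x : Torus) : Torus := -x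

/-! ### Eigenspaces -/

theorem onNet_add (u v : Tetrahedron → ℂ) : onNet (u + v) = onNet u + onNet v := by
  funext x
  by_cases h : x ∈ net <;> simp [onNet, h]

theorem onNet_smul (c : ℂ) (u : Tetrahedron → ℂ) : onNet (c • u) = c • onNet u := by
  funext x
  by_cases h : x ∈ net <;> simp [onNet, h]

theorem onNet_zero : onNet 0 = 0 := by
  funext x
  simp [onNet]

theorem onPlane_add (u v : Torus → ℂ) : onPlane (u + v) = onPlane u + onPlane v := rfl

theorem onPlane_smul (c : ℂ) (u : Torus → ℂ) : onPlane (c • u) = c • onPlane u := rfl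

theorem onPlane_zero : onPlane 0 = 0 := rfl

theorem laplacian_complex_smul {f : Plane → ℂ} {x : Plane} (c : ℂ) (hf : ContDiffAt ℝ 2 f x) :
    Laplacian.laplacian (c • f) x = c * Laplacian.laplacian f x := by
  have h := hf.laplacian_CLM_comp_left (l := c • ContinuousLinearMap.id ℝ ℂ)
  have e : (c • ContinuousLinearMap.id ℝ ℂ : ℂ →L[ℝ] ℂ) ∘ f = c • f := by
    funext y
    simp
  rw [e] at h
  simpa using h

theorem interior_net_nonempty : (interior net).Nonempty := by
  have h3 : 0 < √3 := by positivity
  have hs : √3 * √3 = 3 := Real.mul_self_sqrt (by norm_num)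
  let S : Set Plane := {x | 0 < x 1 ∧ x 1 < √3 * x 0 ∧ x 1 < √3 * (2 - x 0)}
  have hS : IsOpen S := by
    have o0 : IsOpen {x : Plane | 0 < x 1} := isOpen_lt (by fun_prop) (by fun_prop)
    have o1 : IsOpen {x : Plane | x 1 < √3 * x 0} := isOpen_lt (by fun_prop) (by fun_prop)
    have o2 : IsOpen {x : Plane | x 1 < √3 * (2 - x 0)} := isOpen_lt (by fun_prop) (by fun_prop)
    exact o0.inter (o1.inter o2)
  have hsub : S ⊆ net := by
    rintro x ⟨h0, h1, h2⟩
    have hc : ∀ i, netCorner i ∈ net := fun i => subset_convexHull ℝ _ ⟨i, rfl⟩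
    have hx : x = ∑ i : Fin 3,
        (![1 - x 0 / 2 - x 1 / (2 * √3), x 0 / 2 - x 1 / (2 * √3), x 1 / √3] : Fin 3 → ℝ) i •
          netCorner i := by
      ext i
      fin_cases i
      · simp [Fin.sum_univ_three, netCorner]
        field_simp
        ring
      · simp [Fin.sum_univ_three, netCorner]
    rw [hx]
    refine (convex_convexHull ℝ _).sum_mem ?_ ?_ (fun i _ => hc i)
    · intro i _
      have e1 : x 1 / (2 * √3) * (2 * √3) = x 1 := by field_simp
      have e2 : 0 < x 1 / (2 * √3) := by positivity
      have e3 : 0 < x 1 / √3 := by positivity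
      fin_cases i
      · simp
        nlinarith
      · simp
        nlinarith
      · simpa using e3.le
    · simp [Fin.sum_univ_three]
      field_simp
      ring
  refine ⟨!₂[1, √3 / 2], mem_interior.2 ⟨S, hsub, hS, ?_⟩⟩
  simp only [S, Set.mem_ofPred_eq]
  refine ⟨?_, ?_, ?_⟩ <;> simp <;> linarith

theorem uniqueDiffOn_net : UniqueDiffOn ℝ net :=
  uniqueDiffOn_convex (convex_convexHull ℝ _) interior_net_nonempty

theorem netSide_subset_net (k : Fin 3) : netSide k ⊆ net :=
  segment_subset_convexHull ⟨_, rfl⟩ ⟨_, rfl⟩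

theorem sideFlip_mem_net {k : Fin 3} {x : Plane} (hx : x ∈ netSide k) : sideFlip k x ∈ net := by
  obtain ⟨a, b, ha, hb, hab, rfl⟩ := hx
  refine netSide_subset_net k ⟨b, a, hb, ha, by linarith, ?_⟩
  obtain rfl : b = 1 - a := by linarith
  simp only [sideFlip]
  module

theorem finite_netVertices : netVertices.Finite := by
  have : netVertices =
      Set.range fun p : Fin 3 × Fin 3 => midpoint ℝ (netCorner p.1) (netCorner p.2) := by
    ext x
    simp [netVertices, eq_comm]
  rw [this]
  exact Set.finite_range _

theorem differentiableWithinAt_net {f : Plane → ℂ} (hf : ContDiffOn ℝ 2 f (net \ netVertices))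
    {x : Plane} (hx : x ∈ net) (hv : x ∉ netVertices) : DifferentiableWithinAt ℝ f net x := by
  have h := (hf x ⟨hx, hv⟩).differentiableWithinAt (by norm_num)
  have hn : netVerticesᶜ ∈ nhds x := finite_netVertices.isClosed.isOpen_compl.mem_nhds hv
  rw [Set.sdiff_eq] at h
  exact (differentiableWithinAt_inter hn).1 h

theorem contDiffAt_of_mem_interior {f : Plane → ℂ} {s : Set Plane} (hf : ContDiffOn ℝ 2 f s)
    {x : Plane} (hx : x ∈ interior s) : ContDiffAt ℝ 2 f x :=
  hf.contDiffAt (mem_interior_iff_mem_nhds.1 hx)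

/-- The space of solutions of `-Δ u = μ u` on the tetrahedron, the eigenspace of `μ` if it is not
zero. -/
def tetrahedronEigenspace (μ : ℝ) : Submodule ℂ (Tetrahedron → ℂ) where
  carrier := {u | SolvesOnTetrahedron μ u}
  zero_mem' := by
    refine ⟨continuous_const, ?_, ?_, ?_⟩
    · rw [onNet_zero]
      exact contDiffOn_const
    · intro x _
      rw [onNet_zero]
      simp [Pi.zero_def]
    · intro k x _ _ _
      simp [onNet_zero]
  add_mem' := by
    rintro u v hu hv
    refine ⟨hu.continuous.add hv.continuous, ?_, ?_, ?_⟩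
    · rw [onNet_add]
      exact hu.contDiffOn.add hv.contDiffOn
    · intro x hx
      have hx' := contDiffAt_of_mem_interior hu.contDiffOn hx
      rw [onNet_add, hx'.laplacian_add (contDiffAt_of_mem_interior hv.contDiffOn hx), Pi.add_apply,
        mul_add, ← hu.equation x hx, ← hv.equation x hx]
      ring
    · intro k x hx hxv hyv
      have hy := sideFlip_mem_net hx
      have hx' := netSide_subset_net k hx
      rw [onNet_add, fderivWithin_add (uniqueDiffOn_net x hx')
          (differentiableWithinAt_net hu.contDiffOn hx' hxv)
          (differentiableWithinAt_net hv.contDiffOn hx' hxv),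
        fderivWithin_add (uniqueDiffOn_net _ hy)
          (differentiableWithinAt_net hu.contDiffOn hy hyv)
          (differentiableWithinAt_net hv.contDiffOn hy hyv),
        add_apply, add_apply,
        hu.normal_match k x hx hxv hyv, hv.normal_match k x hx hxv hyv]
      ring
  smul_mem' := by
    rintro c u hu
    refine ⟨hu.continuous.const_smul c, ?_, ?_, ?_⟩
    · rw [onNet_smul]
      exact hu.contDiffOn.const_smul c
    · intro x hx
      rw [onNet_smul, laplacian_complex_smul c (contDiffAt_of_mem_interior hu.contDiffOn hx),
        Pi.smul_apply, smul_eq_mul, mul_left_comm, ← hu.equation x hx]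
      ring
    · intro k x hx hxv hyv
      have hy := sideFlip_mem_net hx
      have hx' := netSide_subset_net k hx
      rw [onNet_smul, fderivWithin_const_smul (uniqueDiffOn_net x hx')
          (differentiableWithinAt_net hu.contDiffOn hx' hxv),
        fderivWithin_const_smul (uniqueDiffOn_net _ hy)
          (differentiableWithinAt_net hu.contDiffOn hy hyv),
        smul_apply, smul_apply,
        hu.normal_match k x hx hxv hyv, smul_neg]

/-- The space of solutions of `-Δ u = μ u` on the torus, the eigenspace of `μ` if it is not
zero. -/
def torusEigenspace (μ : ℝ) : Submodule ℂ (Torus → ℂ) where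
  carrier := {u | SolvesOnTorus μ u}
  zero_mem' := by
    refine ⟨?_, ?_⟩
    · rw [onPlane_zero]
      exact contDiff_const
    · intro x
      rw [onPlane_zero]
      simp [Pi.zero_def]
  add_mem' := by
    rintro u v hu hv
    refine ⟨hu.contDiff.add hv.contDiff, ?_⟩
    intro x
    rw [onPlane_add, hu.contDiff.contDiffAt.laplacian_add hv.contDiff.contDiffAt, Pi.add_apply,
      mul_add, ← hu.equation x, ← hv.equation x]
    ring
  smul_mem' := by
    rintro c u hu
    refine ⟨hu.contDiff.const_smul c, ?_⟩
    intro x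
    rw [onPlane_smul, laplacian_complex_smul c hu.contDiff.contDiffAt,
      Pi.smul_apply, smul_eq_mul, mul_left_comm, ← hu.equation x]
    ring

/-- The functions on the torus that are symmetric under the half-turn. -/
def symmetricFunctions : Submodule ℂ (Torus → ℂ) where
  carrier := {u | ∀ x, u (halfTurn x) = u x}
  zero_mem' := fun _ => rfl
  add_mem' := fun hu hv x => by simp [hu x, hv x]
  smul_mem' := fun c u hu x => by simp [hu x]

/-- The functions on the torus that are skew-symmetric under the half-turn. -/
def skewFunctions : Submodule ℂ (Torus → ℂ) where
  carrier := {u | ∀ x, u (halfTurn x) = -u x}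
  zero_mem' := fun _ => by simp
  add_mem' := fun hu hv x => by simp [hu x, hv x, add_comm]
  smul_mem' := fun c u hu x => by simp [hu x]

/-- For a family of eigenspaces, the number of eigenvalues `μ ≤ t`, counted with multiplicity.
(The sum has its intended meaning if there are finitely many eigenvalues `μ ≤ t` and their
eigenspaces have finite dimension, that is, if the family satisfies `HasDiscreteSpectrum`.) -/
def countingFunction {F : Type*} [AddCommGroup F] [Module ℂ F] (V : ℝ → Submodule ℂ F) (t : ℝ) :
    ℕ :=
  ∑ᶠ (μ : ℝ) (_ : μ ≤ t), Module.finrank ℂ (V μ)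

/-- All eigenspaces have finite dimension, and there are finitely many eigenvalues below any
bound. -/
def HasDiscreteSpectrum {F : Type*} [AddCommGroup F] [Module ℂ F] (V : ℝ → Submodule ℂ F) : Prop :=
  (∀ μ, FiniteDimensional ℂ (V μ)) ∧ ∀ t : ℝ, {μ : ℝ | μ ≤ t ∧ V μ ≠ ⊥}.Finite

end TetrahedronSpectrum

end

open TetrahedronSpectrum

namespace TetrahedronSpectrum

open MeasureTheory Set

/-! ### The divergence theorem on a triangle and on a square -/

/-! The tetrahedron is the quotient of the torus by the half-turn: the folding of each side of the
net is `x ↦ l - x` with a period `l`, so a function on the tetrahedron lifts to an even periodic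
function on the plane. Its spectrum should therefore be the even part of the spectrum of the torus.
Lifting a solution directly would require a removable singularity theorem at the vertices, where
only continuity is known. The proof avoids this by comparing dimensions.

Upper bounds. The plane waves on the torus, and the sums of opposite waves on the tetrahedron, span
star algebras which separate points. By Stone-Weierstrass, a continuous function whose integrals
against all of them vanish is zero (`IsSeparatingFamily.eq_zero`). By Green's formula an
eigenfunction for `μ` has zero integral against every wave with eigenvalue different from `μ`, so
the multiplicity is at most the number of waves with eigenvalue `μ`
(`IsSeparatingFamily.finrank_le`). On the tetrahedron, and on the symmetric or the skew part of the
torus, the coefficients of opposite waves determine one another. For `μ ≠ 0` this halves the bound,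
to `(halfIndices μ).card`. The pairing is bilinear, without conjugation; this is harmless as the
families are closed under conjugation up to span.

Lower bounds. Waves are distinct characters, hence independent, which gives the exact multiplicity
on the torus (`finrank_torusEigenspace`). The two parts have at most half of this dimension each and
together all of it, so each has exactly half. Symmetric eigenfunctions on the torus descend
injectively to the tetrahedron (`descend_injective`, `descend_mem`), which closes the gap there. For
`μ = 0` both multiplicities are one, and this is the source of the summand `1/2` in the counting
formula.

The analytic core is Green's formula on the tetrahedron (`NetFunction.green`). A combination of four
even waves takes the same values at the vertices as `u`; after subtracting it, `u` vanishes there.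
Green's formula is then applied to `u` and `η φ`, with `η` vanishing near the vertices and equal to
one at distance `ε`. All derivatives of `η` stand beside `u` itself: the error is `o(1)` from `u`,
times `ε⁻²` from second derivatives of `η`, times an area of order `ε²`. No bound for the gradient
of `u` is needed (`setIntegral_tri_green_of_vanish`). -/

/-- The standard triangle, in which the net is read. -/
def tri : Set (ℝ × ℝ) := {z | 0 ≤ z.1 ∧ 0 ≤ z.2 ∧ z.1 + z.2 ≤ 1}

/-- The interior of the standard triangle. -/
def openTri : Set (ℝ × ℝ) := {z | 0 < z.1 ∧ 0 < z.2 ∧ z.1 + z.2 < 1}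

theorem isClosed_tri : IsClosed tri :=
  (isClosed_le continuous_const continuous_fst).inter
    ((isClosed_le continuous_const continuous_snd).inter
      (isClosed_le (continuous_fst.add continuous_snd) continuous_const))

theorem isOpen_openTri : IsOpen openTri :=
  (isOpen_lt continuous_const continuous_fst).inter
    ((isOpen_lt continuous_const continuous_snd).inter
      (isOpen_lt (continuous_fst.add continuous_snd) continuous_const))

theorem tri_subset_Icc : tri ⊆ Icc (0, 0) (1, 1) := by
  rintro ⟨s, t⟩ ⟨h0, h1, h2⟩
  simp only at h0 h1 h2
  exact ⟨⟨h0, h1⟩, ⟨by simp only; linarith, by simp only; linarith⟩⟩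

theorem isCompact_tri : IsCompact tri :=
  isCompact_Icc.of_isClosed_subset isClosed_tri tri_subset_Icc

theorem openTri_subset_tri : openTri ⊆ tri := fun _ h => ⟨h.1.le, h.2.1.le, h.2.2.le⟩

theorem tri_subset_closure_openTri : tri ⊆ closure openTri := by
  rintro ⟨s, t⟩ ⟨h0, h1, h2⟩
  simp only at h0 h1 h2
  rw [mem_closure_iff_seq_limit]
  -- The point is pulled towards the interior point `(1/3, 1/3)`, with weight `1 / (n + 1)`.
  refine ⟨fun n => (s + (1 / 3 - s) * (1 / ((n : ℝ) + 1)), t + (1 / 3 - t) * (1 / ((n : ℝ) + 1))),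
    fun n => ?_, ?_⟩
  · have hn : 0 < 1 / ((n : ℝ) + 1) := by positivity
    have hn' : 1 / ((n : ℝ) + 1) ≤ 1 := by
      rw [div_le_one (by positivity)]
      linarith [(Nat.cast_nonneg n : (0 : ℝ) ≤ n)]
    have hs := mul_nonneg h0 (sub_nonneg.2 hn')
    have ht := mul_nonneg h1 (sub_nonneg.2 hn')
    have hst := mul_nonneg (sub_nonneg.2 h2) (sub_nonneg.2 hn')
    refine ⟨?_, ?_, ?_⟩ <;> simp only <;> linarith
  · have h := tendsto_one_div_add_atTop_nhds_zero_nat (𝕜 := ℝ)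
    rw [nhds_prod_eq]
    refine Filter.Tendsto.prodMk ?_ ?_
    · simpa using (h.const_mul (1 / 3 - s)).const_add s
    · simpa using (h.const_mul (1 / 3 - t)).const_add t

theorem tri_subset_closure_interior : tri ⊆ closure (interior tri) :=
  tri_subset_closure_openTri.trans
    (closure_mono (interior_maximal openTri_subset_tri isOpen_openTri))

theorem setIntegral_tri_eq_iterated {F : ℝ × ℝ → ℂ} (hF : ContinuousOn F tri) :
    ∫ z in tri, F z = ∫ t in (0 : ℝ)..1, ∫ s in (0 : ℝ)..(1 - t), F (s, t) := by
  have hint : IntegrableOn F tri := hF.integrableOn_compact isCompact_tri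
  rw [← integral_indicator isClosed_tri.measurableSet]
  rw [Measure.volume_eq_prod, integral_prod_symm _ (by
    rw [← Measure.volume_eq_prod]
    exact (integrable_indicator_iff isClosed_tri.measurableSet).2 hint)]
  have key : ∀ t : ℝ, ∫ s, tri.indicator F (s, t) =
      (Icc (0 : ℝ) 1).indicator (fun t => ∫ s in (0 : ℝ)..(1 - t), F (s, t)) t := by
    intro t
    by_cases ht : t ∈ Icc (0 : ℝ) 1
    · rw [indicator_of_mem ht, intervalIntegral.integral_of_le (by linarith [ht.2]),
        ← integral_Icc_eq_integral_Ioc, ← integral_indicator measurableSet_Icc]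
      congr 1
      funext s
      by_cases hs : s ∈ Icc 0 (1 - t)
      · rw [indicator_of_mem hs, indicator_of_mem]
        exact ⟨hs.1, ht.1, by simp only; linarith [hs.2]⟩
      · rw [indicator_of_notMem hs, indicator_of_notMem]
        rintro ⟨h0, h1, h2⟩
        exact hs ⟨h0, by simp only at h2; linarith⟩
    · rw [indicator_of_notMem ht]
      rw [← integral_zero ℝ ℂ]
      congr 1
      funext s
      rw [indicator_of_notMem]
      rintro ⟨h0, h1, h2⟩
      simp only at h0 h1 h2
      exact ht ⟨h1, by linarith⟩
  simp_rw [key]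
  rw [integral_indicator measurableSet_Icc, intervalIntegral.integral_of_le zero_le_one,
    integral_Icc_eq_integral_Ioc]

theorem setIntegral_tri_swap (F : ℝ × ℝ → ℂ) :
    ∫ z in tri, F z.swap = ∫ z in tri, F z := by
  have h := (Measure.measurePreserving_swap (μ := (volume : Measure ℝ))
    (ν := (volume : Measure ℝ))).setIntegral_preimage_emb
      MeasurableEquiv.prodComm.measurableEmbedding F tri
  rw [← Measure.volume_eq_prod] at h
  rw [← h]
  congr 2
  ext z
  simp only [tri, mem_preimage, mem_ofPred_eq, Prod.fst_swap, Prod.snd_swap]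
  constructor <;> rintro ⟨h0, h1, h2⟩ <;> exact ⟨h1, h0, by linarith⟩

/-- Fubini and the fundamental theorem of calculus on each horizontal slice. The latter needs
derivatives only inside the slice, so nothing is asked of them on the sides beyond continuity of
`P'`. -/
theorem setIntegral_tri_partial {P P' : ℝ × ℝ → ℂ} (hP : ContinuousOn P tri)
    (hP' : ContinuousOn P' tri)
    (hd : ∀ z ∈ openTri, HasDerivAt (fun x => P (x, z.2)) (P' z) z.1) :
    ∫ z in tri, P' z = ∫ t in (0 : ℝ)..1, (P (1 - t, t) - P (0, t)) := by
  rw [setIntegral_tri_eq_iterated hP']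
  rw [intervalIntegral.integral_of_le zero_le_one, intervalIntegral.integral_of_le zero_le_one]
  refine setIntegral_congr_fun measurableSet_Ioc fun t ht => ?_
  have hmap : MapsTo (fun s : ℝ => (s, t)) (Icc 0 (1 - t)) tri := fun s hs =>
    ⟨hs.1, ht.1.le, by simp only; linarith [hs.2]⟩
  have hc : ContinuousOn (fun s : ℝ => (s, t)) (Icc 0 (1 - t)) := by fun_prop
  have h01 : (0 : ℝ) ≤ 1 - t := by linarith [ht.2]
  exact intervalIntegral.integral_eq_sub_of_hasDerivAt_of_le h01 (hP.comp hc hmap)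
    (fun s hs => hd (s, t) ⟨hs.1, ht.1, by simp only; linarith [hs.2]⟩)
    ((hP'.comp hc hmap).intervalIntegrable_of_Icc h01)

/-- The substitution `t ↦ 1 - t`. Applied to the flux through a side, it is the cancellation of the
two halves of a folded side. -/
theorem intervalIntegral_eq_zero_of_antisymm {F : ℝ → ℂ}
    (hF : ∀ t ∈ Icc (0 : ℝ) 1, F (1 - t) = -F t) : ∫ t in (0 : ℝ)..1, F t = 0 := by
  have h1 : ∫ t in (0 : ℝ)..1, F (1 - t) = ∫ t in (0 : ℝ)..1, F t := by
    simp
  have h2 : ∫ t in (0 : ℝ)..1, F (1 - t) = ∫ t in (0 : ℝ)..1, -F t :=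
    intervalIntegral.integral_congr fun t ht => hF t (by rwa [uIcc_of_le zero_le_one] at ht)
  rw [h1, intervalIntegral.integral_neg] at h2
  exact self_eq_neg.1 h2

/-- The divergence theorem on the triangle for a field whose normal components at the two halves
of each side cancel. -/
theorem setIntegral_tri_divergence_eq_zero {P Q P' Q' : ℝ × ℝ → ℂ} (hP : ContinuousOn P tri)
    (hQ : ContinuousOn Q tri) (hP' : ContinuousOn P' tri) (hQ' : ContinuousOn Q' tri)
    (hPd : ∀ z ∈ openTri, HasDerivAt (fun x => P (x, z.2)) (P' z) z.1)
    (hQd : ∀ z ∈ openTri, HasDerivAt (fun y => Q (z.1, y)) (Q' z) z.2)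
    (h1 : ∀ t ∈ Icc (0 : ℝ) 1, P (0, 1 - t) = -P (0, t))
    (h2 : ∀ t ∈ Icc (0 : ℝ) 1, Q (1 - t, 0) = -Q (t, 0))
    (h3 : ∀ t ∈ Icc (0 : ℝ) 1, P (1 - t, t) + Q (1 - t, t) = -(P (t, 1 - t) + Q (t, 1 - t))) :
    ∫ z in tri, (P' z + Q' z) = 0 := by
  have hswap : MapsTo Prod.swap tri tri := by
    rintro z ⟨a, b, c⟩
    exact ⟨b, a, by simpa [add_comm] using c⟩
  have hsc : ContinuousOn (Prod.swap : ℝ × ℝ → ℝ × ℝ) tri := continuous_swap.continuousOn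
  -- The `Q`-part is the `P`-part reflected in the diagonal.
  have hy := setIntegral_tri_partial (hQ.comp hsc hswap) (hQ'.comp hsc hswap)
    (fun z hz => hQd z.swap ⟨hz.2.1, hz.1, by simpa [add_comm] using hz.2.2⟩)
  simp only [Function.comp_apply, setIntegral_tri_swap Q', Prod.swap_prod_mk] at hy
  have cont : ∀ {F : ℝ × ℝ → ℂ} {g : ℝ → ℝ × ℝ}, ContinuousOn F tri → Continuous g →
      (∀ t ∈ Icc (0 : ℝ) 1, g t ∈ tri) →
      IntervalIntegrable (fun t => F (g t)) volume 0 1 := fun hF hg hm =>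
    (hF.comp hg.continuousOn hm).intervalIntegrable_of_Icc zero_le_one
  have m1 : ∀ t ∈ Icc (0 : ℝ) 1, ((1 - t, t) : ℝ × ℝ) ∈ tri := fun t ht =>
    ⟨by simp only; linarith [ht.2], ht.1, by simp⟩
  have m2 : ∀ t ∈ Icc (0 : ℝ) 1, ((t, 1 - t) : ℝ × ℝ) ∈ tri := fun t ht =>
    ⟨ht.1, by simp only; linarith [ht.2], by simp⟩
  have m3 : ∀ t ∈ Icc (0 : ℝ) 1, ((0, t) : ℝ × ℝ) ∈ tri := fun t ht =>
    ⟨le_rfl, ht.1, by simpa using ht.2⟩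
  have m4 : ∀ t ∈ Icc (0 : ℝ) 1, ((t, 0) : ℝ × ℝ) ∈ tri := fun t ht =>
    ⟨ht.1, le_rfl, by simpa using ht.2⟩
  rw [integral_add (hP'.integrableOn_compact isCompact_tri)
    (hQ'.integrableOn_compact isCompact_tri), setIntegral_tri_partial hP hP' hPd, hy,
    intervalIntegral.integral_sub (cont hP (by fun_prop) m1) (cont hP (by fun_prop) m3),
    intervalIntegral.integral_sub (cont hQ (by fun_prop) m2) (cont hQ (by fun_prop) m4),
    intervalIntegral_eq_zero_of_antisymm (F := fun t => P (0, t)) h1,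
    intervalIntegral_eq_zero_of_antisymm (F := fun t => Q (t, 0)) h2]
  -- The two partial integrations parametrise the slanted side in opposite directions; with a common
  -- parameter their boundary terms add up to the flux `P + Q`.
  have e : ∫ t in (0 : ℝ)..1, Q (t, 1 - t) = ∫ t in (0 : ℝ)..1, Q (1 - t, t) := by
    have h := intervalIntegral.integral_comp_sub_left (a := 0) (b := 1) (fun t => Q (1 - t, t)) 1
    simpa only [sub_sub_cancel, sub_zero, sub_self] using h
  rw [e, sub_zero, sub_zero, ← intervalIntegral.integral_add (cont hP (by fun_prop) m1)
    (cont hQ (by fun_prop) m1)]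
  refine intervalIntegral_eq_zero_of_antisymm fun t ht => ?_
  have := h3 t ht
  simp only [sub_sub_cancel]
  rw [this, neg_neg]

/-- The unit square. -/
def square : Set (ℝ × ℝ) := Icc (0 : ℝ) 1 ×ˢ Icc (0 : ℝ) 1

theorem isCompact_square : IsCompact square := isCompact_Icc.prod isCompact_Icc

theorem square_subset_closure_interior : square ⊆ closure (interior square) := by
  rw [square, interior_prod_eq, closure_prod_eq, interior_Icc, closure_Ioo zero_ne_one]

/-- The divergence theorem on the square for a periodic field. -/
theorem setIntegral_square_divergence_eq_zero {P Q P' Q' : ℝ × ℝ → ℂ}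
    (hP' : Continuous P') (hQ' : Continuous Q')
    (hPd : ∀ z, HasDerivAt (fun x => P (x, z.2)) (P' z) z.1)
    (hQd : ∀ z, HasDerivAt (fun y => Q (z.1, y)) (Q' z) z.2)
    (h1 : ∀ t, P (1, t) = P (0, t)) (h2 : ∀ s, Q (s, 1) = Q (s, 0)) :
    ∫ z in square, (P' z + Q' z) = 0 := by
  have i1 : IntegrableOn P' square := hP'.continuousOn.integrableOn_compact isCompact_square
  have i2 : IntegrableOn Q' square := hQ'.continuousOn.integrableOn_compact isCompact_square
  rw [integral_add i1 i2]
  have e2 : ∫ z in square, Q' z = 0 := by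
    rw [square, Measure.volume_eq_prod, setIntegral_prod _ (by
      rw [← Measure.volume_eq_prod]; exact i2)]
    rw [← integral_zero ℝ ℂ (μ := volume.restrict (Icc (0 : ℝ) 1))]
    congr 1
    funext s
    have hc : Continuous fun t => Q' (s, t) := by fun_prop
    rw [integral_Icc_eq_integral_Ioc, ← intervalIntegral.integral_of_le zero_le_one,
      intervalIntegral.integral_eq_sub_of_hasDerivAt (f := fun t => Q (s, t))
        (fun t _ => hQd (s, t)) (hc.intervalIntegrable 0 1)]
    simp [h2]
  have e1 : ∫ z in square, P' z = 0 := by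
    have h := setIntegral_prod_swap (μ := (volume : Measure ℝ)) (ν := (volume : Measure ℝ))
      (Icc (0 : ℝ) 1) (Icc (0 : ℝ) 1) P'
    rw [← Measure.volume_eq_prod] at h
    rw [square, ← h, Measure.volume_eq_prod, setIntegral_prod _ (by
      rw [← Measure.volume_eq_prod]
      exact ((hP'.comp continuous_swap).continuousOn.integrableOn_compact isCompact_square))]
    rw [← integral_zero ℝ ℂ (μ := volume.restrict (Icc (0 : ℝ) 1))]
    congr 1
    funext t
    simp only [Prod.swap_prod_mk]
    have hc : Continuous fun s => P' (s, t) := by fun_prop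
    rw [integral_Icc_eq_integral_Ioc, ← intervalIntegral.integral_of_le zero_le_one,
      intervalIntegral.integral_eq_sub_of_hasDerivAt (f := fun s => P (s, t))
        (fun s _ => hPd (s, t)) (hc.intervalIntegrable 0 1)]
    simp [h1]
  rw [e1, e2, add_zero]

/-! ### Green's formula -/

/-- A function of two variables together with its partial derivatives of order at most two;
`d12` is the first partial derivative of the second partial derivative. -/
structure Jet where
  /-- the function -/
  f : ℝ × ℝ → ℂ
  /-- the first partial derivative -/
  d1 : ℝ × ℝ → ℂ
  /-- the second partial derivative -/
  d2 : ℝ × ℝ → ℂ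
  /-- a second order derivative -/
  d11 : ℝ × ℝ → ℂ
  /-- a second order derivative -/
  d12 : ℝ × ℝ → ℂ
  /-- a second order derivative -/
  d21 : ℝ × ℝ → ℂ
  /-- a second order derivative -/
  d22 : ℝ × ℝ → ℂ

/-- The derivatives in the jet are continuous on `C` and are what they should be on `U`. -/
structure IsJetOn (J : Jet) (C U : Set (ℝ × ℝ)) : Prop where
  cf : ContinuousOn J.f C
  c1 : ContinuousOn J.d1 C
  c2 : ContinuousOn J.d2 C
  c11 : ContinuousOn J.d11 C
  c12 : ContinuousOn J.d12 C
  c21 : ContinuousOn J.d21 C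
  c22 : ContinuousOn J.d22 C
  h1 : ∀ z ∈ U, HasDerivAt (fun x => J.f (x, z.2)) (J.d1 z) z.1
  h2 : ∀ z ∈ U, HasDerivAt (fun y => J.f (z.1, y)) (J.d2 z) z.2
  h11 : ∀ z ∈ U, HasDerivAt (fun x => J.d1 (x, z.2)) (J.d11 z) z.1
  h12 : ∀ z ∈ U, HasDerivAt (fun x => J.d2 (x, z.2)) (J.d12 z) z.1
  h21 : ∀ z ∈ U, HasDerivAt (fun y => J.d1 (z.1, y)) (J.d21 z) z.2
  h22 : ∀ z ∈ U, HasDerivAt (fun y => J.d2 (z.1, y)) (J.d22 z) z.2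

namespace Jet

/-- The first component of the gradient, up to a factor. -/
noncomputable def n1 (J : Jet) (z : ℝ × ℝ) : ℂ := J.d1 z - 1 / 2 * J.d2 z

/-- The second component of the gradient, up to a factor. -/
noncomputable def n2 (J : Jet) (z : ℝ × ℝ) : ℂ := J.d2 z - 1 / 2 * J.d1 z

/-- Three times the Laplacian of the plane, in the coordinates in which the net is the standard
triangle. -/
noncomputable def L (J : Jet) (z : ℝ × ℝ) : ℂ :=
  J.d11 z - 1 / 2 * J.d12 z - 1 / 2 * J.d21 z + J.d22 z

/-- The first component of the field in Green's formula. -/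
noncomputable def P (J H : Jet) (z : ℝ × ℝ) : ℂ := H.f z * J.n1 z - J.f z * H.n1 z

/-- The second component of the field in Green's formula. -/
noncomputable def Q (J H : Jet) (z : ℝ × ℝ) : ℂ := H.f z * J.n2 z - J.f z * H.n2 z

/-- The derivative of `Jet.P`. -/
noncomputable def P' (J H : Jet) (z : ℝ × ℝ) : ℂ :=
  H.d1 z * J.n1 z + H.f z * (J.d11 z - 1 / 2 * J.d12 z) -
    (J.d1 z * H.n1 z + J.f z * (H.d11 z - 1 / 2 * H.d12 z))

/-- The derivative of `Jet.Q`. -/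
noncomputable def Q' (J H : Jet) (z : ℝ × ℝ) : ℂ :=
  H.d2 z * J.n2 z + H.f z * (J.d22 z - 1 / 2 * J.d21 z) -
    (J.d2 z * H.n2 z + J.f z * (H.d22 z - 1 / 2 * H.d21 z))

/-- The first-order terms cancel because `H.d1 * J.n1 + H.d2 * J.n2` is symmetric in `J` and `H`: it
is the inner product of the gradients, up to a factor. Equality of `d12` and `d21` is not needed. -/
theorem P'_add_Q' (J H : Jet) (z : ℝ × ℝ) :
    P' J H z + Q' J H z = H.f z * J.L z - J.f z * H.L z := by
  simp only [P', Q', n1, n2, L]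
  ring

/-- The product of two jets. -/
noncomputable def mul (J H : Jet) : Jet where
  f z := J.f z * H.f z
  d1 z := J.d1 z * H.f z + J.f z * H.d1 z
  d2 z := J.d2 z * H.f z + J.f z * H.d2 z
  d11 z := J.d11 z * H.f z + J.d1 z * H.d1 z + (J.d1 z * H.d1 z + J.f z * H.d11 z)
  d12 z := J.d12 z * H.f z + J.d2 z * H.d1 z + (J.d1 z * H.d2 z + J.f z * H.d12 z)
  d21 z := J.d21 z * H.f z + J.d1 z * H.d2 z + (J.d2 z * H.d1 z + J.f z * H.d21 z)
  d22 z := J.d22 z * H.f z + J.d2 z * H.d2 z + (J.d2 z * H.d2 z + J.f z * H.d22 z)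

end Jet

theorem IsJetOn.mul {J H : Jet} {C U : Set (ℝ × ℝ)} (hJ : IsJetOn J C U) (hH : IsJetOn H C U) :
    IsJetOn (J.mul H) C U := by
  obtain ⟨a, a1, a2, a11, a12, a21, a22, A1, A2, A11, A12, A21, A22⟩ := hJ
  obtain ⟨b, b1, b2, b11, b12, b21, b22, B1, B2, B11, B12, B21, B22⟩ := hH
  constructor
  · exact a.mul b
  · exact (a1.mul b).add (a.mul b1)
  · exact (a2.mul b).add (a.mul b2)
  · exact ((a11.mul b).add (a1.mul b1)).add ((a1.mul b1).add (a.mul b11))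
  · exact ((a12.mul b).add (a2.mul b1)).add ((a1.mul b2).add (a.mul b12))
  · exact ((a21.mul b).add (a1.mul b2)).add ((a2.mul b1).add (a.mul b21))
  · exact ((a22.mul b).add (a2.mul b2)).add ((a2.mul b2).add (a.mul b22))
  · exact fun z hz => (A1 z hz).mul (B1 z hz)
  · exact fun z hz => (A2 z hz).mul (B2 z hz)
  · exact fun z hz => ((A11 z hz).mul (B1 z hz)).add ((A1 z hz).mul (B11 z hz))
  · exact fun z hz => ((A12 z hz).mul (B1 z hz)).add ((A1 z hz).mul (B12 z hz))
  · exact fun z hz => ((A21 z hz).mul (B2 z hz)).add ((A2 z hz).mul (B21 z hz))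
  · exact fun z hz => ((A22 z hz).mul (B2 z hz)).add ((A2 z hz).mul (B22 z hz))

theorem IsJetOn.mono {J : Jet} {C U C' U' : Set (ℝ × ℝ)} (h : IsJetOn J C U) (hC : C' ⊆ C)
    (hU : U' ⊆ U) : IsJetOn J C' U' := by
  obtain ⟨a, a1, a2, a11, a12, a21, a22, A1, A2, A11, A12, A21, A22⟩ := h
  exact ⟨a.mono hC, a1.mono hC, a2.mono hC, a11.mono hC, a12.mono hC, a21.mono hC, a22.mono hC,
    fun z hz => A1 z (hU hz), fun z hz => A2 z (hU hz), fun z hz => A11 z (hU hz),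
    fun z hz => A12 z (hU hz), fun z hz => A21 z (hU hz), fun z hz => A22 z (hU hz)⟩

section Field

variable {J H : Jet} {C U : Set (ℝ × ℝ)}

theorem IsJetOn.cn1 (hJ : IsJetOn J C U) : ContinuousOn J.n1 C :=
  hJ.c1.sub (continuousOn_const.mul hJ.c2)

theorem IsJetOn.cn2 (hJ : IsJetOn J C U) : ContinuousOn J.n2 C :=
  hJ.c2.sub (continuousOn_const.mul hJ.c1)

theorem IsJetOn.cL (hJ : IsJetOn J C U) : ContinuousOn J.L C :=
  ((hJ.c11.sub (continuousOn_const.mul hJ.c12)).sub (continuousOn_const.mul hJ.c21)).add hJ.c22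

theorem IsJetOn.continuousOn_P (hJ : IsJetOn J C U) (hH : IsJetOn H C U) :
    ContinuousOn (Jet.P J H) C := (hH.cf.mul hJ.cn1).sub (hJ.cf.mul hH.cn1)

theorem IsJetOn.continuousOn_Q (hJ : IsJetOn J C U) (hH : IsJetOn H C U) :
    ContinuousOn (Jet.Q J H) C := (hH.cf.mul hJ.cn2).sub (hJ.cf.mul hH.cn2)

theorem IsJetOn.continuousOn_P' (hJ : IsJetOn J C U) (hH : IsJetOn H C U) :
    ContinuousOn (Jet.P' J H) C :=
  ((hH.c1.mul hJ.cn1).add (hH.cf.mul (hJ.c11.sub (continuousOn_const.mul hJ.c12)))).sub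
    ((hJ.c1.mul hH.cn1).add (hJ.cf.mul (hH.c11.sub (continuousOn_const.mul hH.c12))))

theorem IsJetOn.continuousOn_Q' (hJ : IsJetOn J C U) (hH : IsJetOn H C U) :
    ContinuousOn (Jet.Q' J H) C :=
  ((hH.c2.mul hJ.cn2).add (hH.cf.mul (hJ.c22.sub (continuousOn_const.mul hJ.c21)))).sub
    ((hJ.c2.mul hH.cn2).add (hJ.cf.mul (hH.c22.sub (continuousOn_const.mul hH.c21))))

theorem IsJetOn.hasDerivAt_P (hJ : IsJetOn J C U) (hH : IsJetOn H C U) {z : ℝ × ℝ} (hz : z ∈ U) :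
    HasDerivAt (fun x => Jet.P J H (x, z.2)) (Jet.P' J H z) z.1 :=
  ((hH.h1 z hz).mul ((hJ.h11 z hz).sub ((hJ.h12 z hz).const_mul (1 / 2)))).sub
    ((hJ.h1 z hz).mul ((hH.h11 z hz).sub ((hH.h12 z hz).const_mul (1 / 2))))

theorem IsJetOn.hasDerivAt_Q (hJ : IsJetOn J C U) (hH : IsJetOn H C U) {z : ℝ × ℝ} (hz : z ∈ U) :
    HasDerivAt (fun y => Jet.Q J H (z.1, y)) (Jet.Q' J H z) z.2 :=
  ((hH.h2 z hz).mul ((hJ.h22 z hz).sub ((hJ.h21 z hz).const_mul (1 / 2)))).sub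
    ((hJ.h2 z hz).mul ((hH.h22 z hz).sub ((hH.h21 z hz).const_mul (1 / 2))))

end Field

/-- Green's formula on the square for periodic functions. -/
theorem setIntegral_square_green {J H : Jet} (hJ : IsJetOn J univ univ) (hH : IsJetOn H univ univ)
    (pJ : ∀ t, J.f (1, t) = J.f (0, t) ∧ J.d1 (1, t) = J.d1 (0, t) ∧ J.d2 (1, t) = J.d2 (0, t))
    (qJ : ∀ s, J.f (s, 1) = J.f (s, 0) ∧ J.d1 (s, 1) = J.d1 (s, 0) ∧ J.d2 (s, 1) = J.d2 (s, 0))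
    (pH : ∀ t, H.f (1, t) = H.f (0, t) ∧ H.d1 (1, t) = H.d1 (0, t) ∧ H.d2 (1, t) = H.d2 (0, t))
    (qH : ∀ s, H.f (s, 1) = H.f (s, 0) ∧ H.d1 (s, 1) = H.d1 (s, 0) ∧ H.d2 (s, 1) = H.d2 (s, 0)) :
    ∫ z in square, (H.f z * J.L z - J.f z * H.L z) = 0 := by
  simp_rw [← Jet.P'_add_Q']
  refine setIntegral_square_divergence_eq_zero (P := Jet.P J H) (Q := Jet.Q J H)
    (continuousOn_univ.1 (hJ.continuousOn_P' hH))
    (continuousOn_univ.1 (hJ.continuousOn_Q' hH)) (fun z => hJ.hasDerivAt_P hH (mem_univ z))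
    (fun z => hJ.hasDerivAt_Q hH (mem_univ z)) ?_ ?_
  · intro t
    simp only [Jet.P, Jet.n1, pJ, pH]
  · intro s
    simp only [Jet.Q, Jet.n2, qJ, qH]

/-- The values and the normal derivatives of `J` match along the sides of the triangle,
the latter outside `Z`. -/
structure Matched (J : Jet) (Z : Set (ℝ × ℝ)) : Prop where
  v1 : ∀ t ∈ Icc (0 : ℝ) 1, J.f (0, 1 - t) = J.f (0, t)
  v2 : ∀ t ∈ Icc (0 : ℝ) 1, J.f (1 - t, 0) = J.f (t, 0)
  v3 : ∀ t ∈ Icc (0 : ℝ) 1, J.f (1 - t, t) = J.f (t, 1 - t)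
  n1 : ∀ t ∈ Icc (0 : ℝ) 1, (0, t) ∉ Z → (0, 1 - t) ∉ Z → J.n1 (0, 1 - t) = -J.n1 (0, t)
  n2 : ∀ t ∈ Icc (0 : ℝ) 1, (t, 0) ∉ Z → (1 - t, 0) ∉ Z → J.n2 (1 - t, 0) = -J.n2 (t, 0)
  n3 : ∀ t ∈ Icc (0 : ℝ) 1, (t, 1 - t) ∉ Z → (1 - t, t) ∉ Z →
    J.n1 (1 - t, t) + J.n2 (1 - t, t) = -(J.n1 (t, 1 - t) + J.n2 (t, 1 - t))

/-- All entries of the jet vanish near the points of `Z`. -/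
def VanishesNear (H : Jet) (Z : Set (ℝ × ℝ)) : Prop :=
  ∀ z ∈ Z, ∀ᶠ w in nhds z, H.f w = 0 ∧ H.d1 w = 0 ∧ H.d2 w = 0 ∧ H.d11 w = 0 ∧ H.d12 w = 0 ∧
    H.d21 w = 0 ∧ H.d22 w = 0

/-- Nothing is known about the derivatives of `J` at the vertices, but every term of the field in
Green's formula carries an entry of `H` as a factor, and these vanish near the vertices. -/
theorem ContinuousOn.of_eventually_eq_zero {F : ℝ × ℝ → ℂ} {K Z : Set (ℝ × ℝ)}
    (hF : ContinuousOn F (K \ Z)) (hK : IsClosed Z) (h0 : ∀ z ∈ Z, ∀ᶠ w in nhds z, F w = 0) :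
    ContinuousOn F K := by
  intro z hz
  by_cases hZ : z ∈ Z
  · have h : F =ᶠ[nhds z] fun _ => 0 := h0 z hZ
    exact (continuousAt_const.congr h.symm).continuousWithinAt
  · exact (hF z ⟨hz, hZ⟩).mono_of_mem_nhdsWithin
      (Filter.inter_mem (self_mem_nhdsWithin)
        (mem_nhdsWithin_of_mem_nhds (hK.isOpen_compl.mem_nhds hZ)))

/-- Green's formula on the triangle. -/
theorem setIntegral_tri_green {J H : Jet} {Z : Set (ℝ × ℝ)} (hZ : IsClosed Z)
    (hJ : IsJetOn J (tri \ Z) openTri) (hH : IsJetOn H (tri \ Z) openTri)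
    (mJ : Matched J Z) (mH : Matched H ∅) (hv : VanishesNear H Z) :
    ∫ z in tri, (H.f z * J.L z - J.f z * H.L z) = 0 := by
  simp_rw [← Jet.P'_add_Q']
  have hv0 : ∀ z ∈ Z, H.f z = 0 ∧ H.n1 z = 0 ∧ H.n2 z = 0 := fun z hz => by
    obtain ⟨h, h1, h2, -⟩ := (hv z hz).self_of_nhds
    simp [Jet.n1, Jet.n2, h, h1, h2]
  refine setIntegral_tri_divergence_eq_zero (P := Jet.P J H) (Q := Jet.Q J H)
    ((hJ.continuousOn_P hH).of_eventually_eq_zero hZ ?_)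
    ((hJ.continuousOn_Q hH).of_eventually_eq_zero hZ ?_)
    ((hJ.continuousOn_P' hH).of_eventually_eq_zero hZ ?_)
    ((hJ.continuousOn_Q' hH).of_eventually_eq_zero hZ ?_)
    (fun z hz => hJ.hasDerivAt_P hH hz) (fun z hz => hJ.hasDerivAt_Q hH hz) ?_ ?_ ?_
  · intro z hz
    filter_upwards [hv z hz] with w ⟨h, h1, h2, h11, h12, h21, h22⟩
    simp [Jet.P, Jet.n1, h, h1, h2]
  · intro z hz
    filter_upwards [hv z hz] with w ⟨h, h1, h2, h11, h12, h21, h22⟩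
    simp [Jet.Q, Jet.n2, h, h1, h2]
  · intro z hz
    filter_upwards [hv z hz] with w ⟨h, h1, h2, h11, h12, h21, h22⟩
    simp [Jet.P', Jet.n1, h, h1, h2, h11, h12]
  · intro z hz
    filter_upwards [hv z hz] with w ⟨h, h1, h2, h11, h12, h21, h22⟩
    simp [Jet.Q', Jet.n2, h, h1, h2, h21, h22]
  · intro t ht
    have eH := mH.v1 t ht
    have eH' := mH.n1 t ht (notMem_empty _) (notMem_empty _)
    simp only [Jet.P, eH, eH', mJ.v1 t ht]
    -- If one of the two points lies in `Z`, the matching of the normal component of `J` is not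
    -- available. There `H` and its normal component vanish, and by the matching of `H` they vanish
    -- at the other point too.
    by_cases h : (0, t) ∈ Z
    · simp [hv0 _ h]
    by_cases h' : (0, 1 - t) ∈ Z
    · obtain ⟨a, b, -⟩ := hv0 _ h'
      rw [a] at eH
      rw [b] at eH'
      simp [← eH, neg_eq_zero.1 eH'.symm]
    rw [mJ.n1 t ht h h']
    ring
  · intro t ht
    have eH := mH.v2 t ht
    have eH' := mH.n2 t ht (notMem_empty _) (notMem_empty _)
    simp only [Jet.Q, eH, eH', mJ.v2 t ht]
    by_cases h : (t, 0) ∈ Z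
    · simp [hv0 _ h]
    by_cases h' : (1 - t, 0) ∈ Z
    · obtain ⟨a, -, b⟩ := hv0 _ h'
      rw [a] at eH
      rw [b] at eH'
      simp [← eH, neg_eq_zero.1 eH'.symm]
    rw [mJ.n2 t ht h h']
    ring
  · intro t ht
    have eH := mH.v3 t ht
    have eH' := mH.n3 t ht (notMem_empty _) (notMem_empty _)
    have e : ∀ z, Jet.P J H z + Jet.Q J H z =
        H.f z * (J.n1 z + J.n2 z) - J.f z * (H.n1 z + H.n2 z) := fun z => by
      simp only [Jet.P, Jet.Q]
      ring
    simp only [e, eH, eH', mJ.v3 t ht]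
    by_cases h : (t, 1 - t) ∈ Z
    · simp [hv0 _ h]
    by_cases h' : (1 - t, t) ∈ Z
    · obtain ⟨a, b, c⟩ := hv0 _ h'
      rw [a] at eH
      rw [b, c, add_zero] at eH'
      simp [← eH, neg_eq_zero.1 eH'.symm]
    rw [mJ.n3 t ht h h']
    ring

/-! ### Cutting off the vertices -/

/-- The intervals of radius `ε` about `0`, `1 / 2` and `1`. -/
def nearHalves (ε : ℝ) : Set ℝ :=
  Metric.closedBall 0 ε ∪ Metric.closedBall (1 / 2) ε ∪ Metric.closedBall 1 ε

theorem volume_nearHalves_le {ε : ℝ} (hε : 0 ≤ ε) :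
    volume (nearHalves ε) ≤ ENNReal.ofReal (6 * ε) := by
  refine (measure_union_le _ _).trans
    ((add_le_add (measure_union_le _ _) le_rfl).trans (le_of_eq ?_))
  simp only [Real.volume_closedBall]
  rw [← ENNReal.ofReal_add (by positivity) (by positivity),
    ← ENNReal.ofReal_add (by positivity) (by positivity)]
  congr 1
  ring

/-- A point of the triangle whose coordinates are close to half-integers is close to a vertex. -/
theorem exists_vertex_near {ε : ℝ} (hε : ε < 1 / 4) {z : ℝ × ℝ} (hz : z ∈ tri)
    (h1 : z.1 ∈ nearHalves ε) (h2 : z.2 ∈ nearHalves ε) :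
    ∃ p ∈ tri, p.1 ∈ ({0, 1 / 2, 1} : Set ℝ) ∧ p.2 ∈ ({0, 1 / 2, 1} : Set ℝ) ∧ dist z p ≤ ε := by
  obtain ⟨s, t⟩ := z
  obtain ⟨-, -, hst⟩ := hz
  have key : ∀ x ∈ nearHalves ε, ∃ p ∈ ({0, 1 / 2, 1} : Set ℝ), dist x p ≤ ε := by
    rintro x ((h | h) | h)
    · exact ⟨0, by simp, h⟩
    · exact ⟨1 / 2, by simp, h⟩
    · exact ⟨1, by simp, h⟩
  obtain ⟨p, hp, hps⟩ := key s h1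
  obtain ⟨q, hq, hqt⟩ := key t h2
  refine ⟨(p, q), ?_, hp, hq, max_le hps hqt⟩
  simp only at hst
  rw [Real.dist_eq, abs_le] at hps hqt
  -- A sum of half-integers below `3/2` is at most `1`, so `(p, q)` lies in the triangle.
  have hpq : p + q < 3 / 2 := by linarith [hps.1, hqt.1]
  simp only [mem_insert_iff, mem_singleton_iff] at hp hq
  rcases hp with rfl | rfl | rfl <;> rcases hq with rfl | rfl | rfl <;>
    first
    | (exfalso; norm_num at hpq; done)
    | norm_num [tri]

/-- There are smooth functions on the line which vanish near `0`, `1 / 2` and `1` and equal `1`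
at distance `ε` from these points, with derivatives of the least possible order. -/
theorem exists_cutoff : ∃ C : ℝ, 0 ≤ C ∧ ∀ ε : ℝ, 0 < ε → ε < 1 / 4 → ∃ a a' a'' : ℝ → ℝ,
    (∀ x, HasDerivAt a (a' x) x) ∧ (∀ x, HasDerivAt a' (a'' x) x) ∧ Continuous a'' ∧
    (∀ x, a (1 - x) = a x) ∧ (∀ x, a' (1 - x) = -a' x) ∧
    (∀ p ∈ ({0, 1 / 2, 1} : Set ℝ), ∀ᶠ x in nhds p, a x = 0 ∧ a' x = 0 ∧ a'' x = 0) ∧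
    (∀ x ∉ nearHalves ε, a x = 1 ∧ a' x = 0 ∧ a'' x = 0) ∧
    (∀ x, |1 - a x| ≤ C) ∧ (∀ x, |a' x| ≤ C / ε) ∧ (∀ x, |a'' x| ≤ C / ε ^ 2) := by
  -- The cutoff is one minus three copies of a fixed bump, rescaled by `ε` and centred at `0`,
  -- `1/2`, `1`. Evenness of the bump makes it symmetric under `x ↦ 1 - x`, which exchanges the
  -- outer copies.
  let B : ContDiffBump (0 : ℝ) := ⟨1 / 2, 1, by norm_num, by norm_num⟩
  have hB : ContDiff ℝ 2 B := B.contDiff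
  have hB1 : ContDiff ℝ 1 (deriv B) := by
    have : ContDiff ℝ (1 + 1) B := hB
    exact (contDiff_succ_iff_deriv.1 this).2.2
  have hB2 : Continuous (deriv (deriv B)) := hB1.continuous_deriv le_rfl
  have hs : HasCompactSupport B := B.hasCompactSupport
  obtain ⟨C0, hC0⟩ := hs.exists_bound_of_continuous hB.continuous
  obtain ⟨C1, hC1⟩ := hs.deriv.exists_bound_of_continuous hB1.continuous
  obtain ⟨C2, hC2⟩ := hs.deriv.deriv.exists_bound_of_continuous hB2
  simp only [Real.norm_eq_abs] at hC0 hC1 hC2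
  have dB : ∀ x, HasDerivAt B (deriv B x) x := fun x =>
    (hB.differentiable (by norm_num) x).hasDerivAt
  have dB1 : ∀ x, HasDerivAt (deriv B) (deriv (deriv B) x) x := fun x =>
    (hB1.differentiable (by norm_num) x).hasDerivAt
  have neg0 : ∀ x, B (-x) = B x := fun x => B.neg x
  have neg1 : ∀ x, deriv B (-x) = -deriv B x := fun x => by
    have h : (fun x => B (-x)) = B := funext neg0
    have h' := deriv_comp_neg (f := B) (x := x)
    rw [h] at h'
    rw [h', neg_neg]
  have far0 : ∀ x, 1 < |x| → ∀ᶠ y in nhds x, B y = 0 := by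
    intro x hx
    have : IsOpen {y : ℝ | 1 < |y|} := isOpen_lt continuous_const continuous_abs
    filter_upwards [this.mem_nhds hx] with y hy
    exact B.zero_of_le_dist (by simpa [B] using (show 1 < |y| from hy).le)
  have far1 : ∀ x, 1 < |x| → ∀ᶠ y in nhds x, deriv B y = 0 := by
    intro x hx
    have h : B =ᶠ[nhds x] fun _ => 0 := far0 x hx
    simpa [Filter.EventuallyEq] using h.deriv
  have far2 : ∀ x, 1 < |x| → ∀ᶠ y in nhds x, deriv (deriv B) y = 0 := by
    intro x hx
    have h : deriv B =ᶠ[nhds x] fun _ => 0 := far1 x hx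
    simpa [Filter.EventuallyEq] using h.deriv
  have near0 : ∀ᶠ y in nhds 0, B y = 1 := B.eventuallyEq_one
  have near1 : ∀ᶠ y in nhds 0, deriv B y = 0 := by
    have h : B =ᶠ[nhds 0] fun _ => 1 := near0
    simpa [Filter.EventuallyEq] using h.deriv
  have near2 : ∀ᶠ y in nhds 0, deriv (deriv B) y = 0 := by
    have h : deriv B =ᶠ[nhds 0] fun _ => 0 := near1
    simpa [Filter.EventuallyEq] using h.deriv
  set C : ℝ := 3 * (|C0| + |C1| + |C2|) with hC
  refine ⟨C, by positivity, fun ε hε hε4 => ?_⟩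
  refine ⟨fun x => 1 - (B ((x - 0) / ε) + B ((x - 1 / 2) / ε) + B ((x - 1) / ε)),
    fun x => -((deriv B ((x - 0) / ε) + deriv B ((x - 1 / 2) / ε) + deriv B ((x - 1) / ε)) / ε),
    fun x => -((deriv (deriv B) ((x - 0) / ε) + deriv (deriv B) ((x - 1 / 2) / ε) +
      deriv (deriv B) ((x - 1) / ε)) / ε ^ 2), ?_, ?_, ?_, ?_, ?_, ?_, ?_, ?_, ?_, ?_⟩
  · intro x
    have h : ∀ p, HasDerivAt (fun x => B ((x - p) / ε)) (deriv B ((x - p) / ε) * (1 / ε)) x :=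
      fun p => (dB _).comp x (((hasDerivAt_id x).sub_const p).div_const ε)
    refine ((((h 0).add (h (1 / 2))).add (h 1)).const_sub 1).congr_deriv ?_
    ring
  · intro x
    have h : ∀ p, HasDerivAt (fun x => deriv B ((x - p) / ε))
        (deriv (deriv B) ((x - p) / ε) * (1 / ε)) x :=
      fun p => (dB1 _).comp x (((hasDerivAt_id x).sub_const p).div_const ε)
    refine (((((h 0).add (h (1 / 2))).add (h 1)).div_const ε).neg).congr_deriv ?_
    ring
  · fun_prop
  · intro x
    have e0 : (1 - x - 0) / ε = -((x - 1) / ε) := by ring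
    have e1 : (1 - x - 1 / 2) / ε = -((x - 1 / 2) / ε) := by ring
    have e2 : (1 - x - 1) / ε = -((x - 0) / ε) := by ring
    simp only [e0, e1, e2, neg0]
    ring
  · intro x
    have e0 : (1 - x - 0) / ε = -((x - 1) / ε) := by ring
    have e1 : (1 - x - 1 / 2) / ε = -((x - 1 / 2) / ε) := by ring
    have e2 : (1 - x - 1) / ε = -((x - 0) / ε) := by ring
    simp only [e0, e1, e2, neg1]
    ring
  · intro p hp
    have cont : ∀ q : ℝ, Filter.Tendsto (fun x => (x - q) / ε) (nhds p) (nhds ((p - q) / ε)) :=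
      fun q => Continuous.tendsto (by fun_prop) p
    have self : ∀ {P : ℝ → Prop}, (∀ᶠ y in nhds 0, P y) → ∀ᶠ x in nhds p, P ((x - p) / ε) := by
      intro P hP
      have := cont p
      rw [sub_self, zero_div] at this
      exact this hP
    -- The centres are more than `1/4 > ε` apart, so near one of them the copies of the bump at the
    -- others vanish.
    have other : ∀ {P : ℝ → Prop}, (∀ x, 1 < |x| → ∀ᶠ y in nhds x, P y) → ∀ q, 1 / 4 < |p - q| →
        ∀ᶠ x in nhds p, P ((x - q) / ε) := by
      intro P hP q hq
      refine cont q (hP _ ?_)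
      rw [abs_div, abs_of_pos hε, lt_div_iff₀ hε]
      linarith
    simp only [mem_insert_iff, mem_singleton_iff] at hp
    rcases hp with rfl | rfl | rfl
    · have a1 : (1 / 4 : ℝ) < |0 - 1 / 2| := by norm_num
      have a2 : (1 / 4 : ℝ) < |0 - 1| := by norm_num
      filter_upwards [self near0, self near1, self near2, other far0 _ a1, other far1 _ a1,
        other far2 _ a1, other far0 _ a2, other far1 _ a2, other far2 _ a2]
        with x h0 h1 h2 h3 h4 h5 h6 h7 h8
      simp only [h0, h1, h2, h3, h4, h5, h6, h7, h8]
      norm_num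
    · have a1 : (1 / 4 : ℝ) < |1 / 2 - 0| := by norm_num
      have a2 : (1 / 4 : ℝ) < |1 / 2 - 1| := by norm_num
      filter_upwards [self near0, self near1, self near2, other far0 _ a1, other far1 _ a1,
        other far2 _ a1, other far0 _ a2, other far1 _ a2, other far2 _ a2]
        with x h0 h1 h2 h3 h4 h5 h6 h7 h8
      simp only [h0, h1, h2, h3, h4, h5, h6, h7, h8]
      norm_num
    · have a1 : (1 / 4 : ℝ) < |1 - 0| := by norm_num
      have a2 : (1 / 4 : ℝ) < |(1 : ℝ) - 1 / 2| := by norm_num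
      filter_upwards [self near0, self near1, self near2, other far0 _ a1, other far1 _ a1,
        other far2 _ a1, other far0 _ a2, other far1 _ a2, other far2 _ a2]
        with x h0 h1 h2 h3 h4 h5 h6 h7 h8
      simp only [h0, h1, h2, h3, h4, h5, h6, h7, h8]
      norm_num
  · intro x hx
    simp only [nearHalves, mem_union, Metric.mem_closedBall, not_or, not_le, Real.dist_eq] at hx
    obtain ⟨⟨x0, x1⟩, x2⟩ := hx
    have big : ∀ q, ε < |x - q| → 1 < |(x - q) / ε| := fun q hq => by
      rwa [abs_div, abs_of_pos hε, lt_div_iff₀ hε, one_mul]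
    simp only [(far0 _ (big _ x0)).self_of_nhds, (far0 _ (big _ x1)).self_of_nhds,
      (far0 _ (big _ x2)).self_of_nhds, (far1 _ (big _ x0)).self_of_nhds,
      (far1 _ (big _ x1)).self_of_nhds, (far1 _ (big _ x2)).self_of_nhds,
      (far2 _ (big _ x0)).self_of_nhds, (far2 _ (big _ x1)).self_of_nhds,
      (far2 _ (big _ x2)).self_of_nhds]
    norm_num
  · intro x
    rw [sub_sub_cancel]
    refine (abs_add_three _ _ _).trans ?_
    linarith [hC0 ((x - 0) / ε), hC0 ((x - 1 / 2) / ε), hC0 ((x - 1) / ε), le_abs_self C0,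
      abs_nonneg C1, abs_nonneg C2]
  · intro x
    rw [abs_neg, abs_div, abs_of_pos hε]
    refine div_le_div_of_nonneg_right ((abs_add_three _ _ _).trans ?_) hε.le
    linarith [hC1 ((x - 0) / ε), hC1 ((x - 1 / 2) / ε), hC1 ((x - 1) / ε), le_abs_self C1,
      abs_nonneg C0, abs_nonneg C2]
  · intro x
    rw [abs_neg, abs_div, abs_of_pos (pow_pos hε 2)]
    refine div_le_div_of_nonneg_right ((abs_add_three _ _ _).trans ?_) (pow_pos hε 2).le
    linarith [hC2 ((x - 0) / ε), hC2 ((x - 1 / 2) / ε), hC2 ((x - 1) / ε), le_abs_self C2,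
      abs_nonneg C1, abs_nonneg C0]

/-- The points with half-integral coordinates in the unit square. -/
def halves : Set (ℝ × ℝ) := ({0, 1 / 2, 1} : Set ℝ) ×ˢ ({0, 1 / 2, 1} : Set ℝ)

theorem isClosed_halves : IsClosed halves :=
  ((Set.toFinite _).isClosed).prod ((Set.toFinite _).isClosed)

theorem openTri_disjoint_halves {z : ℝ × ℝ} (hz : z ∈ openTri) : z ∉ halves := by
  obtain ⟨s, t⟩ := z
  obtain ⟨hs, ht, hst⟩ := hz
  rintro ⟨p, q⟩
  simp only [mem_insert_iff, mem_singleton_iff] at p q hs ht hst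
  rcases p with rfl | rfl | rfl <;> rcases q with rfl | rfl | rfl <;> linarith

/-- The jet of the function on the plane which cuts off the points with half-integral coordinates,
given the corresponding function on the line and its derivatives. -/
noncomputable def cutoffJet (a a' a'' : ℝ → ℝ) : Jet where
  -- This differs from `1` only where both coordinates are close to halves, which is an area of
  -- order `ε ^ 2`; the product `a z.1 * a z.2` would differ from `1` on strips with area of order
  -- `ε`.
  f z := ((1 - (1 - a z.1) * (1 - a z.2) : ℝ) : ℂ)
  d1 z := ((a' z.1 * (1 - a z.2) : ℝ) : ℂ)
  d2 z := (((1 - a z.1) * a' z.2 : ℝ) : ℂ)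
  d11 z := ((a'' z.1 * (1 - a z.2) : ℝ) : ℂ)
  d12 z := ((-(a' z.1 * a' z.2) : ℝ) : ℂ)
  d21 z := ((-(a' z.1 * a' z.2) : ℝ) : ℂ)
  d22 z := (((1 - a z.1) * a'' z.2 : ℝ) : ℂ)

theorem isJetOn_cutoffJet {a a' a'' : ℝ → ℝ} (h : ∀ x, HasDerivAt a (a' x) x)
    (h' : ∀ x, HasDerivAt a' (a'' x) x) (h'' : Continuous a'') :
    IsJetOn (cutoffJet a a' a'') univ univ := by
  have c : Continuous a := continuous_iff_continuousAt.2 fun x => (h x).continuousAt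
  have c' : Continuous a' := continuous_iff_continuousAt.2 fun x => (h' x).continuousAt
  constructor
  · exact Continuous.continuousOn (by unfold cutoffJet; fun_prop)
  · exact Continuous.continuousOn (by unfold cutoffJet; fun_prop)
  · exact Continuous.continuousOn (by unfold cutoffJet; fun_prop)
  · exact Continuous.continuousOn (by unfold cutoffJet; fun_prop)
  · exact Continuous.continuousOn (by unfold cutoffJet; fun_prop)
  · exact Continuous.continuousOn (by unfold cutoffJet; fun_prop)
  · exact Continuous.continuousOn (by unfold cutoffJet; fun_prop)
  · intro z _
    refine HasDerivAt.ofReal_comp (u := a' z.1 * (1 - a z.2)) ?_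
    exact ((((h z.1).const_sub 1).mul_const (1 - a z.2)).const_sub 1).congr_deriv (by ring)
  · intro z _
    refine HasDerivAt.ofReal_comp (u := (1 - a z.1) * a' z.2) ?_
    exact ((((h z.2).const_sub 1).const_mul (1 - a z.1)).const_sub 1).congr_deriv (by ring)
  · intro z _
    exact HasDerivAt.ofReal_comp (u := a'' z.1 * (1 - a z.2)) ((h' z.1).mul_const (1 - a z.2))
  · intro z _
    refine HasDerivAt.ofReal_comp (u := -(a' z.1 * a' z.2)) ?_
    exact (((h z.1).const_sub 1).mul_const (a' z.2)).congr_deriv (by ring)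
  · intro z _
    refine HasDerivAt.ofReal_comp (u := -(a' z.1 * a' z.2)) ?_
    exact (((h z.2).const_sub 1).const_mul (a' z.1)).congr_deriv (by ring)
  · intro z _
    exact HasDerivAt.ofReal_comp (u := (1 - a z.1) * a'' z.2) ((h' z.2).const_mul (1 - a z.1))

/-- Flipping a side replaces `t` by `1 - t`, under which `a` is even and `a'` is odd. On the two
coordinate sides the normal component also has a term with the factor `a' 0`, which has the wrong
parity and must vanish. -/
theorem matched_cutoffJet {a a' a'' : ℝ → ℝ} (s : ∀ x, a (1 - x) = a x)
    (s' : ∀ x, a' (1 - x) = -a' x) (h0 : a' 0 = 0) (Z : Set (ℝ × ℝ)) :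
    Matched (cutoffJet a a' a'') Z := by
  constructor <;> intro t _ <;>
    simp only [cutoffJet, Jet.n1, Jet.n2, s, s', h0] <;> intros <;> push_cast <;> ring

theorem Matched.mul {J H : Jet} {Z : Set (ℝ × ℝ)} (hJ : Matched J Z) (hH : Matched H Z) :
    Matched (J.mul H) Z := by
  have e1 : ∀ z, (J.mul H).n1 z = J.n1 z * H.f z + J.f z * H.n1 z := fun z => by
    simp only [Jet.n1, Jet.mul]; ring
  have e2 : ∀ z, (J.mul H).n2 z = J.n2 z * H.f z + J.f z * H.n2 z := fun z => by
    simp only [Jet.n2, Jet.mul]; ring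
  constructor
  · intro t ht
    simp only [Jet.mul, hJ.v1 t ht, hH.v1 t ht]
  · intro t ht
    simp only [Jet.mul, hJ.v2 t ht, hH.v2 t ht]
  · intro t ht
    simp only [Jet.mul, hJ.v3 t ht, hH.v3 t ht]
  · intro t ht a b
    rw [e1, e1, hJ.v1 t ht, hH.v1 t ht, hJ.n1 t ht a b, hH.n1 t ht a b]
    ring
  · intro t ht a b
    rw [e2, e2, hJ.v2 t ht, hH.v2 t ht, hJ.n2 t ht a b, hH.n2 t ht a b]
    ring
  · intro t ht a b
    rw [e1, e1, e2, e2, hJ.v3 t ht, hH.v3 t ht]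
    linear_combination H.f (t, 1 - t) * hJ.n3 t ht a b + J.f (t, 1 - t) * hH.n3 t ht a b

theorem VanishesNear.mul {J : Jet} {Z : Set (ℝ × ℝ)} (hJ : VanishesNear J Z) (H : Jet) :
    VanishesNear (J.mul H) Z := by
  intro z hz
  filter_upwards [hJ z hz] with w ⟨h, h1, h2, h11, h12, h21, h22⟩
  simp [Jet.mul, h, h1, h2, h11, h12, h21, h22]

theorem vanishesNear_cutoffJet {a a' a'' : ℝ → ℝ}
    (h : ∀ p ∈ ({0, 1 / 2, 1} : Set ℝ), ∀ᶠ x in nhds p, a x = 0 ∧ a' x = 0 ∧ a'' x = 0) :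
    VanishesNear (cutoffJet a a' a'') halves := by
  rintro ⟨p, q⟩ ⟨hp, hq⟩
  filter_upwards [(h p hp).prod_nhds (h q hq)] with w ⟨⟨h0, h1, h2⟩, ⟨k0, k1, k2⟩⟩
  simp [cutoffJet, h0, h1, h2, k0, k1, k2]

/-- Green's formula on the triangle for a function which need not be differentiable at the
vertices, where it vanishes. -/
theorem setIntegral_tri_green_of_vanish {J φ : Jet} {Y : ℝ × ℝ → ℂ}
    (hJ : IsJetOn J (tri \ halves) openTri) (cJ : ContinuousOn J.f tri) (mJ : Matched J halves)
    (h0 : ∀ z ∈ tri, z ∈ halves → J.f z = 0) (hY : ContinuousOn Y tri)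
    (hL : ∀ z ∈ openTri, J.L z = Y z) (hφ : IsJetOn φ univ univ) (mφ : ∀ Z, Matched φ Z) :
    ∫ z in tri, (φ.f z * Y z - J.f z * φ.L z) = 0 := by
  set X : ℝ × ℝ → ℂ := fun z => φ.f z * Y z - J.f z * φ.L z with hX
  have cφ : Continuous φ.f := continuousOn_univ.1 hφ.cf
  have cφ1 : Continuous φ.d1 := continuousOn_univ.1 hφ.c1
  have cφ2 : Continuous φ.d2 := continuousOn_univ.1 hφ.c2
  have cφL : Continuous φ.L := continuousOn_univ.1 hφ.cL
  have cX : ContinuousOn X tri := (cφ.continuousOn.mul hY).sub (cJ.mul cφL.continuousOn)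
  -- The equation extends from the interior to the sides by continuity, except at the vertices.
  have hL' : ∀ z ∈ tri \ halves, J.L z = Y z := by
    have hsub : openTri ⊆ tri \ halves := fun z hz =>
      ⟨openTri_subset_tri hz, openTri_disjoint_halves hz⟩
    exact Set.EqOn.of_subset_closure (s := openTri) hL hJ.cL (hY.mono sdiff_subset) hsub
      (sdiff_subset.trans tri_subset_closure_openTri)
  obtain ⟨M, hM0, hM⟩ : ∃ M : ℝ, 0 ≤ M ∧ ∀ z ∈ tri, ‖φ.f z‖ ≤ M ∧ ‖φ.d1 z‖ ≤ M ∧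
      ‖φ.d2 z‖ ≤ M ∧ ‖X z‖ ≤ M := by
    obtain ⟨A, hA⟩ := isCompact_tri.exists_bound_of_continuousOn cφ.continuousOn
    obtain ⟨A1, hA1⟩ := isCompact_tri.exists_bound_of_continuousOn cφ1.continuousOn
    obtain ⟨A2, hA2⟩ := isCompact_tri.exists_bound_of_continuousOn cφ2.continuousOn
    obtain ⟨A3, hA3⟩ := isCompact_tri.exists_bound_of_continuousOn cX
    refine ⟨|A| + |A1| + |A2| + |A3|, by positivity, fun z hz => ?_⟩
    have := hA z hz
    have := hA1 z hz
    have := hA2 z hz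
    have := hA3 z hz
    have := le_abs_self A
    have := le_abs_self A1
    have := le_abs_self A2
    have := le_abs_self A3
    have := abs_nonneg A
    have := abs_nonneg A1
    have := abs_nonneg A2
    have := abs_nonneg A3
    refine ⟨?_, ?_, ?_, ?_⟩ <;> linarith
  obtain ⟨C, hC0, hcut⟩ := exists_cutoff
  -- Here `360 = 36 + 36 * 9`: the area is at most `36 * ε ^ 2`, and the integrand is at most `C ^ 2
  -- * M + 9 * M * C ^ 2 * δ / ε ^ 2`, with `ε ^ 2 ≤ δ`.
  suffices h : ∀ δ : ℝ, 0 < δ → ‖∫ z in tri, X z‖ ≤ 360 * M * C ^ 2 * δ by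
    rw [← norm_le_zero_iff]
    refine le_of_forall_pos_le_add fun e he => ?_
    have hD : 0 < 360 * M * C ^ 2 + 1 := by positivity
    refine (h (e / (360 * M * C ^ 2 + 1)) (by positivity)).trans ?_
    rw [zero_add, mul_div_assoc', div_le_iff₀ hD]
    nlinarith
  intro δ hδ
  -- As `J.f` vanishes at the vertices, uniform continuity makes it at most `δ` within `ε₀` of them.
  -- This is the only smallness used.
  obtain ⟨ε₀, hε₀, huc⟩ := Metric.uniformContinuousOn_iff.1
    (isCompact_tri.uniformContinuousOn_of_continuous cJ) δ hδ
  obtain ⟨ε, hε, hε4, hεε, hεδ⟩ : ∃ ε : ℝ, 0 < ε ∧ ε < 1 / 4 ∧ ε < ε₀ ∧ ε ^ 2 ≤ δ := by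
    refine ⟨min (1 / 8) (min (ε₀ / 2) δ), by positivity, ?_, ?_, ?_⟩
    · exact (min_le_left _ _).trans_lt (by norm_num)
    · exact ((min_le_right _ _).trans (min_le_left _ _)).trans_lt (by linarith)
    · have h1 : min (1 / 8) (min (ε₀ / 2) δ) ≤ 1 / 8 := min_le_left _ _
      have h2 : min (1 / 8) (min (ε₀ / 2) δ) ≤ δ := (min_le_right _ _).trans (min_le_right _ _)
      have h3 : 0 < min (1 / 8) (min (ε₀ / 2) δ) := by positivity
      nlinarith
  obtain ⟨a, a', a'', da, da', ca'', sa, sa', near, far, B0, B1, B2⟩ := hcut ε hε hε4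
  set η := cutoffJet a a' a'' with hη
  have jη : IsJetOn η univ univ := isJetOn_cutoffJet da da' ca''
  have mη : ∀ Z, Matched η Z := matched_cutoffJet sa sa' (near 0 (by simp)).self_of_nhds.2.1
  have vη : VanishesNear η halves := vanishesNear_cutoffJet near
  -- The cutoff multiplies the test function and not `J`, so that no derivative of `J` meets a
  -- derivative of `η`.
  have green := setIntegral_tri_green isClosed_halves hJ
    ((jη.mul hφ).mono (subset_univ (tri \ halves)) (subset_univ openTri)) mJ ((mη ∅).mul (mφ ∅))
    (vη.mul φ)
  -- By the product rule `T` is `L` of `η φ` minus `η` times `L` of `φ`. Hence `R` is the difference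
  -- of the integrands without and with the cutoff.
  set T : ℝ × ℝ → ℂ := fun z => φ.f z * η.L z + (2 * (η.d1 z * φ.d1 z) -
    (η.d2 z * φ.d1 z + η.d1 z * φ.d2 z) + 2 * (η.d2 z * φ.d2 z)) with hT
  set R : ℝ × ℝ → ℂ := fun z => (1 - η.f z) * X z + J.f z * T z with hR
  have cη : Continuous η.f := continuousOn_univ.1 jη.cf
  have cη1 : Continuous η.d1 := continuousOn_univ.1 jη.c1
  have cη2 : Continuous η.d2 := continuousOn_univ.1 jη.c2
  have cηL : Continuous η.L := continuousOn_univ.1 jη.cL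
  have cT : Continuous T := by fun_prop
  have cR : ContinuousOn R tri :=
    ((continuous_const.sub cη).continuousOn.mul cX).add (cJ.mul cT.continuousOn)
  have hXR : ∫ z in tri, X z = ∫ z in tri, R z := by
    rw [← sub_eq_zero, ← integral_sub (cX.integrableOn_compact isCompact_tri)
      (cR.integrableOn_compact isCompact_tri), ← green]
    refine setIntegral_congr_fun isClosed_tri.measurableSet fun z hz => ?_
    -- At a vertex `J.L` is unrelated to `Y`, but it is multiplied by `η.f = 0`.
    by_cases hzv : z ∈ halves
    · obtain ⟨hf, -⟩ := (vη z hzv).self_of_nhds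
      simp [hR, h0 z hz hzv, hf, Jet.mul]
    · simp only [hR, hX, hT, Jet.mul, Jet.L, ← hL' z ⟨hz, hzv⟩]
      ring
  have hfar : ∀ z ∈ tri \ (tri ∩ nearHalves ε ×ˢ nearHalves ε), R z = 0 := by
    rintro z ⟨hz, hzn⟩
    have : z.1 ∉ nearHalves ε ∨ z.2 ∉ nearHalves ε := by
      by_contra! hcon
      exact hzn ⟨hz, hcon⟩
    rcases this with h | h <;> obtain ⟨k0, k1, k2⟩ := far _ h <;>
      simp [hR, hT, hη, cutoffJet, Jet.L, k0, k1, k2]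
  have hbound : ∀ z ∈ tri ∩ nearHalves ε ×ˢ nearHalves ε,
      ‖R z‖ ≤ C ^ 2 * M + δ * (9 * M * C ^ 2 / ε ^ 2) := by
    rintro z ⟨hz, hz1, hz2⟩
    obtain ⟨M0, M1, M2, M3⟩ := hM z hz
    obtain ⟨p, hp, hp1, hp2, hzp⟩ := exists_vertex_near hε4 hz hz1 hz2
    have hJz : ‖J.f z‖ ≤ δ := by
      have := huc z hz p hp (hzp.trans_lt hεε)
      rw [h0 p hp ⟨hp1, hp2⟩, dist_zero_right] at this
      exact this.le
    have hε1 : C / ε ≤ C / ε ^ 2 := div_le_div_of_nonneg_left hC0 (by positivity) (by nlinarith)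
    have hCε : 0 ≤ C / ε ^ 2 := by positivity
    have hCε' : 0 ≤ C / ε := by positivity
    have q : C * (C / ε ^ 2) = C ^ 2 / ε ^ 2 := by ring
    have e0 : ‖1 - η.f z‖ ≤ C ^ 2 := by
      have : 1 - η.f z = (((1 - a z.1) * (1 - a z.2) : ℝ) : ℂ) := by
        simp [hη, cutoffJet]
      rw [this, Complex.norm_real, Real.norm_eq_abs, abs_mul, sq]
      exact mul_le_mul (B0 _) (B0 _) (abs_nonneg _) hC0
    have e1 : ‖η.d1 z‖ ≤ C ^ 2 / ε ^ 2 := by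
      simp only [hη, cutoffJet, Complex.norm_real, Real.norm_eq_abs, abs_mul]
      rw [← q, mul_comm C]
      exact mul_le_mul ((B1 _).trans hε1) (B0 _) (abs_nonneg _) hCε
    have e2 : ‖η.d2 z‖ ≤ C ^ 2 / ε ^ 2 := by
      simp only [hη, cutoffJet, Complex.norm_real, Real.norm_eq_abs, abs_mul]
      rw [← q]
      exact mul_le_mul (B0 _) ((B1 _).trans hε1) (abs_nonneg _) hC0
    have e11 : ‖η.d11 z‖ ≤ C ^ 2 / ε ^ 2 := by
      simp only [hη, cutoffJet, Complex.norm_real, Real.norm_eq_abs, abs_mul]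
      rw [← q, mul_comm C]
      exact mul_le_mul (B2 _) (B0 _) (abs_nonneg _) hCε
    have e22 : ‖η.d22 z‖ ≤ C ^ 2 / ε ^ 2 := by
      simp only [hη, cutoffJet, Complex.norm_real, Real.norm_eq_abs, abs_mul]
      rw [← q]
      exact mul_le_mul (B0 _) (B2 _) (abs_nonneg _) hC0
    have e12 : ‖η.d12 z‖ ≤ C ^ 2 / ε ^ 2 := by
      simp only [hη, cutoffJet, Complex.norm_real, Real.norm_eq_abs, abs_mul, abs_neg]
      rw [← div_pow, sq]
      exact mul_le_mul (B1 _) (B1 _) (abs_nonneg _) hCε'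
    have e21 : ‖η.d21 z‖ ≤ C ^ 2 / ε ^ 2 := e12
    set D := C ^ 2 / ε ^ 2 with hD
    have hD0 : 0 ≤ D := by positivity
    have eL : ‖η.L z‖ ≤ 3 * D := by
      have h1 : ‖1 / 2 * η.d12 z‖ ≤ 1 / 2 * D := by
        rw [norm_mul]; norm_num; linarith
      have h2 : ‖1 / 2 * η.d21 z‖ ≤ 1 / 2 * D := by
        rw [norm_mul]; norm_num; linarith
      have := norm_add_le (η.d11 z - 1 / 2 * η.d12 z - 1 / 2 * η.d21 z) (η.d22 z)
      have := norm_sub_le (η.d11 z - 1 / 2 * η.d12 z) (1 / 2 * η.d21 z)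
      have := norm_sub_le (η.d11 z) (1 / 2 * η.d12 z)
      simp only [Jet.L]
      linarith
    have prod : ∀ {x y : ℂ} {b c : ℝ}, ‖x‖ ≤ b → ‖y‖ ≤ c → 0 ≤ b → ‖x * y‖ ≤ b * c :=
      fun hx hy hb => (norm_mul_le _ _).trans (mul_le_mul hx hy (norm_nonneg _) hb)
    have two : ‖(2 : ℂ)‖ ≤ 2 := by simp
    -- The constant is `9 = 3 + 2 + 1 + 1 + 2`, from the terms of `T` in order.
    have eT : ‖T z‖ ≤ 9 * M * D := by
      have h1 := prod M0 eL hM0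
      have h2 := prod two (prod e1 M1 hD0) zero_le_two
      have h3 := prod e2 M1 hD0
      have h4 := prod e1 M2 hD0
      have h5 := prod two (prod e2 M2 hD0) zero_le_two
      have := norm_add_le (φ.f z * η.L z) (2 * (η.d1 z * φ.d1 z) -
        (η.d2 z * φ.d1 z + η.d1 z * φ.d2 z) + 2 * (η.d2 z * φ.d2 z))
      have := norm_add_le (2 * (η.d1 z * φ.d1 z) - (η.d2 z * φ.d1 z + η.d1 z * φ.d2 z))
        (2 * (η.d2 z * φ.d2 z))
      have := norm_sub_le (2 * (η.d1 z * φ.d1 z)) (η.d2 z * φ.d1 z + η.d1 z * φ.d2 z)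
      have := norm_add_le (η.d2 z * φ.d1 z) (η.d1 z * φ.d2 z)
      simp only [hT]
      linarith
    have hfin : 9 * M * C ^ 2 / ε ^ 2 = 9 * M * D := by rw [hD]; ring
    rw [hfin]
    exact (norm_add_le _ _).trans
      (add_le_add (prod e0 M3 (by positivity)) (prod hJz eT hδ.le))
  have hvol : volume (tri ∩ nearHalves ε ×ˢ nearHalves ε) ≤ ENNReal.ofReal (36 * ε ^ 2) := by
    refine (measure_mono inter_subset_right).trans ?_
    rw [Measure.volume_eq_prod, Measure.prod_prod]
    refine (mul_le_mul' (volume_nearHalves_le hε.le) (volume_nearHalves_le hε.le)).trans ?_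
    rw [← ENNReal.ofReal_mul (by positivity)]
    exact ENNReal.ofReal_le_ofReal (by nlinarith)
  rw [hXR, setIntegral_eq_of_subset_of_forall_sdiff_eq_zero isClosed_tri.measurableSet
    inter_subset_left hfar]
  refine (norm_setIntegral_le_of_norm_le_const (hvol.trans_lt ENNReal.ofReal_lt_top)
    hbound).trans ?_
  have hreal : volume.real (tri ∩ nearHalves ε ×ˢ nearHalves ε) ≤ 36 * ε ^ 2 :=
    ENNReal.toReal_le_of_le_ofReal (by positivity) hvol
  refine (mul_le_mul_of_nonneg_left hreal (by positivity)).trans ?_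
  have e : (C ^ 2 * M + δ * (9 * M * C ^ 2 / ε ^ 2)) * (36 * ε ^ 2) =
      36 * (C ^ 2 * M) * ε ^ 2 + 324 * (M * C ^ 2) * δ := by
    field_simp
    ring
  rw [e]
  have := mul_le_mul_of_nonneg_left hεδ (by positivity : 0 ≤ 36 * (C ^ 2 * M))
  linarith

/-! ### Complete families of continuous functions -/

section Dense

variable {X ι : Type*} [TopologicalSpace X]

/-- A family of functions whose span is a star subalgebra and which separates points. -/
structure IsSeparatingFamily (c : ι → C(X, ℂ)) : Prop where
  one_mem : 1 ∈ Submodule.span ℂ (range c)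
  mul_mem : ∀ i j, c i * c j ∈ Submodule.span ℂ (range c)
  star_mem : ∀ i, star (c i) ∈ Submodule.span ℂ (range c)
  sep : ∀ x y, (∀ i, c i x = c i y) → x = y

/-- Products and conjugates of generators stay in the span, so by linearity in each argument the
span is a star subalgebra, and the Stone-Weierstrass theorem applies. -/
theorem IsSeparatingFamily.dense [CompactSpace X] {c : ι → C(X, ℂ)}
    (hc : IsSeparatingFamily c) (f : C(X, ℂ)) :
    f ∈ closure (Submodule.span ℂ (range c) : Set C(X, ℂ)) := by
  set W := Submodule.span ℂ (range c) with hW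
  have hmul : ∀ f ∈ W, ∀ g ∈ W, f * g ∈ W := by
    intro f hf g hg
    induction hf using Submodule.span_induction with
    | mem f hf =>
      obtain ⟨i, rfl⟩ := hf
      induction hg using Submodule.span_induction with
      | mem g hg =>
        obtain ⟨j, rfl⟩ := hg
        exact hc.mul_mem i j
      | zero => simp
      | add a b _ _ ha hb => rw [mul_add]; exact W.add_mem ha hb
      | smul r a _ ha => rw [mul_smul_comm]; exact W.smul_mem r ha
    | zero => simp
    | add a b _ _ ha hb => rw [add_mul]; exact W.add_mem ha hb
    | smul r a _ ha => rw [smul_mul_assoc]; exact W.smul_mem r ha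
  have hstar : ∀ f ∈ W, star f ∈ W := by
    intro f hf
    induction hf using Submodule.span_induction with
    | mem f hf =>
      obtain ⟨i, rfl⟩ := hf
      exact hc.star_mem i
    | zero => simp
    | add a b _ _ ha hb => rw [star_add]; exact W.add_mem ha hb
    | smul r a _ ha => rw [star_smul]; exact W.smul_mem _ ha
  let A : StarSubalgebra ℂ C(X, ℂ) :=
    { carrier := W
      mul_mem' := fun {f g} hf hg => hmul f hf g hg
      add_mem' := fun hf hg => W.add_mem hf hg
      algebraMap_mem' := fun r => by
        rw [Algebra.algebraMap_eq_smul_one]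
        exact W.smul_mem r hc.one_mem
      star_mem' := fun {f} hf => hstar f hf }
  have hA : A.SeparatesPoints := by
    intro x y hxy
    by_contra! hcon
    refine hxy (hc.sep x y fun i => ?_)
    exact hcon (c i) ⟨c i, Submodule.subset_span ⟨i, rfl⟩, rfl⟩
  have htop := ContinuousMap.starSubalgebra_topologicalClosure_eq_top_of_separatesPoints A hA
  have : f ∈ A.topologicalClosure := htop ▸ StarSubalgebra.mem_top
  exact this

variable {K : Set (ℝ × ℝ)} {p : ℝ × ℝ → X}

/-- A continuous function is zero if its integrals against all functions of a separating family
are zero. -/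
theorem IsSeparatingFamily.eq_zero [CompactSpace X] {c : ι → C(X, ℂ)}
    (hc : IsSeparatingFamily c) (hK : IsCompact K) (hKi : K ⊆ closure (interior K))
    (hp : ContinuousOn p K) (hsurj : ∀ x, ∃ z ∈ K, p z = x) (u : C(X, ℂ))
    (hu : ∀ i, ∫ z in K, u (p z) * c i (p z) = 0) : u = 0 := by
  have hcont : ∀ f : C(X, ℂ), ContinuousOn (fun z => f (p z)) K := fun f =>
    f.continuous.comp_continuousOn hp
  have hint : ∀ f : C(X, ℂ), IntegrableOn (fun z => u (p z) * f (p z)) K := fun f =>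
    ((hcont u).mul (hcont f)).integrableOn_compact hK
  have hspan : ∀ f ∈ Submodule.span ℂ (range c), ∫ z in K, u (p z) * f (p z) = 0 := by
    intro f hf
    induction hf using Submodule.span_induction with
    | mem f hf =>
      obtain ⟨i, rfl⟩ := hf
      exact hu i
    | zero => simp
    | add a b _ _ ha hb =>
      simp only [ContinuousMap.add_apply, mul_add]
      rw [integral_add (hint a) (hint b), ha, hb, add_zero]
    | smul r a _ ha =>
      simp only [ContinuousMap.smul_apply, smul_eq_mul, mul_left_comm _ r]
      rw [integral_const_mul, ha, mul_zero]
  have hall : ∀ f : C(X, ℂ), ∫ z in K, u (p z) * f (p z) = 0 := by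
    intro f
    -- The integral is a Lipschitz function of `f` in the uniform norm, with constant `‖u‖ *
    -- volume.real K`.
    have hclosed : IsClosed {f : C(X, ℂ) | ∫ z in K, u (p z) * f (p z) = 0} := by
      refine isClosed_eq ?_ continuous_const
      rw [continuous_iff_continuousAt]
      intro f
      rw [ContinuousAt, tendsto_iff_norm_sub_tendsto_zero]
      have hle : ∀ g : C(X, ℂ), ‖(∫ z in K, u (p z) * g (p z)) - ∫ z in K, u (p z) * f (p z)‖ ≤
          ‖u‖ * ‖g - f‖ * volume.real K := by
        intro g
        rw [← integral_sub (hint g) (hint f)]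
        refine norm_setIntegral_le_of_norm_le_const hK.measure_lt_top fun z _ => ?_
        rw [← mul_sub]
        refine (norm_mul_le _ _).trans (mul_le_mul (u.norm_coe_le_norm _) ?_ (norm_nonneg _)
          (norm_nonneg _))
        exact (g - f).norm_coe_le_norm (p z)
      refine squeeze_zero (fun _ => norm_nonneg _) hle ?_
      have : Continuous fun g : C(X, ℂ) => ‖u‖ * ‖g - f‖ * volume.real K := by fun_prop
      simpa using this.tendsto f
    exact closure_minimal hspan hclosed (hc.dense f)
  -- Testing against the conjugate of `u` gives its square norm. Vanishing almost everywhere becomes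
  -- vanishing on the interior by continuity, and then on `K` because `K` lies in the closure of its
  -- interior.
  have hnorm : ∫ z in K, ‖u (p z)‖ ^ 2 = 0 := by
    have h := hall (star u)
    have e : ∀ z, u (p z) * (star u) (p z) = ((‖u (p z)‖ ^ 2 : ℝ) : ℂ) := fun z => by
      simp [Complex.mul_conj, Complex.normSq_eq_norm_sq]
    simp_rw [e] at h
    rw [integral_complex_ofReal] at h
    exact_mod_cast h
  have hc2 : ContinuousOn (fun z => ‖u (p z)‖ ^ 2) K := (hcont u).norm.pow 2
  have hae : (fun z => ‖u (p z)‖ ^ 2) =ᵐ[volume.restrict K] 0 :=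
    (integral_eq_zero_iff_of_nonneg (fun z => by positivity)
      (hc2.integrableOn_compact hK)).1 hnorm
  have hint0 : EqOn (fun z => ‖u (p z)‖ ^ 2) (fun _ => 0) (interior K) := by
    refine Measure.eqOn_open_of_ae_eq (μ := volume) ?_ isOpen_interior
      (hc2.mono interior_subset) continuousOn_const
    exact ae_restrict_of_ae_restrict_of_subset interior_subset hae
  have h0 := hint0.of_subset_closure hc2 continuousOn_const interior_subset hKi
  ext x
  obtain ⟨z, hz, rfl⟩ := hsurj x
  simpa using h0 hz

/-- The dimension of a space of continuous functions is at most the number of coefficients which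
determine the functions of this space. -/
theorem IsSeparatingFamily.finrank_le [CompactSpace X] {c : ι → C(X, ℂ)}
    (hc : IsSeparatingFamily c) (hK : IsCompact K) (hKi : K ⊆ closure (interior K))
    (hp : ContinuousOn p K) (hsurj : ∀ x, ∃ z ∈ K, p z = x) (V : Submodule ℂ (X → ℂ))
    (hV : ∀ u ∈ V, Continuous u) (T : Finset ι)
    (hT : ∀ u ∈ V, (∀ i ∈ T, ∫ z in K, u (p z) * c i (p z) = 0) →
      ∀ i, ∫ z in K, u (p z) * c i (p z) = 0) :
    FiniteDimensional ℂ V ∧ Module.finrank ℂ V ≤ T.card := by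
  have hint : ∀ u ∈ V, ∀ i, IntegrableOn (fun z => u (p z) * c i (p z)) K := fun u hu i =>
    (((hV u hu).comp_continuousOn hp).mul
      ((c i).continuous.comp_continuousOn hp)).integrableOn_compact hK
  -- The map to the coefficients indexed by `T`; by `hT` and `eq_zero` it is injective.
  let Φ : V →ₗ[ℂ] (T → ℂ) :=
    { toFun := fun u i => ∫ z in K, u.1 (p z) * c i (p z)
      map_add' := fun u v => by
        funext i
        simp only [Submodule.coe_add, Pi.add_apply, add_mul]
        exact integral_add (hint u u.2 i) (hint v v.2 i)
      map_smul' := fun r u => by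
        funext i
        simp only [Submodule.coe_smul, Pi.smul_apply, smul_eq_mul, mul_assoc, RingHom.id_apply]
        exact integral_const_mul r _ }
  have hinj : Function.Injective Φ := by
    rw [← LinearMap.ker_eq_bot, LinearMap.ker_eq_bot']
    rintro ⟨u, hu⟩ h
    have := hc.eq_zero hK hKi hp hsurj ⟨u, hV u hu⟩
      (hT u hu fun i hi => congrFun h ⟨i, hi⟩)
    ext x
    exact congrArg (fun f : C(X, ℂ) => f x) this
  refine ⟨Module.Finite.of_injective Φ hinj, ?_⟩
  simpa using LinearMap.finrank_le_finrank_of_injective hinj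

end Dense

/-! ### Coordinates of the plane -/

/-- The first period. -/
def v₁ : Plane := !₂[2, 0]

/-- The second period. -/
noncomputable def v₂ : Plane := !₂[1, √3]

/-- The point with given coordinates with respect to the basis of the two periods. -/
noncomputable def pt (z : ℝ × ℝ) : Plane := z.1 • v₁ + z.2 • v₂

/-- The second coordinate with respect to the basis of the two periods. -/
noncomputable def coordT : Plane →L[ℝ] ℝ := (√3)⁻¹ • EuclideanSpace.proj 1

/-- The first coordinate with respect to the basis of the two periods. -/
noncomputable def coordS : Plane →L[ℝ] ℝ := (1 / 2 : ℝ) • (EuclideanSpace.proj 0 - coordT)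

@[simp] theorem coordT_v₁ : coordT v₁ = 0 := by simp [coordT, v₁]
@[simp] theorem coordT_v₂ : coordT v₂ = 1 := by simp [coordT, v₂]
@[simp] theorem coordS_v₁ : coordS v₁ = 1 := by simp [coordS, coordT, v₁]
@[simp] theorem coordS_v₂ : coordS v₂ = 0 := by simp [coordS, coordT, v₂]

@[simp] theorem coordS_pt (z : ℝ × ℝ) : coordS (pt z) = z.1 := by simp [pt]
@[simp] theorem coordT_pt (z : ℝ × ℝ) : coordT (pt z) = z.2 := by simp [pt]

theorem pt_coord (x : Plane) : pt (coordS x, coordT x) = x := by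
  ext i
  fin_cases i
  · simp [pt, v₁, v₂, coordS, coordT]
    ring
  · simp [pt, v₁, v₂, coordT]
    field_simp

theorem continuous_pt : Continuous pt := by
  unfold pt
  fun_prop

/-- Three times the Laplacian in terms of the derivatives in the directions of the periods. -/
theorem three_mul_laplacian (f : Plane → ℂ) (x : Plane) :
    3 * Laplacian.laplacian f x = fderiv ℝ (fderiv ℝ f) x v₁ v₁ -
      1 / 2 * fderiv ℝ (fderiv ℝ f) x v₁ v₂ - 1 / 2 * fderiv ℝ (fderiv ℝ f) x v₂ v₁ +
        fderiv ℝ (fderiv ℝ f) x v₂ v₂ := by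
  rw [InnerProductSpace.laplacian_eq_iteratedFDeriv_orthonormalBasis f
    (EuclideanSpace.basisFun (Fin 2) ℝ)]
  simp only [Fin.sum_univ_two, iteratedFDeriv_two_apply]
  set D := fderiv ℝ (fderiv ℝ f) x
  -- After expansion in the standard basis the mixed terms cancel, without using symmetry of the
  -- second derivative.
  have h1 : v₁ = (2 : ℝ) • EuclideanSpace.basisFun (Fin 2) ℝ 0 := by
    ext i
    fin_cases i <;> simp [v₁]
  have h2 : v₂ = EuclideanSpace.basisFun (Fin 2) ℝ 0 +
      √3 • EuclideanSpace.basisFun (Fin 2) ℝ 1 := by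
    ext i
    fin_cases i <;> simp [v₂]
  have h3 : ((√3 : ℝ) : ℂ) * ((√3 : ℝ) : ℂ) = 3 := by
    rw [← Complex.ofReal_mul, Real.mul_self_sqrt (by norm_num)]
    norm_num
  rw [h1, h2]
  simp only [map_add, map_smul, add_apply, smul_apply, Complex.real_smul, Matrix.cons_val_zero,
    Matrix.cons_val_one]
  push_cast
  linear_combination
    (-D (EuclideanSpace.basisFun (Fin 2) ℝ 1) (EuclideanSpace.basisFun (Fin 2) ℝ 1)) * h3

/-- The jet of a function on a set in the plane, in the coordinates `pt`. -/
noncomputable def jetWithin (f : Plane → ℂ) (S : Set Plane) : Jet where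
  f z := f (pt z)
  d1 z := fderivWithin ℝ f S (pt z) v₁
  d2 z := fderivWithin ℝ f S (pt z) v₂
  d11 z := fderivWithin ℝ (fderivWithin ℝ f S) S (pt z) v₁ v₁
  d12 z := fderivWithin ℝ (fderivWithin ℝ f S) S (pt z) v₁ v₂
  d21 z := fderivWithin ℝ (fderivWithin ℝ f S) S (pt z) v₂ v₁
  d22 z := fderivWithin ℝ (fderivWithin ℝ f S) S (pt z) v₂ v₂

/-- Derivatives within `S` are continuous up to the boundary points belonging to `S`, by unique
differentiability, and are genuine derivatives where `S` is a neighbourhood. This is the reason for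
the two sets `C` and `U`. -/
theorem isJetOn_jetWithin {f : Plane → ℂ} {S : Set Plane} (hf : ContDiffOn ℝ 2 f S)
    (hS : UniqueDiffOn ℝ S) {C U : Set (ℝ × ℝ)} (hC : MapsTo pt C S)
    (hU : ∀ z ∈ U, S ∈ nhds (pt z)) : IsJetOn (jetWithin f S) C U := by
  have hA : ContDiffOn ℝ 1 (fderivWithin ℝ f S) S := hf.fderivWithin hS (by norm_num)
  have cA : ContinuousOn (fun z => fderivWithin ℝ f S (pt z)) C :=
    hA.continuousOn.comp continuous_pt.continuousOn hC
  have cB : ContinuousOn (fun z => fderivWithin ℝ (fderivWithin ℝ f S) S (pt z)) C :=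
    (hA.continuousOn_fderivWithin hS le_rfl).comp continuous_pt.continuousOn hC
  have line1 : ∀ z : ℝ × ℝ, HasDerivAt (fun x => pt (x, z.2)) v₁ z.1 := fun z => by
    simpa [pt] using ((hasDerivAt_id z.1).smul_const v₁).add_const (z.2 • v₂)
  have line2 : ∀ z : ℝ × ℝ, HasDerivAt (fun y => pt (z.1, y)) v₂ z.2 := fun z => by
    simpa [pt] using ((hasDerivAt_id z.2).smul_const v₂).const_add (z.1 • v₁)
  have dA : ∀ z ∈ U, HasFDerivAt f (fderivWithin ℝ f S (pt z)) (pt z) := fun z hz =>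
    ((hf.differentiableOn (by norm_num)) (pt z)
      (mem_of_mem_nhds (hU z hz))).hasFDerivWithinAt.hasFDerivAt (hU z hz)
  have dB : ∀ z ∈ U, HasFDerivAt (fderivWithin ℝ f S)
      (fderivWithin ℝ (fderivWithin ℝ f S) S (pt z)) (pt z) := fun z hz =>
    ((hA.differentiableOn (by norm_num)) (pt z)
      (mem_of_mem_nhds (hU z hz))).hasFDerivWithinAt.hasFDerivAt (hU z hz)
  have dB1 : ∀ z ∈ U, ∀ v : Plane, HasDerivAt (fun x => fderivWithin ℝ f S (pt (x, z.2)) v)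
      (fderivWithin ℝ (fderivWithin ℝ f S) S (pt z) v₁ v) z.1 := fun z hz v => by
    have h := (HasFDerivAt.comp_hasDerivAt (f := fun x => pt (x, z.2)) z.1
      (dB z hz) (line1 z)).clm_apply (hasDerivAt_const z.1 v)
    simpa using h
  have dB2 : ∀ z ∈ U, ∀ v : Plane, HasDerivAt (fun y => fderivWithin ℝ f S (pt (z.1, y)) v)
      (fderivWithin ℝ (fderivWithin ℝ f S) S (pt z) v₂ v) z.2 := fun z hz v => by
    have h := (HasFDerivAt.comp_hasDerivAt (f := fun y => pt (z.1, y)) z.2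
      (dB z hz) (line2 z)).clm_apply (hasDerivAt_const z.2 v)
    simpa using h
  constructor
  · exact hf.continuousOn.comp continuous_pt.continuousOn hC
  · exact cA.clm_apply continuousOn_const
  · exact cA.clm_apply continuousOn_const
  · exact (cB.clm_apply continuousOn_const).clm_apply continuousOn_const
  · exact (cB.clm_apply continuousOn_const).clm_apply continuousOn_const
  · exact (cB.clm_apply continuousOn_const).clm_apply continuousOn_const
  · exact (cB.clm_apply continuousOn_const).clm_apply continuousOn_const
  · exact fun z hz => HasFDerivAt.comp_hasDerivAt z.1 (dA z hz) (line1 z)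
  · exact fun z hz => HasFDerivAt.comp_hasDerivAt z.2 (dA z hz) (line2 z)
  · exact fun z hz => dB1 z hz v₁
  · exact fun z hz => dB1 z hz v₂
  · exact fun z hz => dB2 z hz v₁
  · exact fun z hz => dB2 z hz v₂

theorem jetWithin_L {f : Plane → ℂ} {S : Set Plane} {z : ℝ × ℝ} (hz : S ∈ nhds (pt z)) :
    (jetWithin f S).L z = 3 * Laplacian.laplacian f (pt z) := by
  have h : fderivWithin ℝ f S =ᶠ[nhds (pt z)] fderiv ℝ f := by
    filter_upwards [eventually_mem_nhds_iff.2 hz] with x hx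
    exact fderivWithin_of_mem_nhds hx
  have h' : fderivWithin ℝ (fderivWithin ℝ f S) S (pt z) = fderiv ℝ (fderiv ℝ f) (pt z) := by
    rw [fderivWithin_of_mem_nhds hz, h.fderiv_eq]
  rw [three_mul_laplacian]
  simp only [Jet.L, jetWithin, h']

/-! ### Periodic functions -/

theorem mem_torusLattice {x : Plane} :
    x ∈ torusLattice ↔ ∃ m n : ℤ, x = (m : ℝ) • v₁ + (n : ℝ) • v₂ := by
  rw [torusLattice, AddSubgroup.mem_closure_pair]
  simp only [v₁, v₂, ← Int.cast_smul_eq_zsmul ℝ, eq_comm]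

theorem v₁_mem : v₁ ∈ torusLattice := mem_torusLattice.2 ⟨1, 0, by simp⟩

theorem v₂_mem : v₂ ∈ torusLattice := mem_torusLattice.2 ⟨0, 1, by simp⟩

/-- Functions of class `C²` on the torus, read on the plane. -/
structure SmoothPeriodic (f : Plane → ℂ) : Prop where
  contDiff : ContDiff ℝ 2 f
  periodic : ∀ x, ∀ l ∈ torusLattice, f (x + l) = f x

theorem SmoothPeriodic.add {f g : Plane → ℂ} (hf : SmoothPeriodic f) (hg : SmoothPeriodic g) :
    SmoothPeriodic (fun x => f x + g x) :=
  ⟨hf.contDiff.add hg.contDiff, fun x l hl => by rw [hf.periodic x l hl, hg.periodic x l hl]⟩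

theorem SmoothPeriodic.const_mul {f : Plane → ℂ} (hf : SmoothPeriodic f) (c : ℂ) :
    SmoothPeriodic (fun x => c * f x) :=
  ⟨contDiff_const.mul hf.contDiff, fun x l hl => by rw [hf.periodic x l hl]⟩

theorem SmoothPeriodic.fderiv_add {f : Plane → ℂ} (hf : SmoothPeriodic f) (x : Plane)
    {l : Plane} (hl : l ∈ torusLattice) : fderiv ℝ f (x + l) = fderiv ℝ f x := by
  rw [← fderiv_comp_add_right]
  congr 1
  funext y
  exact hf.periodic y l hl

theorem SmoothPeriodic.even_sub {f : Plane → ℂ} (hf : SmoothPeriodic f) (he : ∀ x, f (-x) = f x)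
    (x : Plane) {l : Plane} (hl : l ∈ torusLattice) : f (l - x) = f x := by
  rw [← he x, ← hf.periodic (-x) l hl]
  congr 1
  abel

/-- An even periodic function is invariant under each half-turn `x ↦ l - x`, whose derivative is
minus the identity. The foldings of the sides have this form, so such functions satisfy the matching
of normal derivatives automatically. -/
theorem SmoothPeriodic.fderiv_sub {f : Plane → ℂ} (hf : SmoothPeriodic f)
    (he : ∀ x, f (-x) = f x) (x : Plane) {l : Plane} (hl : l ∈ torusLattice) :
    fderiv ℝ f (l - x) = -fderiv ℝ f x := by
  have h1 := (hf.contDiff.differentiable (by norm_num) (l - x)).hasFDerivAt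
  have h2 : HasFDerivAt (fun y => l - y) (-ContinuousLinearMap.id ℝ Plane) x :=
    (hasFDerivAt_id x).const_sub l
  have h3 := h1.comp x h2
  have e : f ∘ (fun y => l - y) = f := funext fun y => hf.even_sub he y hl
  rw [e] at h3
  rw [h3.fderiv]
  ext v
  simp

theorem SmoothPeriodic.isJetOn {f : Plane → ℂ} (hf : SmoothPeriodic f) :
    IsJetOn (jetWithin f univ) univ univ :=
  isJetOn_jetWithin hf.contDiff.contDiffOn uniqueDiffOn_univ (mapsTo_univ _ _)
    fun _ _ => Filter.univ_mem

theorem SmoothPeriodic.jet_one {f : Plane → ℂ} (hf : SmoothPeriodic f) (t : ℝ) :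
    (jetWithin f univ).f (1, t) = (jetWithin f univ).f (0, t) ∧
      (jetWithin f univ).d1 (1, t) = (jetWithin f univ).d1 (0, t) ∧
      (jetWithin f univ).d2 (1, t) = (jetWithin f univ).d2 (0, t) := by
  have e : pt (1, t) = pt (0, t) + v₁ := by simp [pt, add_comm]
  simp only [jetWithin, fderivWithin_univ, e, hf.fderiv_add _ v₁_mem, hf.periodic _ _ v₁_mem,
    and_self]

theorem SmoothPeriodic.jet_two {f : Plane → ℂ} (hf : SmoothPeriodic f) (s : ℝ) :
    (jetWithin f univ).f (s, 1) = (jetWithin f univ).f (s, 0) ∧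
      (jetWithin f univ).d1 (s, 1) = (jetWithin f univ).d1 (s, 0) ∧
      (jetWithin f univ).d2 (s, 1) = (jetWithin f univ).d2 (s, 0) := by
  have e : pt (s, 1) = pt (s, 0) + v₂ := by simp [pt]
  simp only [jetWithin, fderivWithin_univ, e, hf.fderiv_add _ v₂_mem, hf.periodic _ _ v₂_mem,
    and_self]

theorem SmoothPeriodic.matched {f : Plane → ℂ} (hf : SmoothPeriodic f) (he : ∀ x, f (-x) = f x)
    (Z : Set (ℝ × ℝ)) : Matched (jetWithin f univ) Z := by
  have e1 : ∀ t, pt (0, 1 - t) = v₂ - pt (0, t) := fun t => by simp only [pt]; module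
  have e2 : ∀ t, pt (1 - t, 0) = v₁ - pt (t, 0) := fun t => by simp only [pt]; module
  have e3 : ∀ t, pt (1 - t, t) = (v₁ + v₂) - pt (t, 1 - t) := fun t => by simp only [pt]; module
  have h12 := add_mem v₁_mem v₂_mem
  constructor <;> intro t _
  · simp only [jetWithin, e1, hf.even_sub he _ v₂_mem]
  · simp only [jetWithin, e2, hf.even_sub he _ v₁_mem]
  · simp only [jetWithin, e3, hf.even_sub he _ h12]
  · intro _ _
    simp only [Jet.n1, jetWithin, fderivWithin_univ, e1, hf.fderiv_sub he _ v₂_mem, neg_apply]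
    ring
  · intro _ _
    simp only [Jet.n2, jetWithin, fderivWithin_univ, e2, hf.fderiv_sub he _ v₁_mem, neg_apply]
    ring
  · intro _ _
    simp only [Jet.n1, Jet.n2, jetWithin, fderivWithin_univ, e3, hf.fderiv_sub he _ h12, neg_apply]
    ring

/-- Green's formula on the torus. -/
theorem SmoothPeriodic.green {f g : Plane → ℂ} (hf : SmoothPeriodic f) (hg : SmoothPeriodic g) :
    ∫ z in square, (g (pt z) * (3 * Laplacian.laplacian f (pt z)) -
      f (pt z) * (3 * Laplacian.laplacian g (pt z))) = 0 := by
  have h := setIntegral_square_green hf.isJetOn hg.isJetOn hf.jet_one hf.jet_two hg.jet_one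
    hg.jet_two
  simp only [jetWithin_L Filter.univ_mem] at h
  exact h

/-! ### Plane waves -/

/-- The phase of a plane wave with the periods of the torus. -/
noncomputable def phase (i : ℤ × ℤ) : Plane →L[ℝ] ℂ :=
  (2 * Real.pi * Complex.I) •
    Complex.ofRealCLM.comp ((i.1 : ℝ) • coordS + (i.2 : ℝ) • coordT)

/-- The plane waves with the periods of the torus. -/
noncomputable def wave (i : ℤ × ℤ) (x : Plane) : ℂ := Complex.exp (phase i x)

/-- The eigenvalues of the plane waves. -/
noncomputable def waveEigenvalue (i : ℤ × ℤ) : ℝ :=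
  4 * Real.pi ^ 2 / 3 * ((i.1 ^ 2 - i.1 * i.2 + i.2 ^ 2 : ℤ) : ℝ)

theorem phase_apply (i : ℤ × ℤ) (x : Plane) :
    phase i x = 2 * Real.pi * Complex.I * (i.1 * coordS x + i.2 * coordT x) := by
  simp [phase]
  ring

theorem wave_add (i j : ℤ × ℤ) (x : Plane) : wave (i + j) x = wave i x * wave j x := by
  rw [wave, wave, wave, ← Complex.exp_add]
  congr 1
  simp only [phase_apply, Prod.fst_add, Prod.snd_add]
  push_cast
  ring

theorem wave_zero (x : Plane) : wave 0 x = 1 := by simp [wave, phase_apply]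

theorem wave_neg (i : ℤ × ℤ) (x : Plane) : wave (-i) x = wave i (-x) := by
  rw [wave, wave]
  congr 1
  simp [phase_apply]

theorem star_wave (i : ℤ × ℤ) (x : Plane) : star (wave i x) = wave (-i) x := by
  rw [wave, wave, Complex.star_def, ← Complex.exp_conj]
  congr 1
  simp [phase_apply, Complex.conj_ofNat]
  ring

theorem wave_apply_add (i : ℤ × ℤ) (x y : Plane) : wave i (x + y) = wave i x * wave i y := by
  simp only [wave, map_add, Complex.exp_add]

theorem wave_apply_zero (i : ℤ × ℤ) : wave i 0 = 1 := by simp [wave]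

theorem wave_lattice (i : ℤ × ℤ) {l : Plane} (hl : l ∈ torusLattice) : wave i l = 1 := by
  obtain ⟨m, n, rfl⟩ := mem_torusLattice.1 hl
  rw [wave, Complex.exp_eq_one_iff]
  refine ⟨i.1 * m + i.2 * n, ?_⟩
  simp [phase_apply]
  ring

theorem smoothPeriodic_wave (i : ℤ × ℤ) : SmoothPeriodic (wave i) := by
  refine ⟨?_, fun x l hl => ?_⟩
  · exact Complex.contDiff_exp.comp (phase i).contDiff
  · rw [wave_apply_add, wave_lattice i hl, mul_one]

theorem fderiv_wave (i : ℤ × ℤ) : fderiv ℝ (wave i) = fun x => wave i x • phase i := by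
  funext x
  exact ((phase i).hasFDerivAt (x := x)).cexp.fderiv

/-- The phase takes the values `2πi` times `i.1` and `i.2` at the two periods, so three times the
Laplacian multiplies the wave by `(2πi)²` times the quadratic form `i.1² - i.1 i.2 + i.2²`. -/
theorem laplacian_wave (i : ℤ × ℤ) (x : Plane) :
    -Laplacian.laplacian (wave i) x = (waveEigenvalue i : ℂ) * wave i x := by
  have h : HasFDerivAt (fun x => wave i x • phase i)
      ((wave i x • phase i).smulRight (phase i)) x := by
    have := ((phase i).hasFDerivAt (x := x)).cexp.smul_const (phase i)
    exact this
  have h3 := three_mul_laplacian (wave i) x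
  rw [fderiv_wave, h.fderiv] at h3
  simp only [ContinuousLinearMap.smulRight_apply, smul_apply, smul_eq_mul, phase_apply, coordS_v₁,
    coordS_v₂, coordT_v₁, coordT_v₂] at h3
  have hI := Complex.I_mul_I
  simp only [waveEigenvalue]
  push_cast at h3 ⊢
  linear_combination (-1 / 3) * h3 - 4 / 3 * Real.pi ^ 2 * wave i x *
    (i.1 ^ 2 - i.1 * i.2 + i.2 ^ 2) * hI

theorem waveEigenvalue_neg (i : ℤ × ℤ) : waveEigenvalue (-i) = waveEigenvalue i := by
  simp [waveEigenvalue]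

theorem waveEigenvalue_eq_zero {i : ℤ × ℤ} : waveEigenvalue i = 0 ↔ i = 0 := by
  constructor
  · intro h
    have h' : ((i.1 ^ 2 - i.1 * i.2 + i.2 ^ 2 : ℤ) : ℝ) = 0 :=
      (mul_eq_zero.1 h).resolve_left (by positivity)
    have h'' : i.1 ^ 2 - i.1 * i.2 + i.2 ^ 2 = 0 := by exact_mod_cast h'
    have h1 : i.1 ^ 2 = 0 := by
      nlinarith [sq_nonneg (i.1 - i.2), sq_nonneg i.1, sq_nonneg i.2]
    have h2 : i.2 ^ 2 = 0 := by
      nlinarith [sq_nonneg (i.1 - i.2), sq_nonneg i.1, sq_nonneg i.2]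
    exact Prod.ext (pow_eq_zero_iff two_ne_zero |>.1 h1) (pow_eq_zero_iff two_ne_zero |>.1 h2)
  · rintro rfl
    simp [waveEigenvalue]

theorem finite_waveEigenvalue_le (t : ℝ) : {i : ℤ × ℤ | waveEigenvalue i ≤ t}.Finite := by
  obtain ⟨N, hN⟩ := exists_nat_ge t
  refine (((Finset.Icc (-(N : ℤ)) N) ×ˢ (Finset.Icc (-(N : ℤ)) N)).finite_toSet).subset ?_
  intro i hi
  -- The eigenvalue is `2π²/3` times twice the quadratic form, and twice the form equals `i.1² +
  -- i.2² + (i.1 - i.2)²`. Hence it bounds `i.1² + i.2²` from above.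
  have hpi : 1 ≤ 2 * Real.pi ^ 2 / 3 := by
    have := Real.pi_gt_three
    rw [le_div_iff₀ (by norm_num)]
    nlinarith
  have hsq : (0 : ℝ) ≤ ((i.1 ^ 2 + i.2 ^ 2 : ℤ) : ℝ) := by positivity
  have hle : ((i.1 ^ 2 + i.2 ^ 2 : ℤ) : ℝ) ≤ 2 * ((i.1 ^ 2 - i.1 * i.2 + i.2 ^ 2 : ℤ) : ℝ) := by
    have : i.1 ^ 2 + i.2 ^ 2 ≤ 2 * (i.1 ^ 2 - i.1 * i.2 + i.2 ^ 2) := by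
      nlinarith [sq_nonneg (i.1 - i.2)]
    exact_mod_cast this
  have hb : ((i.1 ^ 2 + i.2 ^ 2 : ℤ) : ℝ) ≤ ((N : ℤ) : ℝ) := by
    have h1 : waveEigenvalue i ≤ t := hi
    have h2 : waveEigenvalue i =
        2 * Real.pi ^ 2 / 3 * (2 * ((i.1 ^ 2 - i.1 * i.2 + i.2 ^ 2 : ℤ) : ℝ)) := by
      rw [waveEigenvalue]; ring
    have h3 : 1 * (2 * ((i.1 ^ 2 - i.1 * i.2 + i.2 ^ 2 : ℤ) : ℝ)) ≤ waveEigenvalue i := by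
      rw [h2]
      exact mul_le_mul_of_nonneg_right hpi (hsq.trans hle)
    push_cast at *
    linarith
  have hb' : i.1 ^ 2 + i.2 ^ 2 ≤ (N : ℤ) := by exact_mod_cast hb
  have n0 : (0 : ℤ) ≤ N := Int.natCast_nonneg N
  simp only [Finset.coe_product, Finset.coe_Icc, mem_prod, mem_Icc]
  refine ⟨⟨?_, ?_⟩, ⟨?_, ?_⟩⟩ <;> nlinarith [sq_nonneg i.1, sq_nonneg i.2]

/-! ### The spectrum of the torus -/

theorem onPlane_add_lattice (u : Torus → ℂ) (x : Plane) {l : Plane} (hl : l ∈ torusLattice) :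
    onPlane u (x + l) = onPlane u x := by
  rw [onPlane, onPlane]
  congr 1
  rw [QuotientAddGroup.eq]
  simpa using hl

theorem SolvesOnTorus.smoothPeriodic {μ : ℝ} {u : Torus → ℂ} (hu : SolvesOnTorus μ u) :
    SmoothPeriodic (onPlane u) :=
  ⟨hu.contDiff, fun x _ hl => onPlane_add_lattice u x hl⟩

theorem SolvesOnTorus.continuous {μ : ℝ} {u : Torus → ℂ} (hu : SolvesOnTorus μ u) :
    Continuous u :=
  isQuotientMap_quot_mk.continuous_iff.2 hu.contDiff.continuous

/-- The waves as functions on the torus. -/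
noncomputable def torusWave (i : ℤ × ℤ) : C(Torus, ℂ) where
  toFun x := Quotient.liftOn' x (wave i) fun a b h => by
    rw [QuotientAddGroup.leftRel_apply] at h
    have := (smoothPeriodic_wave i).periodic a _ h
    rw [← this, add_neg_cancel_left]
  continuous_toFun :=
    isQuotientMap_quot_mk.continuous_iff.2 (smoothPeriodic_wave i).contDiff.continuous

theorem torusWave_mk (i : ℤ × ℤ) (x : Plane) :
    torusWave i (QuotientAddGroup.mk x) = wave i x := rfl

theorem torusWave_add (i j : ℤ × ℤ) : torusWave (i + j) = torusWave i * torusWave j := by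
  ext x
  induction x using QuotientAddGroup.induction_on with
  | H x => exact wave_add i j x

theorem torusWave_zero : torusWave 0 = 1 := by
  ext x
  induction x using QuotientAddGroup.induction_on with
  | H x => exact wave_zero x

theorem torusWave_neg_apply (i : ℤ × ℤ) (x : Torus) : torusWave i (-x) = torusWave (-i) x := by
  induction x using QuotientAddGroup.induction_on with
  | H x => exact (wave_neg i x).symm

theorem star_torusWave (i : ℤ × ℤ) : star (torusWave i) = torusWave (-i) := by
  ext x
  induction x using QuotientAddGroup.induction_on with
  | H x => exact star_wave i x

theorem torusWave_mem (i : ℤ × ℤ) : ⇑(torusWave i) ∈ torusEigenspace (waveEigenvalue i) :=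
  ⟨(smoothPeriodic_wave i).contDiff, laplacian_wave i⟩

/-- The point of the torus with given coordinates. -/
noncomputable def torusPoint (z : ℝ × ℝ) : Torus := QuotientAddGroup.mk (pt z)

theorem continuous_torusPoint : Continuous torusPoint :=
  QuotientAddGroup.continuous_mk.comp continuous_pt

theorem torusPoint_surj (x : Torus) : ∃ z ∈ square, torusPoint z = x := by
  induction x using QuotientAddGroup.induction_on with
  | H x =>
    refine ⟨(Int.fract (coordS x), Int.fract (coordT x)),
      ⟨⟨Int.fract_nonneg _, (Int.fract_lt_one _).le⟩,
        ⟨Int.fract_nonneg _, (Int.fract_lt_one _).le⟩⟩, ?_⟩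
    rw [torusPoint, QuotientAddGroup.eq, mem_torusLattice]
    refine ⟨⌊coordS x⌋, ⌊coordT x⌋, ?_⟩
    have e : -pt (Int.fract (coordS x), Int.fract (coordT x)) + pt (coordS x, coordT x) =
        (⌊coordS x⌋ : ℝ) • v₁ + (⌊coordT x⌋ : ℝ) • v₂ := by
      simp only [pt, Int.fract]
      module
    rwa [pt_coord] at e

instance : CompactSpace Torus := by
  refine ⟨(isCompact_square.image continuous_torusPoint).of_isClosed_subset isClosed_univ ?_⟩
  intro x _
  obtain ⟨z, hz, rfl⟩ := torusPoint_surj x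
  exact ⟨z, hz, rfl⟩

theorem wave_eq_wave_iff_coordS (x y : Plane) :
    wave (1, 0) x = wave (1, 0) y ↔ ∃ n : ℤ, coordS x = coordS y + n := by
  rw [wave, wave, Complex.exp_eq_exp_iff_exists_int]
  refine exists_congr fun n => ?_
  have h : (2 * Real.pi * Complex.I : ℂ) ≠ 0 := Complex.two_pi_I_ne_zero
  have e : phase (1, 0) x = phase (1, 0) y + n * (2 * Real.pi * Complex.I) ↔
      2 * Real.pi * Complex.I * (coordS x : ℂ) =
        2 * Real.pi * Complex.I * ((coordS y : ℂ) + n) := by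
    simp [phase_apply, mul_add, mul_comm]
  rw [e, mul_right_inj' h]
  exact_mod_cast Iff.rfl

theorem wave_eq_wave_iff_coordT (x y : Plane) :
    wave (0, 1) x = wave (0, 1) y ↔ ∃ n : ℤ, coordT x = coordT y + n := by
  rw [wave, wave, Complex.exp_eq_exp_iff_exists_int]
  refine exists_congr fun n => ?_
  have h : (2 * Real.pi * Complex.I : ℂ) ≠ 0 := Complex.two_pi_I_ne_zero
  have e : phase (0, 1) x = phase (0, 1) y + n * (2 * Real.pi * Complex.I) ↔
      2 * Real.pi * Complex.I * (coordT x : ℂ) =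
        2 * Real.pi * Complex.I * ((coordT y : ℂ) + n) := by
    simp [phase_apply, mul_add, mul_comm]
  rw [e, mul_right_inj' h]
  exact_mod_cast Iff.rfl

theorem isSeparatingFamily_torusWave : IsSeparatingFamily torusWave where
  one_mem := Submodule.subset_span ⟨0, torusWave_zero⟩
  mul_mem i j := Submodule.subset_span ⟨i + j, torusWave_add i j⟩
  star_mem i := Submodule.subset_span ⟨-i, (star_torusWave i).symm⟩
  sep x y h := by
    induction x using QuotientAddGroup.induction_on with
    | H x =>
      induction y using QuotientAddGroup.induction_on with
      | H y =>
        obtain ⟨m, hm⟩ := (wave_eq_wave_iff_coordS x y).1 (h (1, 0))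
        obtain ⟨n, hn⟩ := (wave_eq_wave_iff_coordT x y).1 (h (0, 1))
        symm
        rw [QuotientAddGroup.eq, mem_torusLattice]
        refine ⟨m, n, ?_⟩
        rw [← pt_coord x, ← pt_coord y, hm, hn]
        simp only [pt]
        module

/-- The coefficients of an eigenfunction with respect to waves with another eigenvalue vanish. -/
theorem SolvesOnTorus.coeff_eq_zero {μ : ℝ} {u : Torus → ℂ} (hu : SolvesOnTorus μ u)
    {i : ℤ × ℤ} (hi : waveEigenvalue i ≠ μ) :
    ∫ z in square, u (torusPoint z) * torusWave i (torusPoint z) = 0 := by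
  have h := hu.smoothPeriodic.green (smoothPeriodic_wave i)
  have e : ∀ z, wave i (pt z) * (3 * Laplacian.laplacian (onPlane u) (pt z)) -
      onPlane u (pt z) * (3 * Laplacian.laplacian (wave i) (pt z)) =
      (3 * ((waveEigenvalue i : ℂ) - μ)) * (u (torusPoint z) * torusWave i (torusPoint z)) := by
    intro z
    have h1 := hu.equation (pt z)
    have h2 := laplacian_wave i (pt z)
    simp only [torusPoint, torusWave_mk]
    change _ = _ * (onPlane u (pt z) * _)
    linear_combination -3 * wave i (pt z) * h1 + 3 * onPlane u (pt z) * h2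
  simp_rw [e] at h
  rw [integral_const_mul, mul_eq_zero] at h
  refine h.resolve_left ?_
  rw [mul_eq_zero, not_or, sub_eq_zero]
  exact ⟨by norm_num, by exact_mod_cast hi⟩

/-- The map `z ↦ (1, 1) - z` preserves the square and its area, and it induces `x ↦ -x` on the torus
because `v₁ + v₂` is a period. -/
theorem setIntegral_square_neg (F : Torus → ℂ) :
    ∫ z in square, F (-torusPoint z) = ∫ z in square, F (torusPoint z) := by
  have h := (Measure.measurePreserving_sub_left (volume : Measure (ℝ × ℝ))
    ((1, 1) : ℝ × ℝ)).setIntegral_preimage_emb (measurableEmbedding_subLeft _)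
      (fun z => F (torusPoint z)) square
  rw [← h]
  have hpre : (fun z : ℝ × ℝ => (1, 1) - z) ⁻¹' square = square := by
    ext ⟨s, t⟩
    simp only [square, mem_preimage, mem_prod, mem_Icc, Prod.fst_sub, Prod.snd_sub]
    constructor <;> rintro ⟨⟨a, b⟩, c, d⟩ <;> refine ⟨⟨?_, ?_⟩, ?_, ?_⟩ <;> linarith
  rw [hpre]
  congr 1
  funext z
  congr 1
  rw [torusPoint, torusPoint, ← QuotientAddGroup.mk_neg, QuotientAddGroup.eq]
  have e : - -pt z + pt ((1, 1) - z) = v₁ + v₂ := by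
    simp only [pt, Prod.fst_sub, Prod.snd_sub]
    module
  rw [e]
  exact add_mem v₁_mem v₂_mem

/-- The waves with a given eigenvalue. -/
noncomputable def waveIndices (μ : ℝ) : Finset (ℤ × ℤ) :=
  ((finite_waveEigenvalue_le μ).subset
    (fun _ h => le_of_eq h : {i | waveEigenvalue i = μ} ⊆ _)).toFinset

theorem mem_waveIndices {μ : ℝ} {i : ℤ × ℤ} : i ∈ waveIndices μ ↔ waveEigenvalue i = μ := by
  simp [waveIndices]

/-- A half of the waves with a given eigenvalue, which contains one of any two opposite waves. -/
noncomputable def halfIndices (μ : ℝ) : Finset (ℤ × ℤ) :=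
  (waveIndices μ).filter fun i => 0 < i.1 ∨ (i.1 = 0 ∧ 0 < i.2)

theorem ne_zero_of_mem_waveIndices {μ : ℝ} (hμ : μ ≠ 0) {i : ℤ × ℤ} (hi : i ∈ waveIndices μ) :
    ¬(i.1 = 0 ∧ i.2 = 0) := by
  rintro ⟨h1, h2⟩
  have : i = 0 := Prod.ext h1 h2
  rw [mem_waveIndices, waveEigenvalue_eq_zero.2 this] at hi
  exact hμ hi.symm

theorem mem_halfIndices_or {μ : ℝ} (hμ : μ ≠ 0) {i : ℤ × ℤ} (hi : waveEigenvalue i = μ) :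
    i ∈ halfIndices μ ∨ -i ∈ halfIndices μ := by
  have h0 := ne_zero_of_mem_waveIndices hμ (mem_waveIndices.2 hi)
  simp only [halfIndices, Finset.mem_filter, mem_waveIndices, waveEigenvalue_neg, hi, true_and,
    Prod.fst_neg, Prod.snd_neg]
  omega

theorem card_waveIndices {μ : ℝ} (hμ : μ ≠ 0) :
    (waveIndices μ).card = 2 * (halfIndices μ).card := by
  rw [← Finset.card_filter_add_card_filter_not (s := waveIndices μ)
    (fun i => 0 < i.1 ∨ (i.1 = 0 ∧ 0 < i.2)), two_mul]
  congr 1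
  refine Finset.card_nbij' (fun i => -i) (fun i => -i) ?_ ?_ (fun _ _ => neg_neg _)
    (fun _ _ => neg_neg _)
  · intro i hi
    simp only [Finset.coe_filter, Set.mem_ofPred_eq] at hi
    have h0 := ne_zero_of_mem_waveIndices hμ hi.1
    simp only [halfIndices, Finset.coe_filter, Set.mem_ofPred_eq, mem_waveIndices,
      waveEigenvalue_neg, Prod.fst_neg, Prod.snd_neg] at hi ⊢
    exact ⟨hi.1, by omega⟩
  · intro i hi
    simp only [halfIndices, Finset.coe_filter, Set.mem_ofPred_eq, mem_waveIndices,
      waveEigenvalue_neg, Prod.fst_neg, Prod.snd_neg] at hi ⊢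
    exact ⟨hi.1, by omega⟩

theorem torusEigenspace_finrank_le (μ : ℝ) : FiniteDimensional ℂ (torusEigenspace μ) ∧
    Module.finrank ℂ (torusEigenspace μ) ≤ (waveIndices μ).card := by
  refine isSeparatingFamily_torusWave.finrank_le isCompact_square square_subset_closure_interior
    continuous_torusPoint.continuousOn torusPoint_surj _
    (fun u hu => SolvesOnTorus.continuous hu) _ fun u hu h i => ?_
  by_cases hi : waveEigenvalue i = μ
  · exact h i (mem_waveIndices.2 hi)
  · exact SolvesOnTorus.coeff_eq_zero hu hi

instance (μ : ℝ) : FiniteDimensional ℂ (torusEigenspace μ) := (torusEigenspace_finrank_le μ).1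

/-- The waves are pairwise distinct characters of the torus, and distinct characters are linearly
independent. -/
theorem linearIndependent_torusWave :
    LinearIndependent ℂ (fun i : ℤ × ℤ => (torusWave i : Torus → ℂ)) := by
  let χ : ℤ × ℤ → (Multiplicative Torus →* ℂ) := fun i =>
    { toFun := fun x => torusWave i x.toAdd
      map_one' := wave_apply_zero i
      map_mul' := fun x y => by
        change torusWave i (x.toAdd + y.toAdd) = _
        induction x.toAdd using QuotientAddGroup.induction_on with
        | H x =>
          induction y.toAdd using QuotientAddGroup.induction_on with
          | H y => exact wave_apply_add i x y }
  have hχ : Function.Injective χ := by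
    intro i j hij
    have key : ∀ x : Plane, wave (i - j) x = 1 := fun x => by
      have h : wave i x = wave j x :=
        DFunLike.congr_fun hij (Multiplicative.ofAdd (QuotientAddGroup.mk x : Torus))
      have h' := wave_add (i - j) j x
      rw [sub_add_cancel, h] at h'
      have hne : wave j x ≠ 0 := Complex.exp_ne_zero _
      exact mul_right_cancel₀ hne (by rw [← h', one_mul])
    -- A wave that is constantly one has zero derivative at the origin, and this derivative is its
    -- phase.
    have hd : ∀ (k : ℤ × ℤ) (v : Plane), (∀ x, wave k x = 1) → phase k v = 0 := by
      intro k v hk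
      have h1 : fderiv ℝ (wave k) 0 v = 0 := by
        have : wave k = fun _ => 1 := funext hk
        rw [this]
        simp
      simpa [fderiv_wave, hk] using h1
    have h1 := hd (i - j) v₁ key
    have h2 := hd (i - j) v₂ key
    simp [phase_apply, sub_eq_zero] at h1 h2
    exact Prod.ext h1 h2
  exact (linearIndependent_monoidHom (Multiplicative Torus) ℂ).comp χ hχ

theorem finrank_torusEigenspace (μ : ℝ) :
    Module.finrank ℂ (torusEigenspace μ) = (waveIndices μ).card := by
  refine le_antisymm (torusEigenspace_finrank_le μ).2 ?_
  have h : LinearIndependent ℂ (fun i : waveIndices μ =>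
      (⟨torusWave i, by
        have := torusWave_mem i
        rwa [mem_waveIndices.1 i.2] at this⟩ : torusEigenspace μ)) := by
    refine LinearIndependent.of_comp (torusEigenspace μ).subtype ?_
    exact linearIndependent_torusWave.comp (fun i : waveIndices μ => (i : ℤ × ℤ))
      Subtype.val_injective
  simpa using h.fintype_card_le_finrank

/-- The half-turn takes a wave to the opposite wave, so the coefficient at `i` is `σ` times the
coefficient at `-i`. One coefficient from each pair suffices. -/
theorem finrank_le_card_halfIndices {μ : ℝ} (hμ : μ ≠ 0) (W : Submodule ℂ (Torus → ℂ)) (σ : ℂ)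
    (hW : ∀ u ∈ W, ∀ x, u (halfTurn x) = σ * u x) :
    Module.finrank ℂ ↥(torusEigenspace μ ⊓ W) ≤ (halfIndices μ).card := by
  refine (isSeparatingFamily_torusWave.finrank_le isCompact_square square_subset_closure_interior
    continuous_torusPoint.continuousOn torusPoint_surj (torusEigenspace μ ⊓ W)
    (fun u hu => SolvesOnTorus.continuous hu.1) _ fun u hu h i => ?_).2
  by_cases hi : waveEigenvalue i = μ
  · rcases mem_halfIndices_or hμ hi with h' | h'
    · exact h i h'
    · rw [← setIntegral_square_neg (fun x => u x * torusWave i x)]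
      have e : ∀ x, u (-x) * torusWave i (-x) = σ * (u x * torusWave (-i) x) := fun x => by
        rw [torusWave_neg_apply, ← mul_assoc, ← hW u hu.2 x]
        rfl
      simp_rw [e]
      rw [integral_const_mul, h (-i) h', mul_zero]
  · exact SolvesOnTorus.coeff_eq_zero hu.1 hi

/-! ### Splitting of the eigenspaces of the torus under the half-turn -/

theorem SolvesOnTorus.comp_halfTurn {μ : ℝ} {u : Torus → ℂ} (hu : SolvesOnTorus μ u) :
    SolvesOnTorus μ (u ∘ halfTurn) := by
  have e : onPlane (u ∘ halfTurn) = fun x => onPlane u (-x) := rfl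
  refine ⟨?_, fun x => ?_⟩
  · rw [e]
    exact hu.contDiff.comp contDiff_neg
  · have h1 : fderiv ℝ (fun x => onPlane u (-x)) = fun x => -fderiv ℝ (onPlane u) (-x) :=
      funext fun x => by
        simpa using fderiv_comp_smul (𝕜 := ℝ) (f := onPlane u) (x := x) (-1)
    have h2 : fderiv ℝ (fderiv ℝ (fun x => onPlane u (-x))) x =
        fderiv ℝ (fderiv ℝ (onPlane u)) (-x) := by
      have h := fderiv_comp_smul (𝕜 := ℝ) (f := fderiv ℝ (onPlane u)) (x := x) (-1)
      simp only [neg_smul, one_smul] at h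
      rw [h1, fderiv_fun_neg, h, neg_neg]
    have h3 := three_mul_laplacian (fun x => onPlane u (-x)) x
    rw [h2, ← three_mul_laplacian] at h3
    rw [e, mul_left_cancel₀ (by norm_num) h3]
    exact hu.equation (-x)

theorem halfTurn_halfTurn (x : Torus) : halfTurn (halfTurn x) = x := neg_neg x

theorem disjoint_symmetric_skew (V : Submodule ℂ (Torus → ℂ)) :
    Disjoint (V ⊓ symmetricFunctions) (V ⊓ skewFunctions) := by
  rw [Submodule.disjoint_def]
  intro u h1 h2
  funext x
  have h := (h1.2 x).symm.trans (h2.2 x)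
  exact self_eq_neg.1 h

theorem symmetric_sup_skew (μ : ℝ) :
    (torusEigenspace μ ⊓ symmetricFunctions) ⊔ (torusEigenspace μ ⊓ skewFunctions) =
      torusEigenspace μ := by
  refine le_antisymm (sup_le inf_le_left inf_le_left) fun u hu => ?_
  have hu' : u ∘ halfTurn ∈ torusEigenspace μ := SolvesOnTorus.comp_halfTurn hu
  rw [Submodule.mem_sup]
  refine ⟨(1 / 2 : ℂ) • (u + u ∘ halfTurn), ⟨Submodule.smul_mem _ _ (add_mem hu hu'), ?_⟩,
    (1 / 2 : ℂ) • (u - u ∘ halfTurn), ⟨Submodule.smul_mem _ _ (sub_mem hu hu'), ?_⟩, ?_⟩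
  · intro x
    simp [halfTurn_halfTurn, add_comm]
  · intro x
    simp [halfTurn_halfTurn]
    ring
  · funext x
    simp
    ring

/-- Each part is bounded by half of the dimension of the eigenspace, and the two dimensions add up
to all of it, so both bounds are attained. -/
theorem finrank_symmetric_skew {μ : ℝ} (hμ : μ ≠ 0) :
    Module.finrank ℂ ↥(torusEigenspace μ ⊓ symmetricFunctions) = (halfIndices μ).card ∧
      Module.finrank ℂ ↥(torusEigenspace μ ⊓ skewFunctions) = (halfIndices μ).card := by
  have h1 := finrank_le_card_halfIndices hμ symmetricFunctions 1 fun u hu x => by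
    rw [one_mul]; exact hu x
  have h2 := finrank_le_card_halfIndices hμ skewFunctions (-1) fun u hu x => by
    rw [neg_one_mul]; exact hu x
  have : FiniteDimensional ℂ ↥(torusEigenspace μ ⊓ symmetricFunctions) :=
    Submodule.finiteDimensional_of_le inf_le_left
  have : FiniteDimensional ℂ ↥(torusEigenspace μ ⊓ skewFunctions) :=
    Submodule.finiteDimensional_of_le inf_le_left
  have h3 := Submodule.finrank_sup_add_finrank_inf_eq (torusEigenspace μ ⊓ symmetricFunctions)
    (torusEigenspace μ ⊓ skewFunctions)
  rw [(disjoint_symmetric_skew (torusEigenspace μ)).eq_bot, finrank_bot, add_zero,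
    symmetric_sup_skew, finrank_torusEigenspace, card_waveIndices hμ] at h3
  omega

theorem waveIndices_zero : waveIndices 0 = {0} := by
  ext i
  rw [mem_waveIndices, waveEigenvalue_eq_zero, Finset.mem_singleton]

theorem one_mem_torusEigenspace_zero : (fun _ => 1 : Torus → ℂ) ∈ torusEigenspace 0 := by
  have h := torusWave_mem 0
  rw [waveEigenvalue_eq_zero.2 rfl, torusWave_zero] at h
  exact h

theorem torusEigenspace_zero : torusEigenspace 0 = Submodule.span ℂ {fun _ => 1} := by
  symm
  refine Submodule.eq_of_le_of_finrank_le ?_ ?_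
  · rw [Submodule.span_singleton_le_iff_mem]
    exact one_mem_torusEigenspace_zero
  · rw [finrank_torusEigenspace, waveIndices_zero, Finset.card_singleton,
      finrank_span_singleton]
    exact fun h => one_ne_zero (congrFun h 0)

/-- A family of finite-dimensional spaces which vanish except for eigenvalues of waves has
discrete spectrum. -/
theorem hasDiscreteSpectrum_of_finrank_le {F : Type*} [AddCommGroup F] [Module ℂ F]
    {V : ℝ → Submodule ℂ F} (h : ∀ μ, FiniteDimensional ℂ (V μ))
    (h' : ∀ μ, Module.finrank ℂ (V μ) ≤ (waveIndices μ).card) : HasDiscreteSpectrum V := by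
  refine ⟨h, fun t => ((finite_waveEigenvalue_le t).image waveEigenvalue).subset ?_⟩
  rintro μ ⟨hμ, hV⟩
  have hpos : 0 < (waveIndices μ).card := by
    refine lt_of_lt_of_le (Nat.pos_of_ne_zero fun h0 => hV ?_) (h' μ)
    exact Submodule.finrank_eq_zero.1 h0
  obtain ⟨i, hi⟩ := Finset.card_pos.1 hpos
  rw [mem_waveIndices] at hi
  exact ⟨i, by rw [mem_ofPred_eq, hi]; exact hμ, hi⟩

/-! ### The net in coordinates -/

theorem netCorner_zero : netCorner 0 = 0 := by
  ext i
  fin_cases i <;> rfl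

theorem netCorner_one : netCorner 1 = v₁ := rfl

theorem netCorner_two : netCorner 2 = v₂ := rfl

theorem netCorner_mem_torusLattice (k : Fin 3) : netCorner k ∈ torusLattice := by
  fin_cases k
  · exact netCorner_zero ▸ zero_mem _
  · exact v₁_mem
  · exact v₂_mem

theorem pt_mem_net {z : ℝ × ℝ} : pt z ∈ net ↔ z ∈ tri := by
  constructor
  · intro h
    have hconv : Convex ℝ {x : Plane | 0 ≤ coordS x ∧ 0 ≤ coordT x ∧ coordS x + coordT x ≤ 1} := by
      intro x hx y hy a b ha hb hab
      obtain ⟨x1, x2, x3⟩ := hx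
      obtain ⟨y1, y2, y3⟩ := hy
      simp only [Set.mem_ofPred_eq, map_add, map_smul, smul_eq_mul]
      refine ⟨by positivity, by positivity, ?_⟩
      nlinarith [mul_le_mul_of_nonneg_left x3 ha, mul_le_mul_of_nonneg_left y3 hb]
    have hsub : net ⊆ {x : Plane | 0 ≤ coordS x ∧ 0 ≤ coordT x ∧ coordS x + coordT x ≤ 1} := by
      refine convexHull_min ?_ hconv
      rintro _ ⟨k, rfl⟩
      fin_cases k
      · simp [netCorner_zero]
      · simp [netCorner_one]
      · simp [netCorner_two]
    simpa [tri] using hsub h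
  · rintro ⟨h1, h2, h3⟩
    have hc : ∀ i, netCorner i ∈ net := fun i => subset_convexHull ℝ _ ⟨i, rfl⟩
    have e : pt z = ∑ i : Fin 3, (![1 - z.1 - z.2, z.1, z.2] : Fin 3 → ℝ) i • netCorner i := by
      simp [Fin.sum_univ_three, netCorner_zero, netCorner_one, netCorner_two, pt]
    rw [e]
    refine (convex_convexHull ℝ _).sum_mem ?_ ?_ (fun i _ => hc i)
    · intro i _
      fin_cases i
      · simp; linarith
      · simpa using h1
      · simpa using h2
    · simp [Fin.sum_univ_three]
      ring

theorem coord_netCorner (i : Fin 3) : (coordS (netCorner i) = 0 ∨ coordS (netCorner i) = 1) ∧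
    (coordT (netCorner i) = 0 ∨ coordT (netCorner i) = 1) := by
  fin_cases i
  · simp [netCorner_zero]
  · change (coordS v₁ = 0 ∨ coordS v₁ = 1) ∧ (coordT v₁ = 0 ∨ coordT v₁ = 1)
    simp
  · change (coordS v₂ = 0 ∨ coordS v₂ = 1) ∧ (coordT v₂ = 0 ∨ coordT v₂ = 1)
    simp

/-- Only this inclusion is needed, since `halves` serves as the exceptional set throughout. -/
theorem mem_halves_of_pt_mem_netVertices {z : ℝ × ℝ} (h : pt z ∈ netVertices) : z ∈ halves := by
  obtain ⟨i, j, h⟩ := h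
  have h1 := congrArg coordS h
  have h2 := congrArg coordT h
  rw [coordS_pt, midpoint_eq_smul_add, map_smul, map_add] at h1
  rw [coordT_pt, midpoint_eq_smul_add, map_smul, map_add] at h2
  refine ⟨?_, ?_⟩
  · rw [h1]
    rcases (coord_netCorner i).1 with e | e <;> rcases (coord_netCorner j).1 with e' | e' <;>
      rw [e, e'] <;> norm_num
  · rw [h2]
    rcases (coord_netCorner i).2 with e | e <;> rcases (coord_netCorner j).2 with e' | e' <;>
      rw [e, e'] <;> norm_num

theorem net_sdiff_mem_nhds {z : ℝ × ℝ} (hz : z ∈ openTri) : net \ netVertices ∈ nhds (pt z) := by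
  have hc : Continuous fun x => (coordS x, coordT x) := by fun_prop
  have ho : IsOpen ((fun x => (coordS x, coordT x)) ⁻¹' openTri) := isOpen_openTri.preimage hc
  refine Filter.mem_of_superset (ho.mem_nhds (by simpa using hz)) fun x hx => ?_
  rw [← pt_coord x]
  exact ⟨pt_mem_net.2 (openTri_subset_tri hx),
    fun h => openTri_disjoint_halves hx (mem_halves_of_pt_mem_netVertices h)⟩

theorem uniqueDiffOn_net_sdiff : UniqueDiffOn ℝ (net \ netVertices) :=
  uniqueDiffOn_net.inter finite_netVertices.isClosed.isOpen_compl

theorem fderivWithin_net_sdiff (f : Plane → ℂ) {x : Plane} (hx : x ∉ netVertices) :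
    fderivWithin ℝ f (net \ netVertices) x = fderivWithin ℝ f net x :=
  fderivWithin_inter (finite_netVertices.isClosed.isOpen_compl.mem_nhds hx)

theorem pt_mem_netSide_zero {t : ℝ} (ht : t ∈ Icc (0 : ℝ) 1) : pt (t, 1 - t) ∈ netSide 0 :=
  ⟨t, 1 - t, ht.1, by linarith [ht.2], by ring, rfl⟩

theorem pt_mem_netSide_one {t : ℝ} (ht : t ∈ Icc (0 : ℝ) 1) : pt (0, t) ∈ netSide 1 :=
  ⟨t, 1 - t, ht.1, by linarith [ht.2], by ring, by
    change t • netCorner 2 + (1 - t) • netCorner 0 = _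
    simp [netCorner_zero, netCorner_two, pt]⟩

theorem pt_mem_netSide_two {t : ℝ} (ht : t ∈ Icc (0 : ℝ) 1) : pt (t, 0) ∈ netSide 2 :=
  ⟨1 - t, t, by linarith [ht.2], ht.1, by ring, by
    change (1 - t) • netCorner 0 + t • netCorner 1 = _
    simp [netCorner_zero, netCorner_one, pt]⟩

theorem sideFlip_zero (t : ℝ) : sideFlip 0 (pt (t, 1 - t)) = pt (1 - t, t) := by
  change v₁ + v₂ - pt (t, 1 - t) = _
  simp only [pt]
  module

theorem sideFlip_one (t : ℝ) : sideFlip 1 (pt (0, t)) = pt (0, 1 - t) := by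
  change v₂ + netCorner 0 - pt (0, t) = _
  simp only [pt, netCorner_zero]
  module

theorem sideFlip_two (t : ℝ) : sideFlip 2 (pt (t, 0)) = pt (1 - t, 0) := by
  change netCorner 0 + v₁ - pt (t, 0) = _
  simp only [pt, netCorner_zero]
  module

theorem outwardNormal_zero : outwardNormal 0 = (√3)⁻¹ • ((1 / 2 : ℝ) • (v₁ + v₂)) := by
  change (√3)⁻¹ • (midpoint ℝ v₁ v₂ - netCorner 0) = _
  rw [netCorner_zero, midpoint_eq_smul_add, sub_zero]
  norm_num

theorem outwardNormal_one : outwardNormal 1 = (√3)⁻¹ • ((1 / 2 : ℝ) • v₂ - v₁) := by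
  change (√3)⁻¹ • (midpoint ℝ v₂ (netCorner 0) - v₁) = _
  rw [netCorner_zero, midpoint_eq_smul_add, add_zero]
  norm_num

theorem outwardNormal_two : outwardNormal 2 = (√3)⁻¹ • ((1 / 2 : ℝ) • v₁ - v₂) := by
  change (√3)⁻¹ • (midpoint ℝ (netCorner 0) v₁ - v₂) = _
  rw [netCorner_zero, midpoint_eq_smul_add, zero_add]
  norm_num

/-! ### Green's formula on the tetrahedron -/

/-- The regularity of solutions on the tetrahedron: functions on the net which define continuous
functions on the tetrahedron, which are twice continuously differentiable except at the vertices and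
the normal derivatives of which match. -/
structure NetFunction (f : Plane → ℂ) : Prop where
  continuousOn : ContinuousOn f net
  contDiffOn : ContDiffOn ℝ 2 f (net \ netVertices)
  value_match : ∀ k : Fin 3, ∀ x ∈ netSide k, f (sideFlip k x) = f x
  normal_match : ∀ k : Fin 3, ∀ x ∈ netSide k, x ∉ netVertices → sideFlip k x ∉ netVertices →
    fderivWithin ℝ f net x (outwardNormal k) =
      -fderivWithin ℝ f net (sideFlip k x) (outwardNormal k)

theorem NetFunction.sub {f g : Plane → ℂ} (hf : NetFunction f) (hg : NetFunction g) :
    NetFunction (f - g) := by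
  refine ⟨hf.continuousOn.sub hg.continuousOn, hf.contDiffOn.sub hg.contDiffOn, ?_, ?_⟩
  · intro k x hx
    simp only [Pi.sub_apply, hf.value_match k x hx, hg.value_match k x hx]
  · intro k x hx hxv hyv
    have hy := sideFlip_mem_net hx
    have hx' := netSide_subset_net k hx
    rw [fderivWithin_sub (uniqueDiffOn_net x hx')
        (differentiableWithinAt_net hf.contDiffOn hx' hxv)
        (differentiableWithinAt_net hg.contDiffOn hx' hxv),
      fderivWithin_sub (uniqueDiffOn_net _ hy)
        (differentiableWithinAt_net hf.contDiffOn hy hyv)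
        (differentiableWithinAt_net hg.contDiffOn hy hyv), sub_apply, sub_apply,
      hf.normal_match k x hx hxv hyv, hg.normal_match k x hx hxv hyv]
    ring

theorem SmoothPeriodic.netFunction {f : Plane → ℂ} (hf : SmoothPeriodic f)
    (he : ∀ x, f (-x) = f x) : NetFunction f := by
  have hl : ∀ k : Fin 3, netCorner (k + 1) + netCorner (k + 2) ∈ torusLattice := fun k =>
    add_mem (netCorner_mem_torusLattice _) (netCorner_mem_torusLattice _)
  refine ⟨hf.contDiff.continuous.continuousOn, hf.contDiff.contDiffOn,
    fun k x _ => hf.even_sub he x (hl k), fun k x hx _ _ => ?_⟩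
  have hd := hf.contDiff.differentiable (by norm_num)
  rw [(hd x).fderivWithin (uniqueDiffOn_net x (netSide_subset_net k hx)),
    (hd _).fderivWithin (uniqueDiffOn_net _ (sideFlip_mem_net hx)), sideFlip,
    hf.fderiv_sub he x (hl k), neg_apply, neg_neg]

theorem NetFunction.isJetOn {f : Plane → ℂ} (hf : NetFunction f) :
    IsJetOn (jetWithin f (net \ netVertices)) (tri \ halves) openTri :=
  isJetOn_jetWithin hf.contDiffOn uniqueDiffOn_net_sdiff
    (fun _ hz => ⟨pt_mem_net.2 hz.1, fun h => hz.2 (mem_halves_of_pt_mem_netVertices h)⟩)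
    fun _ hz => net_sdiff_mem_nhds hz

theorem NetFunction.continuousOn_comp {f : Plane → ℂ} (hf : NetFunction f) :
    ContinuousOn (fun z => f (pt z)) tri :=
  hf.continuousOn.comp continuous_pt.continuousOn fun _ hz => pt_mem_net.2 hz

/-- Up to the common factor `(√3)⁻¹`, the outward normals of sides `1` and `2` are `v₂/2 - v₁` and
`v₁/2 - v₂`, so the normal derivatives are `-n1` and `-n2`. That of side `0` is `(v₁ + v₂)/2`,
giving `n1 + n2`. -/
theorem NetFunction.matched {f : Plane → ℂ} (hf : NetFunction f) :
    Matched (jetWithin f (net \ netVertices)) halves := by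
  have hs : (((√3)⁻¹ : ℝ) : ℂ) ≠ 0 := by
    rw [Complex.ofReal_ne_zero]
    positivity
  have hnv : ∀ z, z ∉ halves → pt z ∉ netVertices := fun z hz h =>
    hz (mem_halves_of_pt_mem_netVertices h)
  constructor <;> intro t ht
  · have h := hf.value_match 1 _ (pt_mem_netSide_one ht)
    rwa [sideFlip_one] at h
  · have h := hf.value_match 2 _ (pt_mem_netSide_two ht)
    rwa [sideFlip_two] at h
  · have h := hf.value_match 0 _ (pt_mem_netSide_zero ht)
    rwa [sideFlip_zero] at h
  · intro h1 h2
    have h := hf.normal_match 1 _ (pt_mem_netSide_one ht) (hnv _ h1)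
      (by rw [sideFlip_one]; exact hnv _ h2)
    rw [sideFlip_one, ← fderivWithin_net_sdiff f (hnv _ h1),
      ← fderivWithin_net_sdiff f (hnv _ h2), outwardNormal_one] at h
    simp only [map_smul, map_sub, Complex.real_smul] at h
    rw [← mul_neg, mul_right_inj' hs] at h
    simp only [Jet.n1, jetWithin]
    push_cast at h
    linear_combination -h
  · intro h1 h2
    have h := hf.normal_match 2 _ (pt_mem_netSide_two ht) (hnv _ h1)
      (by rw [sideFlip_two]; exact hnv _ h2)
    rw [sideFlip_two, ← fderivWithin_net_sdiff f (hnv _ h1),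
      ← fderivWithin_net_sdiff f (hnv _ h2), outwardNormal_two] at h
    simp only [map_smul, map_sub, Complex.real_smul] at h
    rw [← mul_neg, mul_right_inj' hs] at h
    simp only [Jet.n2, jetWithin]
    push_cast at h
    linear_combination -h
  · intro h1 h2
    have h := hf.normal_match 0 _ (pt_mem_netSide_zero ht) (hnv _ h1)
      (by rw [sideFlip_zero]; exact hnv _ h2)
    rw [sideFlip_zero, ← fderivWithin_net_sdiff f (hnv _ h1),
      ← fderivWithin_net_sdiff f (hnv _ h2), outwardNormal_zero] at h
    simp only [map_smul, map_add, Complex.real_smul] at h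
    rw [← mul_neg, mul_right_inj' hs] at h
    simp only [Jet.n1, Jet.n2, jetWithin]
    push_cast at h
    linear_combination h

/-- The even waves. -/
noncomputable def evenWave (i : ℤ × ℤ) (x : Plane) : ℂ := wave i x + wave (-i) x

theorem smoothPeriodic_evenWave (i : ℤ × ℤ) : SmoothPeriodic (evenWave i) :=
  (smoothPeriodic_wave i).add (smoothPeriodic_wave (-i))

theorem evenWave_neg (i : ℤ × ℤ) (x : Plane) : evenWave i (-x) = evenWave i x := by
  rw [evenWave, evenWave, wave_neg i (-x), wave_neg i x, neg_neg, add_comm]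

/-- Twice the cosine of an angle measured in full turns. -/
noncomputable def cosTurn (x : ℝ) : ℝ := 2 * Real.cos (2 * Real.pi * x)

theorem cosTurn_zero : cosTurn 0 = 2 := by simp [cosTurn]

theorem cosTurn_half : cosTurn (1 / 2) = -2 := by
  rw [cosTurn, show 2 * Real.pi * (1 / 2) = Real.pi by ring, Real.cos_pi]
  norm_num

theorem cosTurn_one : cosTurn 1 = 2 := by simp [cosTurn]

theorem evenWave_pt (i : ℤ × ℤ) (z : ℝ × ℝ) :
    evenWave i (pt z) = (cosTurn (i.1 * z.1 + i.2 * z.2) : ℂ) := by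
  rw [evenWave, wave_neg, wave, wave, map_neg, phase_apply, coordS_pt, coordT_pt, cosTurn]
  push_cast
  rw [Complex.two_cos]
  congr 1 <;> congr 1 <;> ring

/-- The values at the vertices are those of a combination of even waves. -/
theorem NetFunction.exists_interpolation {f : Plane → ℂ} (hf : NetFunction f) :
    ∃ h : Plane → ℂ, SmoothPeriodic h ∧ (∀ x, h (-x) = h x) ∧
      ∀ z ∈ tri, z ∈ halves → f (pt z) = h (pt z) := by
  set a := f (pt (0, 0)) with ha
  set b := f (pt (1 / 2, 0)) with hb
  set c := f (pt (0, 1 / 2)) with hc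
  set d := f (pt (1 / 2, 1 / 2)) with hd
  have h10 : f (pt (1, 0)) = a := by
    have h := hf.value_match 2 _ (pt_mem_netSide_two (t := 0) (by simp))
    rwa [sideFlip_two, sub_zero] at h
  have h01 : f (pt (0, 1)) = a := by
    have h := hf.value_match 1 _ (pt_mem_netSide_one (t := 0) (by simp))
    rwa [sideFlip_one, sub_zero] at h
  -- At half-periods these four even waves take the values `±2`: they are twice the characters of
  -- the group of order four formed by the vertices. The coefficients are the inverse character
  -- transform, `1/4`, with a further `1/2` for the factor two. The corners share the value `a`.
  refine ⟨fun x => ((a + b + c + d) / 8 * evenWave (0, 0) x +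
    (a - b + c - d) / 8 * evenWave (1, 0) x) + ((a + b - c - d) / 8 * evenWave (0, 1) x +
    (a - b - c + d) / 8 * evenWave (1, 1) x), ?_, fun x => by simp only [evenWave_neg], ?_⟩
  · exact (((smoothPeriodic_evenWave _).const_mul _).add
      ((smoothPeriodic_evenWave _).const_mul _)).add
      (((smoothPeriodic_evenWave _).const_mul _).add ((smoothPeriodic_evenWave _).const_mul _))
  · rintro ⟨s, t⟩ ⟨-, -, hst⟩ ⟨p, q⟩
    simp only [mem_insert_iff, mem_singleton_iff] at p q hst
    have c0 := cosTurn_zero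
    have c1 := cosTurn_half
    have c2 := cosTurn_one
    rcases p with rfl | rfl | rfl <;> rcases q with rfl | rfl | rfl <;>
      first
      | (exfalso; linarith)
      | (simp only [h10, h01, ← ha, ← hb, ← hc, ← hd, evenWave_pt, Int.cast_zero, Int.cast_one,
          zero_mul, one_mul, add_zero, zero_add, mul_zero, c0, c1, c2, add_halves]
         push_cast
         ring)

/-- Green's formula on the tetrahedron for a function `f` with Laplacian `Y / 3` and a smooth
function `g`. -/
theorem NetFunction.green {f g : Plane → ℂ} {Y : ℝ × ℝ → ℂ} (hf : NetFunction f)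
    (hY : ContinuousOn Y tri) (hL : ∀ z ∈ openTri, 3 * Laplacian.laplacian f (pt z) = Y z)
    (hg : SmoothPeriodic g) (hge : ∀ x, g (-x) = g x) :
    ∫ z in tri, (g (pt z) * Y z - f (pt z) * (3 * Laplacian.laplacian g (pt z))) = 0 := by
  obtain ⟨h, hh, hhe, hfh⟩ := hf.exists_interpolation
  have hfs := hf.sub (hh.netFunction hhe)
  have gL : ∀ z, (jetWithin g univ).L z = 3 * Laplacian.laplacian g (pt z) := fun z =>
    jetWithin_L Filter.univ_mem
  have cgL : Continuous fun z => 3 * Laplacian.laplacian g (pt z) := by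
    simp_rw [← gL]
    exact continuousOn_univ.1 hg.isJetOn.cL
  have chL : Continuous (jetWithin h univ).L := continuousOn_univ.1 hh.isJetOn.cL
  have cg : Continuous fun z => g (pt z) := hg.contDiff.continuous.comp continuous_pt
  have ch : Continuous fun z => h (pt z) := hh.contDiff.continuous.comp continuous_pt
  -- The difference `f - h` vanishes at the vertices and needs the cutoff; `h` is smooth there and
  -- needs none, so `Z = ∅` in `e2`.
  have e1 := setIntegral_tri_green_of_vanish (Y := fun z => Y z - (jetWithin h univ).L z)
    hfs.isJetOn hfs.continuousOn_comp hfs.matched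
    (fun z hz hz' => sub_eq_zero.2 (hfh z hz hz')) (hY.sub chL.continuousOn) (fun z hz => by
      have hz' := net_sdiff_mem_nhds hz
      rw [jetWithin_L hz', ContDiffAt.laplacian_sub (hf.contDiffOn.contDiffAt hz')
        hh.contDiff.contDiffAt, mul_sub, hL z hz, jetWithin_L Filter.univ_mem])
    hg.isJetOn (hg.matched hge)
  have e2 := setIntegral_tri_green (Z := ∅) isClosed_empty
    (hh.isJetOn.mono (subset_univ _) (subset_univ _))
    (hg.isJetOn.mono (subset_univ _) (subset_univ _)) (hh.matched hhe ∅) (hg.matched hge ∅)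
    (fun _ hz => hz.elim)
  have i1 : IntegrableOn (fun z => g (pt z) * (Y z - (jetWithin h univ).L z) -
      (f (pt z) - h (pt z)) * (3 * Laplacian.laplacian g (pt z))) tri :=
    ((cg.continuousOn.mul (hY.sub chL.continuousOn)).sub
      ((hf.continuousOn_comp.sub ch.continuousOn).mul
        cgL.continuousOn)).integrableOn_compact isCompact_tri
  have i2 : IntegrableOn (fun z => g (pt z) * (jetWithin h univ).L z -
      h (pt z) * (3 * Laplacian.laplacian g (pt z))) tri :=
    ((cg.continuousOn.mul chL.continuousOn).sub
      (ch.continuousOn.mul cgL.continuousOn)).integrableOn_compact isCompact_tri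
  simp only [gL] at e1 e2
  change ∫ z in tri, (g (pt z) * (Y z - (jetWithin h univ).L z) -
      (f (pt z) - h (pt z)) * (3 * Laplacian.laplacian g (pt z))) = 0 at e1
  change ∫ z in tri, (g (pt z) * (jetWithin h univ).L z -
      h (pt z) * (3 * Laplacian.laplacian g (pt z))) = 0 at e2
  have e := integral_add i1 i2
  rw [e1, e2, add_zero] at e
  rw [← e]
  congr 1
  funext z
  ring

/-! ### The spectrum of the tetrahedron -/

theorem onNet_of_mem (u : Tetrahedron → ℂ) {x : Plane} (hx : x ∈ net) :
    onNet u x = u (Quot.mk glue ⟨x, hx⟩) := dif_pos hx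

theorem SolvesOnTetrahedron.netFunction {μ : ℝ} {u : Tetrahedron → ℂ}
    (hu : SolvesOnTetrahedron μ u) : NetFunction (onNet u) := by
  refine ⟨?_, hu.contDiffOn, ?_, hu.normal_match⟩
  · rw [continuousOn_iff_continuous_domRestrict]
    have h : net.domRestrict (onNet u) = u ∘ Quot.mk glue := funext fun x => onNet_of_mem u x.2
    rw [h]
    exact hu.continuous.comp continuous_quot_mk
  · intro k x hx
    rw [onNet_of_mem u (sideFlip_mem_net hx), onNet_of_mem u (netSide_subset_net k hx)]
    exact congrArg u (Quot.sound ⟨k, hx, rfl⟩).symm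

/-- Symmetric functions on the torus as functions on the tetrahedron. -/
noncomputable def descend : symmetricFunctions →ₗ[ℂ] (Tetrahedron → ℂ) where
  toFun U := Quot.lift (fun x : net => U.1 (QuotientAddGroup.mk (x : Plane))) (by
    rintro x y ⟨k, -, hy⟩
    rw [hy, ← U.2 (QuotientAddGroup.mk (x : Plane)), halfTurn, ← QuotientAddGroup.mk_neg]
    refine congrArg U.1 (QuotientAddGroup.eq.2 ?_)
    rw [neg_neg, sideFlip, add_sub_cancel]
    exact add_mem (netCorner_mem_torusLattice _) (netCorner_mem_torusLattice _))
  map_add' U V := by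
    funext x
    induction x using Quot.ind
    rfl
  map_smul' c U := by
    funext x
    induction x using Quot.ind
    rfl

theorem onNet_descend (U : symmetricFunctions) {x : Plane} (hx : x ∈ net) :
    onNet (descend U) x = onPlane U.1 x := onNet_of_mem _ hx

theorem onPlane_symmetric (U : symmetricFunctions) (x : Plane) :
    onPlane U.1 (-x) = onPlane U.1 x := U.2 (QuotientAddGroup.mk x)

/-- A point of the torus or its opposite point lies in the image of the net. -/
theorem exists_mem_net (x : Torus) :
    ∃ y ∈ net, x = QuotientAddGroup.mk y ∨ halfTurn x = QuotientAddGroup.mk y := by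
  obtain ⟨⟨s, t⟩, ⟨⟨hs0, hs1⟩, ht0, ht1⟩, rfl⟩ := torusPoint_surj x
  simp only at hs0 hs1 ht0 ht1
  by_cases h : s + t ≤ 1
  · exact ⟨pt (s, t), pt_mem_net.2 ⟨hs0, ht0, h⟩, Or.inl rfl⟩
  · refine ⟨pt (1 - s, 1 - t), pt_mem_net.2 ⟨by simpa using hs1, by simpa using ht1, ?_⟩,
      Or.inr ?_⟩
    · simp only
      linarith
    · rw [halfTurn, torusPoint, ← QuotientAddGroup.mk_neg, QuotientAddGroup.eq]
      have e : - -pt (s, t) + pt (1 - s, 1 - t) = v₁ + v₂ := by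
        simp only [pt]
        module
      rw [e]
      exact add_mem v₁_mem v₂_mem

/-- The net and its image under the half-turn cover the torus, so a symmetric function is determined
by its values on the net. -/
theorem descend_injective : Function.Injective descend := by
  rw [← LinearMap.ker_eq_bot, LinearMap.ker_eq_bot']
  intro U hU
  ext x
  have key : ∀ y ∈ net, U.1 (QuotientAddGroup.mk y) = 0 := fun y hy => by
    have h := onNet_descend U hy
    rw [hU, onNet_zero] at h
    exact h.symm
  obtain ⟨y, hy, h | h⟩ := exists_mem_net x
  · rw [h]
    exact key y hy
  · have hx := U.2 x
    rw [h, key y hy] at hx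
    exact hx.symm

/-- On the net the descended function agrees with an even smooth periodic function, and regularity,
equation and matching are inherited from it. -/
theorem descend_mem {μ : ℝ} (U : symmetricFunctions) (hU : U.1 ∈ torusEigenspace μ) :
    descend U ∈ tetrahedronEigenspace μ := by
  have hU' : SolvesOnTorus μ U.1 := hU
  have hs := hU'.smoothPeriodic
  have hn := hs.netFunction (onPlane_symmetric U)
  have hcongr : EqOn (onNet (descend U)) (onPlane U.1) net := fun x hx => onNet_descend U hx
  refine ⟨?_, hn.contDiffOn.congr fun x hx => hcongr hx.1, ?_, ?_⟩
  · refine isQuotientMap_quot_mk.continuous_iff.2 ?_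
    exact hU'.continuous.comp (QuotientAddGroup.continuous_mk.comp continuous_subtype_val)
  · intro x hx
    have he : onNet (descend U) =ᶠ[nhds x] onPlane U.1 :=
      Filter.eventuallyEq_of_mem (mem_interior_iff_mem_nhds.1 hx) fun y hy => hcongr hy.1
    rw [(InnerProductSpace.laplacian_congr_nhds he).self_of_nhds, he.self_of_nhds]
    exact hU'.equation x
  · intro k x hx hxv hyv
    have h := hn.normal_match k x hx hxv hyv
    rwa [← fderivWithin_congr hcongr (hcongr (netSide_subset_net k hx)),
      ← fderivWithin_congr hcongr (hcongr (sideFlip_mem_net hx))] at h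

theorem symmetric_evenWave (i : ℤ × ℤ) :
    (torusWave i + torusWave (-i) : Torus → ℂ) ∈ symmetricFunctions := by
  intro x
  simp only [Pi.add_apply, halfTurn, torusWave_neg_apply, neg_neg]
  exact add_comm _ _

/-- The even waves as functions on the tetrahedron. -/
noncomputable def tetrahedronWave (i : ℤ × ℤ) : C(Tetrahedron, ℂ) where
  toFun := descend ⟨_, symmetric_evenWave i⟩
  continuous_toFun := by
    have h := torusWave_mem i
    have h' := torusWave_mem (-i)
    rw [waveEigenvalue_neg] at h'
    exact (descend_mem ⟨_, symmetric_evenWave i⟩ (add_mem h h')).continuous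

theorem tetrahedronWave_mk (i : ℤ × ℤ) (x : net) :
    tetrahedronWave i (Quot.mk glue x) = evenWave i x := rfl

theorem zero_mem_net : (0 : Plane) ∈ net := by
  have h := pt_mem_net (z := (0, 0)).2 ⟨le_rfl, le_rfl, by simp⟩
  simpa [pt] using h

open Classical in
/-- The point of the tetrahedron with given coordinates in the triangle. -/
noncomputable def tetrahedronPoint (z : ℝ × ℝ) : Tetrahedron :=
  if h : pt z ∈ net then Quot.mk glue ⟨pt z, h⟩ else Quot.mk glue ⟨0, zero_mem_net⟩

theorem tetrahedronPoint_of_mem {z : ℝ × ℝ} (hz : z ∈ tri) :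
    tetrahedronPoint z = Quot.mk glue ⟨pt z, pt_mem_net.2 hz⟩ := dif_pos (pt_mem_net.2 hz)

theorem continuousOn_tetrahedronPoint : ContinuousOn tetrahedronPoint tri := by
  rw [continuousOn_iff_continuous_domRestrict]
  have h : tri.domRestrict tetrahedronPoint =
      fun z : tri => Quot.mk glue ⟨pt z, pt_mem_net.2 z.2⟩ :=
    funext fun z => tetrahedronPoint_of_mem z.2
  rw [h]
  exact continuous_quot_mk.comp ((continuous_pt.comp continuous_subtype_val).subtype_mk _)

theorem tetrahedronPoint_surj (x : Tetrahedron) : ∃ z ∈ tri, tetrahedronPoint z = x := by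
  obtain ⟨⟨y, hy⟩, rfl⟩ := Quot.exists_rep x
  have hz : (coordS y, coordT y) ∈ tri := pt_mem_net.1 (by rwa [pt_coord])
  refine ⟨(coordS y, coordT y), hz, ?_⟩
  rw [tetrahedronPoint_of_mem hz]
  congr 1
  exact Subtype.ext (pt_coord y)

instance : CompactSpace Tetrahedron := by
  refine ⟨?_⟩
  have h := isCompact_tri.image_of_continuousOn continuousOn_tetrahedronPoint
  convert h
  ext x
  simpa using tetrahedronPoint_surj x

/-! ### Separation of the points of the tetrahedron by even waves -/

theorem tetrahedronPoint_flip_zero {t : ℝ} (ht : t ∈ Icc (0 : ℝ) 1) :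
    tetrahedronPoint (t, 1 - t) = tetrahedronPoint (1 - t, t) := by
  have h1 : (t, 1 - t) ∈ tri := ⟨ht.1, by simpa using ht.2, by simp⟩
  have h2 : (1 - t, t) ∈ tri := ⟨by simpa using ht.2, ht.1, by simp⟩
  rw [tetrahedronPoint_of_mem h1, tetrahedronPoint_of_mem h2]
  exact Quot.sound ⟨0, pt_mem_netSide_zero ht, (sideFlip_zero t).symm⟩

theorem tetrahedronPoint_flip_one {t : ℝ} (ht : t ∈ Icc (0 : ℝ) 1) :
    tetrahedronPoint (0, t) = tetrahedronPoint (0, 1 - t) := by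
  have h1 : (0, t) ∈ tri := ⟨le_rfl, ht.1, by simpa using ht.2⟩
  have h2 : (0, 1 - t) ∈ tri := ⟨le_rfl, by simpa using ht.2, by simpa using ht.1⟩
  rw [tetrahedronPoint_of_mem h1, tetrahedronPoint_of_mem h2]
  exact Quot.sound ⟨1, pt_mem_netSide_one ht, (sideFlip_one t).symm⟩

theorem tetrahedronPoint_flip_two {t : ℝ} (ht : t ∈ Icc (0 : ℝ) 1) :
    tetrahedronPoint (t, 0) = tetrahedronPoint (1 - t, 0) := by
  have h1 : (t, 0) ∈ tri := ⟨ht.1, le_rfl, by simpa using ht.2⟩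
  have h2 : (1 - t, 0) ∈ tri := ⟨by simpa using ht.2, le_rfl, by simpa using ht.1⟩
  rw [tetrahedronPoint_of_mem h1, tetrahedronPoint_of_mem h2]
  exact Quot.sound ⟨2, pt_mem_netSide_two ht, (sideFlip_two t).symm⟩

theorem tetrahedronPoint_corner₁ : tetrahedronPoint (1, 0) = tetrahedronPoint (0, 0) := by
  have h := tetrahedronPoint_flip_two (t := 1) (by simp)
  rwa [sub_self] at h

theorem tetrahedronPoint_corner₂ : tetrahedronPoint (0, 1) = tetrahedronPoint (0, 0) := by
  have h := tetrahedronPoint_flip_one (t := 1) (by simp)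
  rwa [sub_self] at h

/-- Points of the triangle which agree up to periods define the same point of the tetrahedron. -/
theorem tetrahedronPoint_eq_of_add {s t : ℝ} {m n : ℤ} (h : (s, t) ∈ tri)
    (h' : (s + m, t + n) ∈ tri) : tetrahedronPoint (s + m, t + n) = tetrahedronPoint (s, t) := by
  obtain ⟨a, b, c⟩ := h
  obtain ⟨a', b', c'⟩ := h'
  simp only at a b c a' b' c'
  have m1 : (-1 : ℤ) ≤ m := by
    have : ((-1 : ℤ) : ℝ) ≤ m := by push_cast; linarith
    exact_mod_cast this
  have m2 : m ≤ 1 := by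
    have : (m : ℝ) ≤ ((1 : ℤ) : ℝ) := by push_cast; linarith
    exact_mod_cast this
  have n1 : (-1 : ℤ) ≤ n := by
    have : ((-1 : ℤ) : ℝ) ≤ n := by push_cast; linarith
    exact_mod_cast this
  have n2 : n ≤ 1 := by
    have : (n : ℝ) ≤ ((1 : ℤ) : ℝ) := by push_cast; linarith
    exact_mod_cast this
  have c1 := tetrahedronPoint_corner₁
  have c2 := tetrahedronPoint_corner₂
  -- Both points lie in the unit square, so each shift is `-1`, `0` or `1`. A nonzero shift is
  -- possible only between two corners of the net, and these are all identified.
  interval_cases m <;> interval_cases n <;> push_cast at a' b' c' ⊢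
  · exfalso; linarith
  · obtain rfl : s = 1 := by linarith
    obtain rfl : t = 0 := by linarith
    norm_num [c1]
  · obtain rfl : s = 1 := by linarith
    obtain rfl : t = 0 := by linarith
    norm_num [c1, c2]
  · obtain rfl : t = 1 := by linarith
    obtain rfl : s = 0 := by linarith
    norm_num [c2]
  · norm_num
  · obtain rfl : t = 0 := by linarith
    obtain rfl : s = 0 := by linarith
    norm_num [c2]
  · obtain rfl : t = 1 := by linarith
    obtain rfl : s = 0 := by linarith
    norm_num [c1, c2]
  · obtain rfl : s = 0 := by linarith
    obtain rfl : t = 0 := by linarith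
    norm_num [c1]
  · exfalso; linarith

/-- Points of the triangle which agree up to periods and the half-turn define the same point of
the tetrahedron. -/
theorem tetrahedronPoint_eq_of_sub {s t : ℝ} {m n : ℤ} (h : (s, t) ∈ tri)
    (h' : (m - s, n - t) ∈ tri) : tetrahedronPoint (m - s, n - t) = tetrahedronPoint (s, t) := by
  obtain ⟨a, b, c⟩ := h
  obtain ⟨a', b', c'⟩ := h'
  simp only at a b c a' b' c'
  have m1 : (0 : ℤ) ≤ m := by
    have : ((0 : ℤ) : ℝ) ≤ m := by push_cast; linarith
    exact_mod_cast this
  have m2 : m ≤ 2 := by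
    have : (m : ℝ) ≤ ((2 : ℤ) : ℝ) := by push_cast; linarith
    exact_mod_cast this
  have n1 : (0 : ℤ) ≤ n := by
    have : ((0 : ℤ) : ℝ) ≤ n := by push_cast; linarith
    exact_mod_cast this
  have n2 : n ≤ 2 := by
    have : (n : ℝ) ≤ ((2 : ℤ) : ℝ) := by push_cast; linarith
    exact_mod_cast this
  -- The pairs `(0, 1)`, `(1, 0)` and `(1, 1)` are the foldings of the three sides. Each of the
  -- others fixes a corner or is impossible.
  interval_cases m <;> interval_cases n <;> push_cast at a' b' c' ⊢
  · obtain rfl : s = 0 := by linarith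
    obtain rfl : t = 0 := by linarith
    norm_num
  · obtain rfl : s = 0 := by linarith
    rw [sub_zero, ← tetrahedronPoint_flip_one ⟨b, by linarith⟩]
  · obtain rfl : s = 0 := by linarith
    obtain rfl : t = 1 := by linarith
    norm_num
  · obtain rfl : t = 0 := by linarith
    rw [sub_zero, ← tetrahedronPoint_flip_two ⟨a, by linarith⟩]
  · obtain rfl : t = 1 - s := by linarith
    rw [sub_sub_cancel, ← tetrahedronPoint_flip_zero ⟨a, by linarith⟩]
  · exfalso; linarith
  · obtain rfl : s = 1 := by linarith
    obtain rfl : t = 0 := by linarith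
    norm_num
  · exfalso; linarith
  · exfalso; linarith

theorem cosTurn_eq_cosTurn {x y : ℝ} (h : cosTurn x = cosTurn y) :
    ∃ k : ℤ, y = k + x ∨ y = k - x := by
  have h' : Real.cos (2 * Real.pi * x) = Real.cos (2 * Real.pi * y) :=
    mul_left_cancel₀ two_ne_zero h
  obtain ⟨k, hk⟩ := Real.cos_eq_cos_iff.1 h'
  have hpi : 2 * Real.pi ≠ 0 := by positivity
  refine ⟨k, hk.imp (fun e => mul_left_cancel₀ hpi ?_) (fun e => mul_left_cancel₀ hpi ?_)⟩
  · rw [e]; ring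
  · rw [e]; ring

/-- The first two cosines determine the coordinates up to integers and independent signs. The cosine
of the sum shows that a common sign can be chosen, and then the points differ by a period, possibly
after the half-turn. -/
theorem tetrahedronPoint_eq_of_cosTurn {s t s' t' : ℝ} (h : (s, t) ∈ tri) (h' : (s', t') ∈ tri)
    (hs : cosTurn s = cosTurn s') (ht : cosTurn t = cosTurn t')
    (hst : cosTurn (s + t) = cosTurn (s' + t')) :
    tetrahedronPoint (s, t) = tetrahedronPoint (s', t') := by
  have plus : ∀ m n : ℤ, s' = s + m → t' = t + n →
      tetrahedronPoint (s, t) = tetrahedronPoint (s', t') := by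
    rintro m n rfl rfl
    exact (tetrahedronPoint_eq_of_add h h').symm
  have minus : ∀ m n : ℤ, s' = m - s → t' = n - t →
      tetrahedronPoint (s, t) = tetrahedronPoint (s', t') := by
    rintro m n rfl rfl
    exact (tetrahedronPoint_eq_of_sub h h').symm
  obtain ⟨m, hm⟩ := cosTurn_eq_cosTurn hs
  obtain ⟨n, hn⟩ := cosTurn_eq_cosTurn ht
  obtain ⟨k, hk⟩ := cosTurn_eq_cosTurn hst
  rcases hm with hm | hm <;> rcases hn with hn | hn
  · exact plus m n (by linarith) (by linarith)
  · rcases hk with hk | hk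
    · exact plus m (k - m) (by linarith) (by push_cast; linarith)
    · exact minus (k - n) n (by push_cast; linarith) (by linarith)
  · rcases hk with hk | hk
    · exact plus (k - n) n (by push_cast; linarith) (by linarith)
    · exact minus m (k - m) (by linarith) (by push_cast; linarith)
  · exact minus m n (by linarith) (by linarith)

theorem tetrahedronWave_point (i : ℤ × ℤ) {z : ℝ × ℝ} (hz : z ∈ tri) :
    tetrahedronWave i (tetrahedronPoint z) = (cosTurn (i.1 * z.1 + i.2 * z.2) : ℂ) := by
  rw [tetrahedronPoint_of_mem hz, tetrahedronWave_mk, evenWave_pt]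

/-- Even waves are twice cosines: the product-to-sum formula makes their span an algebra, they are
real, and the constant wave has the value two. The indices `(1, 0)`, `(0, 1)` and `(1, 1)` already
separate points. -/
theorem isSeparatingFamily_tetrahedronWave : IsSeparatingFamily tetrahedronWave where
  one_mem := by
    have h : (1 : C(Tetrahedron, ℂ)) = (1 / 2 : ℂ) • tetrahedronWave 0 := by
      ext x
      induction x using Quot.ind with
      | mk x =>
        rw [ContinuousMap.smul_apply, tetrahedronWave_mk, evenWave, neg_zero, wave_zero]
        norm_num
    rw [h]
    exact Submodule.smul_mem _ _ (Submodule.subset_span ⟨0, rfl⟩)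
  mul_mem i j := by
    have h : tetrahedronWave i * tetrahedronWave j =
        tetrahedronWave (i + j) + tetrahedronWave (i - j) := by
      ext x
      induction x using Quot.ind with
      | mk x =>
        simp only [ContinuousMap.mul_apply, ContinuousMap.add_apply, tetrahedronWave_mk, evenWave,
          sub_eq_add_neg, neg_add, wave_add, neg_neg]
        ring
    rw [h]
    exact add_mem (Submodule.subset_span ⟨_, rfl⟩) (Submodule.subset_span ⟨_, rfl⟩)
  star_mem i := by
    have h : star (tetrahedronWave i) = tetrahedronWave i := by
      ext x
      induction x using Quot.ind with
      | mk x =>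
        rw [ContinuousMap.star_apply, tetrahedronWave_mk, evenWave, star_add, star_wave, star_wave,
          neg_neg, add_comm]
    rw [h]
    exact Submodule.subset_span ⟨i, rfl⟩
  sep x y h := by
    obtain ⟨⟨s, t⟩, hz, rfl⟩ := tetrahedronPoint_surj x
    obtain ⟨⟨s', t'⟩, hz', rfl⟩ := tetrahedronPoint_surj y
    have key : ∀ i : ℤ × ℤ, cosTurn (i.1 * s + i.2 * t) = cosTurn (i.1 * s' + i.2 * t') := by
      intro i
      have := h i
      rw [tetrahedronWave_point i hz, tetrahedronWave_point i hz'] at this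
      exact_mod_cast this
    refine tetrahedronPoint_eq_of_cosTurn hz hz' ?_ ?_ ?_
    · simpa using key (1, 0)
    · simpa using key (0, 1)
    · simpa using key (1, 1)

/-- The coefficients of an eigenfunction with respect to waves with another eigenvalue vanish. -/
theorem SolvesOnTetrahedron.coeff_eq_zero {μ : ℝ} {u : Tetrahedron → ℂ}
    (hu : SolvesOnTetrahedron μ u) {i : ℤ × ℤ} (hi : waveEigenvalue i ≠ μ) :
    ∫ z in tri, u (tetrahedronPoint z) * tetrahedronWave i (tetrahedronPoint z) = 0 := by
  have hn := hu.netFunction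
  -- The equation holds only inside the net, but its right-hand side is continuous up to the sides
  -- and at the vertices, as Green's formula requires.
  have h := hn.green (Y := fun z => -3 * μ * onNet u (pt z))
    (continuousOn_const.mul hn.continuousOn_comp) (fun z hz => by
      have := hu.equation (pt z) (mem_interior_iff_mem_nhds.2 (net_sdiff_mem_nhds hz))
      linear_combination -3 * this) (smoothPeriodic_evenWave i) (evenWave_neg i)
  have e : ∀ z ∈ tri, evenWave i (pt z) * (-3 * μ * onNet u (pt z)) -
      onNet u (pt z) * (3 * Laplacian.laplacian (evenWave i) (pt z)) =
      (3 * ((waveEigenvalue i : ℂ) - μ)) *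
        (u (tetrahedronPoint z) * tetrahedronWave i (tetrahedronPoint z)) := by
    intro z hz
    have h1 := laplacian_wave i (pt z)
    have h2 := laplacian_wave (-i) (pt z)
    rw [waveEigenvalue_neg] at h2
    have h3 : Laplacian.laplacian (evenWave i) (pt z) = Laplacian.laplacian (wave i) (pt z) +
        Laplacian.laplacian (wave (-i)) (pt z) :=
      (smoothPeriodic_wave i).contDiff.contDiffAt.laplacian_add
        (smoothPeriodic_wave (-i)).contDiff.contDiffAt
    rw [h3, tetrahedronPoint_of_mem hz, tetrahedronWave_mk, onNet_of_mem u (pt_mem_net.2 hz),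
      evenWave]
    linear_combination 3 * u (Quot.mk glue ⟨pt z, pt_mem_net.2 hz⟩) * (h1 + h2)
  rw [setIntegral_congr_fun isClosed_tri.measurableSet e, integral_const_mul, mul_eq_zero] at h
  refine h.resolve_left ?_
  rw [mul_eq_zero, not_or, sub_eq_zero]
  exact ⟨by norm_num, by exact_mod_cast hi⟩

theorem tetrahedronWave_neg (i : ℤ × ℤ) : tetrahedronWave (-i) = tetrahedronWave i := by
  ext x
  induction x using Quot.ind with
  | mk x => rw [tetrahedronWave_mk, tetrahedronWave_mk, evenWave, evenWave, neg_neg, add_comm]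

/-- Opposite indices give the same even wave, so one of each pair suffices. The set `T` is left free
to cover both `halfIndices μ` for `μ ≠ 0` and `waveIndices 0`, where the index is its own opposite.
-/
theorem tetrahedronEigenspace_finrank_le {μ : ℝ} (T : Finset (ℤ × ℤ))
    (hT : ∀ i, waveEigenvalue i = μ → i ∈ T ∨ -i ∈ T) :
    FiniteDimensional ℂ (tetrahedronEigenspace μ) ∧
      Module.finrank ℂ (tetrahedronEigenspace μ) ≤ T.card := by
  refine isSeparatingFamily_tetrahedronWave.finrank_le isCompact_tri tri_subset_closure_interior
    continuousOn_tetrahedronPoint tetrahedronPoint_surj _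
    (fun u hu => SolvesOnTetrahedron.continuous hu) _ fun u hu h i => ?_
  by_cases hi : waveEigenvalue i = μ
  · rcases hT i hi with h' | h'
    · exact h i h'
    · rw [← tetrahedronWave_neg]
      exact h (-i) h'
  · exact SolvesOnTetrahedron.coeff_eq_zero hu hi

instance (μ : ℝ) : FiniteDimensional ℂ (tetrahedronEigenspace μ) :=
  (tetrahedronEigenspace_finrank_le (waveIndices μ)
    fun _ hi => Or.inl (mem_waveIndices.2 hi)).1

/-! ### Multiplicities and counting functions -/

theorem finrank_symmetric_le (μ : ℝ) :
    Module.finrank ℂ ↥(torusEigenspace μ ⊓ symmetricFunctions) ≤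
      Module.finrank ℂ (tetrahedronEigenspace μ) := by
  let Φ : ↥(torusEigenspace μ ⊓ symmetricFunctions) →ₗ[ℂ] tetrahedronEigenspace μ :=
    (descend ∘ₗ Submodule.inclusion inf_le_right).codRestrict _
      fun U => descend_mem _ U.2.1
  refine LinearMap.finrank_le_finrank_of_injective (f := Φ) ?_
  rw [LinearMap.injective_codRestrict_iff]
  exact descend_injective.comp (Submodule.inclusion_injective _)

theorem finrank_tetrahedronEigenspace {μ : ℝ} (hμ : μ ≠ 0) :
    Module.finrank ℂ (tetrahedronEigenspace μ) = (halfIndices μ).card :=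
  le_antisymm
    (tetrahedronEigenspace_finrank_le _ fun _ hi => mem_halfIndices_or hμ hi).2
    ((finrank_symmetric_skew hμ).1 ▸ finrank_symmetric_le μ)

theorem finrank_tetrahedronEigenspace_zero :
    Module.finrank ℂ (tetrahedronEigenspace 0) = 1 := by
  refine le_antisymm ?_ ?_
  · have h := (tetrahedronEigenspace_finrank_le (waveIndices 0)
      fun _ hi => Or.inl (mem_waveIndices.2 hi)).2
    rwa [waveIndices_zero, Finset.card_singleton] at h
  · refine le_trans ?_ (finrank_symmetric_le 0)
    have : FiniteDimensional ℂ ↥(torusEigenspace 0 ⊓ symmetricFunctions) :=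
      Submodule.finiteDimensional_of_le inf_le_left
    rw [Nat.one_le_iff_ne_zero, Ne, Submodule.finrank_eq_zero, Submodule.eq_bot_iff]
    push Not
    exact ⟨fun _ => 1, ⟨one_mem_torusEigenspace_zero, fun _ => rfl⟩,
      fun h => one_ne_zero (congrFun h 0)⟩

/-- Up to a correction for the constants, the multiplicities on the torus are twice those on the
tetrahedron. -/
theorem two_mul_finrank_tetrahedronEigenspace (μ : ℝ) :
    2 * Module.finrank ℂ (tetrahedronEigenspace μ) =
      Module.finrank ℂ (torusEigenspace μ) + if μ = 0 then 1 else 0 := by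
  rw [finrank_torusEigenspace]
  by_cases hμ : μ = 0
  · subst hμ
    rw [finrank_tetrahedronEigenspace_zero, waveIndices_zero]
    simp
  · rw [finrank_tetrahedronEigenspace hμ, card_waveIndices hμ, if_neg hμ, add_zero]

theorem hasDiscreteSpectrum_torus : HasDiscreteSpectrum torusEigenspace :=
  hasDiscreteSpectrum_of_finrank_le (fun μ => (torusEigenspace_finrank_le μ).1)
    fun μ => (torusEigenspace_finrank_le μ).2

theorem hasDiscreteSpectrum_tetrahedron : HasDiscreteSpectrum tetrahedronEigenspace := by
  have h := fun μ => tetrahedronEigenspace_finrank_le (waveIndices μ)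
    fun _ hi => Or.inl (mem_waveIndices.2 hi)
  exact hasDiscreteSpectrum_of_finrank_le (fun μ => (h μ).1) fun μ => (h μ).2

/-- The counting function as a sum over any finite set which contains the eigenvalues. -/
theorem countingFunction_eq_sum {F : Type*} [AddCommGroup F] [Module ℂ F]
    {V : ℝ → Submodule ℂ F} {t : ℝ} {s : Finset ℝ} (hs : ∀ μ ∈ s, μ ≤ t)
    (hV : ∀ μ, μ ≤ t → V μ ≠ ⊥ → μ ∈ s) :
    countingFunction V t = ∑ μ ∈ s, Module.finrank ℂ (V μ) := by
  rw [countingFunction, finsum_eq_sum_of_support_subset (s := s)]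
  · refine Finset.sum_congr rfl fun μ hμ => ?_
    rw [finsum_eq_if, if_pos (hs μ hμ)]
  · intro μ hμ
    rw [Function.mem_support, finsum_eq_if] at hμ
    by_cases h : μ ≤ t
    · rw [if_pos h] at hμ
      refine hV μ h fun h0 => hμ ?_
      rw [h0, finrank_bot]
    · exact absurd (if_neg h) hμ

theorem two_mul_countingFunction {t : ℝ} (ht : 0 ≤ t) :
    2 * countingFunction tetrahedronEigenspace t = countingFunction torusEigenspace t + 1 := by
  classical
  -- One index set serves both sums. It contains `0`, admissible because `0 ≤ t`, so the correction
  -- at `μ = 0` is counted exactly once.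
  let s : Finset ℝ := insert 0 ((hasDiscreteSpectrum_tetrahedron.2 t).toFinset ∪
    (hasDiscreteSpectrum_torus.2 t).toFinset)
  have hs : ∀ μ ∈ s, μ ≤ t := by
    intro μ hμ
    simp only [s, Finset.mem_insert, Finset.mem_union, Finite.mem_toFinset, mem_ofPred_eq] at hμ
    rcases hμ with rfl | h | h
    · exact ht
    · exact h.1
    · exact h.1
  rw [countingFunction_eq_sum (s := s) hs fun μ h h' => by simp [s, h, h'],
    countingFunction_eq_sum (s := s) hs fun μ h h' => by simp [s, h, h'], Finset.mul_sum]
  simp_rw [two_mul_finrank_tetrahedronEigenspace]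
  rw [Finset.sum_add_distrib, Finset.sum_ite_eq' s 0]
  simp [s]

end TetrahedronSpectrum

theorem mainTheorem2 :
    HasDiscreteSpectrum tetrahedronEigenspace ∧
    HasDiscreteSpectrum torusEigenspace ∧
    -- every torus eigenspace splits into its symmetric and its skew-symmetric part
    (∀ μ : ℝ,
      (torusEigenspace μ ⊓ symmetricFunctions) ⊔ (torusEigenspace μ ⊓ skewFunctions) =
          torusEigenspace μ ∧
        Disjoint (torusEigenspace μ ⊓ symmetricFunctions) (torusEigenspace μ ⊓ skewFunctions)) ∧
    -- the eigenfunctions for the eigenvalue zero are the constants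
    torusEigenspace 0 = Submodule.span ℂ {fun _ => 1} ∧
    -- for the other eigenvalues the two parts have the same dimension
    (∀ μ : ℝ, μ ≠ 0 →
      Module.finrank ℂ ↥(torusEigenspace μ ⊓ symmetricFunctions) =
        Module.finrank ℂ ↥(torusEigenspace μ ⊓ skewFunctions)) ∧
    -- the counting functions
    (∀ t : ℝ, 0 ≤ t →
      (countingFunction tetrahedronEigenspace t : ℝ) =
        1 / 2 * (countingFunction torusEigenspace t : ℝ) + 1 / 2) := by
  refine ⟨hasDiscreteSpectrum_tetrahedron, hasDiscreteSpectrum_torus,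
    fun μ => ⟨symmetric_sup_skew μ, disjoint_symmetric_skew _⟩, torusEigenspace_zero,
    fun μ hμ => (finrank_symmetric_skew hμ).1.trans (finrank_symmetric_skew hμ).2.symm,
    fun t ht => ?_⟩
  have h : (2 * countingFunction tetrahedronEigenspace t : ℝ) =
      countingFunction torusEigenspace t + 1 := by exact_mod_cast two_mul_countingFunction ht
  linarith
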